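/- All graphs are finite and simple, $N(v)$ is the neighborhood of a vertex $v$, $N(A)=\bigcup_{a\in A}N(a)$, and $N^i(r)$ is the set of vertices at distance $i$ from $r$. A bipartite graph is chordal bipartite if all its induced cycles have length four. A partial order $\pi$ on $V(G)$ is a reflexive, antisymmetric and transitive set of pairs, $|\pi|$ is the number of its pairs, and $x\prec_\pi y$ means $(x,y)\in\pi$ and $x\ne y$. A vertex ordering $\sigma$ is a linear extension of $\pi$ if $x\prec_\pi y$ implies that $x$ is to the left of $y$ in $\sigma$. An LBFS ordering is a vertex ordering that arises as follows. In step $i=1,\dots,|V(G)|$ an eligible vertex gets number $i$. Here the label of an unnumbered vertex is the set of the numbers of its numbered neighbors, and an unnumbered vertex $x$ is eligible if there is no unnumbered $y$ whose label $B$ is larger than the label $A$ of $x$, i.e., with $A\subsetneq B$ or ($A\setminus B$ and $B\setminus A$ nonempty and $\min(A\setminus B)>\min(B\setminus A)$). For a vertex ordering $\rho$, LBFS$^+(\rho)$ is the LBFS ordering obtained by always choosing the eligible vertex that is leftmost in $\rho$. For a set $M$ and a set $\mathcal R$ of pairs of subsets of $M$, an OBA-ordering is a linear ordering of $M$ such that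 for all $(A,B)\in\mathcal R$ with $B\neq\emptyset$ there is an $x\in A$ that is to the left of all $y\in B$. **Algorithm.** The input is a connected chordal bipartite graph $G$, a partial order $\pi$ on $V(G)$ and a vertex $r$. Let $k$ be the maximal distance of a vertex from $r$. 1. If there is $(x,y)\in\pi$ with $x$ in a later layer $N^i(r)$ than $y$, reject. 2. For $1\le i\le k$ let $\mathcal R_i=\{(\{x\},\{y\}) : x,y\in N^i(r),\ x\prec_\pi y\}$. 3. For $i=k,k-1,\dots,2$ and every $(A,B)\in\mathcal R_i$, add the pair $(A'',B')$ to $\mathcal R_{i-1}$, where $A'=(N(A)\cap N^{i-1}(r))\setminus N(B)$, $A''=\{v\in A' : N(v)\cap N^{i-2}(r)=N(A')\cap N^{i-2}(r)\}$ and $B'=(N(B)\cap N^{i-1}(r))\setminus N(A)$. 4. If for some $1\le i\le k$ there is no OBA-ordering for $(N^i(r),\mathcal R_i)$, reject. Otherwise choose an arbitrary OBA-ordering $\sigma_i$ for every $i$, let $\rho$ be the concatenation of $r,\sigma_1,\dots,\sigma_k$, and return $\sigma=\mathrm{LBFS}^+(\rho)$. **Theorem.** The algorithm decides in time $O(|\pi|\cdot|V(G)|^2)$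 whether there is an LBFS ordering of $G$ that starts in $r$ and is a linear extension of $\pi$. In detail: (a) For every connected chordal bipartite graph $G$, every partial order $\pi$ on $V(G)$ and every $r\in V(G)$ the algorithm yields a result. Whatever OBA-orderings it chooses, if it rejects, then no LBFS ordering of $G$ starting in $r$ is a linear extension of $\pi$, and if it returns $\sigma$, then $\sigma$ is an LBFS ordering of $G$ that starts in $r$ and is a linear extension of $\pi$. (b) The algorithm can be implemented in this time on a unit-cost random access machine: there are a program and a constant $C$ such that, for every input consisting of a connected chordal bipartite graph $G$ with vertex set $\{0,\dots,n-1\}$ (given by its adjacency matrix), a vertex $r$ and a partial order $\pi$ on $V(G)$ (given as the list of its pairs, in any order), the program halts after at most $C\cdot|\pi|\cdot n^2$ steps and has carried out a run of the algorithm. That is, it has stored the sets $\mathcal R_1,\dots,\mathcal R_k$ (unless it rejects in item 1), it accepts if and only if there is an LBFS ordering of $G$ that starts in $r$ and is a linear extension of $\pi$, and if it accepts, it has stored $\rho$ and $\sigma$. (The operations of the machine are access to registers and to cells of three-dimensional arrays of natural numbers, adding one, truncated subtraction, comparison, and loops whose number of iterations is fixed on entry; each operation counts as one step.) -/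

import Mathlib

/-! ### Chordal bipartite graphs and BFS layers -/

/-- A bipartite graph is chordal bipartite if every induced cycle has length four. An induced cycle
of length `m` is an induced copy of the cycle graph on `m ≥ 3` vertices. -/
def IsChordalBipartite {V : Type*} (G : SimpleGraph V) : Prop :=
  G.IsBipartite ∧ ∀ m : ℕ, 3 ≤ m → Nonempty (SimpleGraph.cycleGraph m ↪g G) → m = 4

/-- The layer `N^i(r)`: all vertices at distance exactly `i` from `r` (for connected graphs). -/
def layer {V : Type*} (G : SimpleGraph V) (r : V) (i : ℕ) : Set V :=
  {v | G.dist r v = i}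

/-- The maximal distance of a vertex from `r`. -/
noncomputable def depth {V : Type*} [Fintype V] (G : SimpleGraph V) (r : V) : ℕ :=
  Finset.univ.sup (fun v => G.dist r v)

/-- The neighborhood of a set: the union of the neighborhoods of its elements. -/
def setNeighbors {V : Type*} (G : SimpleGraph V) (A : Set V) : Set V :=
  {v | ∃ a ∈ A, G.Adj a v}

/-! ### Vertex orderings -/

/-- A list containing every vertex exactly once. -/
def IsVertexOrdering {V : Type*} (σ : List V) : Prop :=
  σ.Nodup ∧ ∀ v, v ∈ σ

/-- `x` is to the left of `y` in `σ`. -/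
def Before {V : Type*} [DecidableEq V] (σ : List V) (x y : V) : Prop :=
  σ.idxOf x < σ.idxOf y

/-- `σ` is a linear extension of `π`: if `x ≺_π y`, i.e. `(x, y) ∈ π` and `x ≠ y`, then `x` is to
the left of `y` in `σ`. -/
def IsLinearExtension {V : Type*} [DecidableEq V] (π : V → V → Prop) (σ : List V) : Prop :=
  ∀ x y, π x y → x ≠ y → Before σ x y

/-! ### Lexicographic breadth first search -/

/-- The label order of LBFS: `A ⊊ B` or `min (A \ B) > min (B \ A)`, where the second alternative
requires both minima to exist. -/
def LabelLess (A B : Set ℕ) : Prop :=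
  A ⊂ B ∨ ((A \ B).Nonempty ∧ (B \ A).Nonempty ∧ sInf (B \ A) < sInf (A \ B))

/-- The label of `v` after the vertices of the list `p` have been numbered in this order: the
numbers of the neighbors of `v` in `p`. The first vertex gets the number `1`. -/
def label {V : Type*} (G : SimpleGraph V) (p : List V) (v : V) : Set ℕ :=
  {j | ∃ i u, p[i]? = some u ∧ G.Adj u v ∧ j = i + 1}

/-- `x` may be numbered next by LBFS after the vertices of `p` have been numbered. -/
def Eligible {V : Type*} (G : SimpleGraph V) (p : List V) (x : V) : Prop :=
  x ∉ p ∧ ¬ ∃ y, y ∉ p ∧ LabelLess (label G p x) (label G p y)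

/-- `σ` can be the output of LBFS: in every step an eligible vertex is numbered. -/
def IsLBFSOrdering {V : Type*} (G : SimpleGraph V) (σ : List V) : Prop :=
  IsVertexOrdering σ ∧ ∀ p v, (p ++ [v]) <+: σ → Eligible G p v

/-- `σ` is the output of LBFS⁺ with tie-breaker `ρ`: in every step the eligible vertex that is
leftmost in `ρ` is numbered. -/
def IsLBFSPlusOrdering {V : Type*} [DecidableEq V] (G : SimpleGraph V) (ρ σ : List V) : Prop :=
  IsVertexOrdering σ ∧ ∀ p v, (p ++ [v]) <+: σ →
    Eligible G p v ∧ ∀ w, Eligible G p w → w ≠ v → Before ρ v w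

/-- `σ` is a solution of the rooted partial search order problem of LBFS. -/
def IsRootedLBFSExtension {V : Type*} [DecidableEq V] (G : SimpleGraph V) (r : V)
    (π : V → V → Prop) (σ : List V) : Prop :=
  IsLBFSOrdering G σ ∧ σ.head? = some r ∧ IsLinearExtension π σ

/-! ### One-before-all orderings -/

/-- `σ` is a linear ordering of `M` with the one-before-all property for the relation `R`: whenever
`(A, B) ∈ R` and `B ≠ ∅`, some element of `A` is to the left of all elements of `B`. The family of
sets on which `R` lives is not an argument, as it does not influence this property. -/
def IsOBAOrdering {V : Type*} [DecidableEq V] (M : Set V) (R : Set V → Set V → Prop)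
    (σ : List V) : Prop :=
  σ.Nodup ∧ (∀ v, v ∈ σ ↔ v ∈ M) ∧
    ∀ A B, R A B → B.Nonempty → ∃ x ∈ A, ∀ y ∈ B, Before σ x y

/-! ### The algorithm for the rooted problem on chordal bipartite graphs -/

/-- The set `A' = [N(A) ∩ N^i(r)] \ N(B)`. -/
def exclusiveNeighbors {V : Type*} (G : SimpleGraph V) (r : V) (i : ℕ) (A B : Set V) : Set V :=
  (setNeighbors G A ∩ layer G r i) \ setNeighbors G B

/-- The set `A'' = {v ∈ A' | N(v) ∩ N^i(r) = N(A') ∩ N^i(r)}`. -/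
def maximalVertices {V : Type*} (G : SimpleGraph V) (r : V) (i : ℕ) (A' : Set V) : Set V :=
  {v ∈ A' | G.neighborSet v ∩ layer G r i = setNeighbors G A' ∩ layer G r i}

/-- The relations built by the loop of the algorithm: `OBARel G r π i A B` means `(A, B) ∈ R_i`.
Initially `R_i` consists of the `({x}, {y})` with `x, y ∈ N^i(r)` and `x ≺_π y`. Then, from the last
layer down to layer `2`, each `(A, B)` in the relation of a layer contributes the pair `(A'', B')`
to the relation of the preceding layer. -/
inductive OBARel {V : Type*} (G : SimpleGraph V) (r : V) (π : V → V → Prop) :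
    ℕ → Set V → Set V → Prop
  | base {i : ℕ} {x y : V} (hi : 1 ≤ i) (hx : x ∈ layer G r i) (hy : y ∈ layer G r i)
      (hxy : π x y) (hne : x ≠ y) : OBARel G r π i {x} {y}
  | step {i : ℕ} {A B : Set V} (h : OBARel G r π (i + 2) A B) :
      OBARel G r π (i + 1)
        (maximalVertices G r i (exclusiveNeighbors G r (i + 1) A B))
        (exclusiveNeighbors G r (i + 1) B A)

/-- Some tuple of `π` puts a vertex before a vertex of an earlier layer. -/
def ViolatesLayers {V : Type*} (G : SimpleGraph V) (r : V) (π : V → V → Prop) : Prop :=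
  ∃ x y, π x y ∧ G.dist r y < G.dist r x

/-- The concatenation of `r` with the orderings `s 1, …, s k` of the layers `1, …, k`. -/
def concatLayers {V : Type*} (r : V) (k : ℕ) (s : ℕ → List V) : List V :=
  r :: ((List.range k).map (fun i => s (i + 1))).flatten

/-- The possible results of the algorithm with input `G`, `r`, `π`: `none` stands for the answer
that `π` cannot be linearized, and `some (ρ, σ)` for the answer `σ` obtained with the tie-breaker
`ρ`. The algorithm rejects a partial order that is incompatible with the layers (tuples pointing to
a later layer are ignored), it rejects if the one-before-all problem of some layer is unsolvable,
and otherwise it chooses an arbitrary one-before-all ordering for each layer, concatenates them and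
returns the LBFS⁺ ordering for the resulting tie-breaker. -/
inductive PSOPAlgorithm {V : Type*} [Fintype V] [DecidableEq V] (G : SimpleGraph V) (r : V)
    (π : V → V → Prop) : Option (List V × List V) → Prop
  | rejectLayers (h : ViolatesLayers G r π) : PSOPAlgorithm G r π none
  | rejectOBA (h : ¬ ViolatesLayers G r π) (i : ℕ) (hi : 1 ≤ i) (hik : i ≤ depth G r)
      (hs : ¬ ∃ s, IsOBAOrdering (layer G r i) (OBARel G r π i) s) : PSOPAlgorithm G r π none
  | accept (h : ¬ ViolatesLayers G r π) (s : ℕ → List V) (σ : List V)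
      (hs : ∀ i, 1 ≤ i → i ≤ depth G r → IsOBAOrdering (layer G r i) (OBARel G r π i) (s i))
      (hσ : IsLBFSPlusOrdering G (concatLayers r (depth G r) s) σ) :
      PSOPAlgorithm G r π (some (concatLayers r (depth G r) s, σ))

/-! ### A random access machine with unit costs

Programs work on registers and three-dimensional arrays of natural numbers. New numbers arise only
by adding one and by truncated subtraction, so that the numbers occurring in a computation
(and all addresses) are at most the largest number in input and program plus the number of steps;
unit costs are therefore adequate. Every loop has a bound that is fixed when it is entered. -/

namespace Machine

/-- Memory: register contents and array contents (array name, then three indices). -/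
structure State where
  reg : ℕ → ℕ
  arr : ℕ → ℕ → ℕ → ℕ → ℕ

/-- Expressions: constants, registers, array cells, successor, truncated subtraction. -/
inductive Expr where
  | const (c : ℕ)
  | reg (x : ℕ)
  | cell (a : ℕ) (i j k : Expr)
  | succ (e : Expr)
  | sub (e₁ e₂ : Expr)

/-- The value of an expression. -/
def Expr.eval (s : State) : Expr → ℕ
  | .const c => c
  | .reg x => s.reg x
  | .cell a i j k => s.arr a (i.eval s) (j.eval s) (k.eval s)
  | .succ e => e.eval s + 1
  | .sub e₁ e₂ => e₁.eval s - e₂.eval s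

/-- The number of steps needed to evaluate an expression: one for each operation in it. -/
def Expr.cost : Expr → ℕ
  | .const _ => 1
  | .reg _ => 1
  | .cell _ i j k => 1 + i.cost + j.cost + k.cost
  | .succ e => 1 + e.cost
  | .sub e₁ e₂ => 1 + e₁.cost + e₂.cost

/-- Programs. `loop x e c` executes `c` with `x = 0, 1, …, m - 1`, where `m` is the value of `e`
on entry. -/
inductive Program where
  | skip
  | setReg (x : ℕ) (e : Expr)
  | setCell (a : ℕ) (i j k e : Expr)
  | seq (c₁ c₂ : Program)
  | ifLt (e₁ e₂ : Expr) (c₁ c₂ : Program)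
  | ifEq (e₁ e₂ : Expr) (c₁ c₂ : Program)
  | loop (x : ℕ) (e : Expr) (c : Program)

/-- Write `v` into register `x`. -/
def State.writeReg (s : State) (x v : ℕ) : State :=
  { s with reg := fun y => if y = x then v else s.reg y }

/-- Write `v` into the cell `(i, j, k)` of array `a`. -/
def State.writeCell (s : State) (a i j k v : ℕ) : State :=
  { s with arr := fun a' i' j' k' =>
      if a' = a ∧ i' = i ∧ j' = j ∧ k' = k then v else s.arr a' i' j' k' }

/-- Execution of a program: the final memory together with the number of steps. -/
def Program.exec : Program → State → State × ℕ
  | .skip, s => (s, 1)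
  | .setReg x e, s => (s.writeReg x (e.eval s), 1 + e.cost)
  | .setCell a i j k e, s =>
      (s.writeCell a (i.eval s) (j.eval s) (k.eval s) (e.eval s),
        1 + i.cost + j.cost + k.cost + e.cost)
  | .seq c₁ c₂, s =>
      ((c₂.exec (c₁.exec s).1).1, (c₁.exec s).2 + (c₂.exec (c₁.exec s).1).2)
  | .ifLt e₁ e₂ c₁ c₂, s =>
      if e₁.eval s < e₂.eval s then ((c₁.exec s).1, 1 + e₁.cost + e₂.cost + (c₁.exec s).2)
      else ((c₂.exec s).1, 1 + e₁.cost + e₂.cost + (c₂.exec s).2)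
  | .ifEq e₁ e₂ c₁ c₂, s =>
      if e₁.eval s = e₂.eval s then ((c₁.exec s).1, 1 + e₁.cost + e₂.cost + (c₁.exec s).2)
      else ((c₂.exec s).1, 1 + e₁.cost + e₂.cost + (c₂.exec s).2)
  | .loop x e c, s =>
      (List.range (e.eval s)).foldl
        (fun q i => ((c.exec (q.1.writeReg x i)).1, q.2 + 1 + (c.exec (q.1.writeReg x i)).2))
        (s, 1 + e.cost)

open Classical in
/-- The initial memory for a graph `G` on `{0, …, n - 1}`, a vertex `r`, and a list `L` of the tuples
of a partial order. Register `0` holds `n`, register `1` holds `r`, register `2` holds the number of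
tuples, array `0` holds the adjacency matrix, and row `p` of array `1` holds the two entries of the
`p`-th tuple. Everything else is `0`. -/
noncomputable def input {n : ℕ} (G : SimpleGraph (Fin n)) (r : Fin n)
    (L : List (Fin n × Fin n)) : State where
  reg x := if x = 0 then n else if x = 1 then r else if x = 2 then L.length else 0
  arr a i j k :=
    if a = 0 then
      if ∃ u v : Fin n, G.Adj u v ∧ (u : ℕ) = i ∧ (v : ℕ) = j ∧ k = 0 then 1 else 0
    else if a = 1 ∧ k = 0 then
      match L[i]? with
      | none => 0
      | some t => if j = 0 then t.1 else if j = 1 then t.2 else 0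
    else 0

/-- The final memory shows that the program accepts: register `3` holds `1`. -/
def Accepts (s : State) : Prop := s.reg 3 = 1

/-- The relation stored for layer `i` is `R`: cell `(i, 0, 0)` of array `2` holds the number of
stored pairs, and the `j`-th pair is given by its membership bits `(i, j, v)` in the arrays `3`
and `4`. -/
def StoresRelation {n : ℕ} (s : State) (i : ℕ) (R : Set (Fin n) → Set (Fin n) → Prop) : Prop :=
  ∀ A B, R A B ↔ ∃ j < s.arr 2 i 0 0,
    A = {v : Fin n | s.arr 3 i j v = 1} ∧ B = {v : Fin n | s.arr 4 i j v = 1}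

/-- The list `σ` of length `n` is stored in array `a`. -/
def StoresList {n : ℕ} (s : State) (a : ℕ) (σ : List (Fin n)) : Prop :=
  σ.map Fin.val = (List.range n).map (fun t => s.arr a t 0 0)

/-- The final memory `s` documents a run of the algorithm on `G`, `r`, `π`: unless `π` is rejected
because of the layers, the relations `R_1, …, R_k` are stored; the machine accepts or
rejects as the run does; and after acceptance array `5` holds the tie-breaker and array `6` the
returned LBFS⁺ ordering. -/
def DocumentsRun {n : ℕ} (G : SimpleGraph (Fin n)) (r : Fin n) (π : Fin n → Fin n → Prop)
    (s : State) : Prop :=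
  (¬ ViolatesLayers G r π →
    ∀ i, 1 ≤ i → i ≤ depth G r → StoresRelation s i (OBARel G r π i)) ∧
  ((¬ Accepts s ∧ PSOPAlgorithm G r π none) ∨
    (Accepts s ∧ ∃ ρ σ, PSOPAlgorithm G r π (some (ρ, σ)) ∧ StoresList s 5 ρ ∧ StoresList s 6 σ))

end Machine

/-! ### Layers of connected bipartite graphs -/

section Layers

variable {V : Type*} {G : SimpleGraph V} {r : V}

/-! Call the neighbors of a vertex in the preceding layer its parents. An LBFS ordering starting in
`r` visits the layers in order (`IsLBFSOrdering.before_of_dist_lt`), so only the order inside the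
layers is at stake. It is governed by `IsLBFSOrdering.four_point`: if `w` precedes `a`, `a` precedes
`b`, and `w` is adjacent to `b` but not to `a`, then some vertex before `w` is adjacent to `a` but
not to `b`. Hence the first parent that belongs to only one of two vertices of a layer decides
between them, and the tie-breaker matters only if their parents agree.

Chordal bipartiteness enters through `neighbors_comparable`: two vertices of a layer that are
connected through later layers have nested parent sets, since otherwise a private parent of each,
joined through earlier layers, would close an induced cycle of length greater than four. The sets
`B` and `A'` of the algorithm are connected in this way. So some vertex of `B` has all parents of
`B`, some vertex of `A'` has all parents of `A'`, and all vertices of a first component `A` have the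
same parents.

Rejections are right because in every solution each pair has an element of its first component
before its whole second component (`OBARel.exists_before`, by induction towards the root). If `a`
precedes all of `B`, the first vertex `w` of `B'` is adjacent to the vertex of `B` with all parents,
and the four-point condition yields a vertex of `A'` before `w`. The first vertex of `A'` must have
all parents of `A'`, so it lies in `A''`.

Returned orderings are right by an induction away from the root (`OBARel.exists_before_of_plus`). If
`B'` is nonempty, an element of `A''` precedes `B'`, and a vertex of `A` adjacent to it precedes
`B`. If `B'` is empty, every vertex of `A` has all parents of `B`, and the vertex of `A` that the
tie-breaker puts first wins. The pairs of singletons then say that `π` is respected.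

For the time bound, a layer has at most `|π|` pairs (`length_pairsUpTo_le`). A pair is processed in
linear time, since each of its sets can be replaced by one vertex with the most parents, and `A''`
is found by comparing numbers of parents (`derivePair_spec`). The one-before-all orderings are found
greedily, and getting stuck proves that there is none (`not_exists_isOBAOrdering`). The search keeps
all comparisons of labels and updates each in constant time (`labelLess_label_append`). Some parts
take cubic time, which is within the bound because reflexivity gives `n ≤ |π|`. -/

lemma dist_ne_of_adj (hc : G.Connected) (hb : G.IsBipartite) {u v : V} (h : G.Adj u v) :
    G.dist r u ≠ G.dist r v := by
  intro he
  obtain ⟨c⟩ := hb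
  -- In a two-coloring, a walk has even length exactly if its ends have the same color; equal
  -- distances from `r` would thus give two adjacent vertices the same color.
  let c' : G.Coloring Bool := SimpleGraph.Coloring.mk (fun v => decide (c v = 0)) (by
    intro a b hab h2
    have := c.valid hab
    have h2' : (c a = 0 ↔ c b = 0) := by simpa using h2
    omega)
  obtain ⟨p, hp⟩ := hc.exists_walk_length_eq_dist r u
  obtain ⟨q, hq⟩ := hc.exists_walk_length_eq_dist r v
  have h1 := c'.even_length_iff_congr p
  have h2 := c'.even_length_iff_congr q
  rw [hp, he] at h1
  rw [hq] at h2
  have h3 := c'.valid h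
  revert h1 h2 h3
  generalize Even (G.dist r v) = e
  cases c' r <;> cases c' u <;> cases c' v <;> simp

lemma dist_of_adj (hc : G.Connected) (hb : G.IsBipartite) {u v : V} (h : G.Adj u v) :
    G.dist r u = G.dist r v + 1 ∨ G.dist r v = G.dist r u + 1 := by
  have h1 := dist_ne_of_adj (r := r) hc hb h
  have h2 := h.diff_dist_adj (u := r)
  omega

lemma exists_parent (hc : G.Connected) {v : V} {i : ℕ} (h : G.dist r v = i + 1) :
    ∃ u, G.Adj u v ∧ G.dist r u = i := by
  obtain ⟨p, hp⟩ := hc.exists_walk_length_eq_dist v r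
  have hp' : p.length = i + 1 := by rw [hp, SimpleGraph.dist_comm, h]
  cases p with
  | nil => simp at hp'
  | @cons _ w _ hvw q =>
    refine ⟨w, hvw.symm, ?_⟩
    have h1 : G.dist r w ≤ i := by
      rw [SimpleGraph.dist_comm]
      refine (SimpleGraph.dist_le q).trans ?_
      simpa using hp'.le
    have h2 := hvw.diff_dist_adj (u := r)
    omega

/-- The edges of `G` inside `S`, as a graph on all vertices. -/
def restrictTo (G : SimpleGraph V) (S : Set V) : SimpleGraph V where
  Adj u v := G.Adj u v ∧ u ∈ S ∧ v ∈ S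
  symm := ⟨fun _ _ h => ⟨h.1.symm, h.2.2, h.2.1⟩⟩
  loopless := ⟨fun v h => G.loopless.irrefl v h.1⟩

lemma restrictTo_mono {S T : Set V} (h : S ⊆ T) : restrictTo G S ≤ restrictTo G T :=
  fun _ _ hab => ⟨hab.1, h hab.2.1, h hab.2.2⟩

/-- On a shortest walk of length `a` the two pieces at its `k`-th vertex bound the distances to the
ends by `k` and `a - k`, and their sum cannot fall below `a`. The exact distances later exclude
repetitions and chords. -/
lemma exists_geodesic {H : SimpleGraph V} {x y : V} (h : H.Reachable x y) :
    ∃ (a : ℕ) (f : ℕ → V), f 0 = x ∧ f a = y ∧ (∀ k < a, H.Adj (f k) (f (k + 1))) ∧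
      ∀ k ≤ a, H.dist x (f k) = k := by
  obtain ⟨p, hp⟩ := h.exists_walk_length_eq_dist
  refine ⟨p.length, p.getVert, by simp, by simp, fun k hk => p.adj_getVert_succ hk, ?_⟩
  intro k hk
  have h1 : H.dist x (p.getVert k) ≤ k :=
    (SimpleGraph.dist_le (p.take k)).trans (by simp)
  have h2 : H.dist (p.getVert k) y ≤ p.length - k :=
    (SimpleGraph.dist_le (p.drop k)).trans (by simp)
  have h3 : H.dist x y ≤ H.dist x (p.getVert k) + H.dist (p.getVert k) y :=
    SimpleGraph.Reachable.dist_triangle_left ⟨p.take k⟩ y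
  omega

/-- An induced path between two vertices that are connected inside `S`. -/
lemma exists_induced_path {S : Set V} {x y : V} (hxy : x ≠ y)
    (h : (restrictTo G S).Reachable x y) :
    ∃ (a : ℕ) (f : ℕ → V), 1 ≤ a ∧ f 0 = x ∧ f a = y ∧ (∀ k ≤ a, f k ∈ S) ∧
      (∀ k ≤ a, ∀ l ≤ a, f k = f l → k = l) ∧
      ∀ k ≤ a, ∀ l ≤ a, (G.Adj (f k) (f l) ↔ l = k + 1 ∨ k = l + 1) := by
  obtain ⟨a, f, h0, ha, hadj, hd⟩ := exists_geodesic h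
  have ha1 : 1 ≤ a := by
    rcases Nat.eq_zero_or_pos a with rfl | h
    · exact absurd (h0.symm.trans ha) hxy
    · exact h
  have hS : ∀ k ≤ a, f k ∈ S := by
    intro k hk
    rcases hk.lt_or_eq with h | rfl
    · exact (hadj k h).2.1
    · have := (hadj (k - 1) (by omega)).2.2
      rwa [Nat.sub_add_cancel ha1] at this
  refine ⟨a, f, ha1, h0, ha, hS, ?_, ?_⟩
  · intro k hk l hl he
    rw [← hd k hk, he, hd l hl]
  · intro k hk l hl
    constructor
    · intro hkl
      have h1 : (restrictTo G S).Adj (f k) (f l) := ⟨hkl, hS k hk, hS l hl⟩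
      have h2 := h1.diff_dist_adj (u := x)
      rw [hd k hk, hd l hl] at h2
      have h3 : k ≠ l := by
        rintro rfl
        exact G.loopless.irrefl _ hkl
      omega
    · rintro (rfl | rfl)
      · exact (hadj k (by omega)).1
      · exact (hadj l (by omega)).1.symm

/-- Two induced paths without edges between their interiors, whose ends are joined by two edges,
form an induced cycle. -/
lemma cycle_of_paths {a b : ℕ} (ha : 1 ≤ a) (hb : 1 ≤ b) {f g : ℕ → V}
    (hf : ∀ k ≤ a, ∀ l ≤ a, f k = f l → k = l) (hg : ∀ k ≤ b, ∀ l ≤ b, g k = g l → k = l)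
    (hfa : ∀ k ≤ a, ∀ l ≤ a, (G.Adj (f k) (f l) ↔ l = k + 1 ∨ k = l + 1))
    (hga : ∀ k ≤ b, ∀ l ≤ b, (G.Adj (g k) (g l) ↔ l = k + 1 ∨ k = l + 1))
    (hne : ∀ k ≤ a, ∀ l ≤ b, f k ≠ g l)
    (hfg : ∀ k ≤ a, ∀ l ≤ b, (G.Adj (f k) (g l) ↔ (k = a ∧ l = 0) ∨ (k = 0 ∧ l = b))) :
    Nonempty (SimpleGraph.cycleGraph (a + b + 2) ↪g G) := by
  -- The cycle runs through the `a + 1` vertices of `f` and then through the `b + 1` vertices of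
  -- `g`, the first of which has position `a + 1`.
  let c : Fin (a + b + 2) → V := fun k => if k.val ≤ a then f k.val else g (k.val - a - 1)
  refine ⟨⟨⟨c, ?_⟩, ?_⟩⟩
  · intro ⟨k, hk⟩ ⟨l, hl⟩ h
    simp only [c] at h
    rw [Fin.mk.injEq]
    split_ifs at h with h1 h2 h2
    · exact hf _ h1 _ h2 h
    · exact absurd h (hne _ h1 _ (by omega))
    · exact absurd h.symm (hne _ h2 _ (by omega))
    · have := hg _ (by omega) _ (by omega) h
      omega
  · intro ⟨k, hk⟩ ⟨l, hl⟩
    rw [SimpleGraph.cycleGraph_adj']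
    -- Adjacency in the cycle graph is a difference of one modulo the length: a successor, or the
    -- step from the last position to position `0`.
    have hsub : ∀ (u v : ℕ) (hu : u < a + b + 2) (hv : v < a + b + 2),
        ((⟨u, hu⟩ - ⟨v, hv⟩ : Fin (a + b + 2)).val = 1 ↔ u = v + 1 ∨ (u = 0 ∧ v = a + b + 1)) := by
      intro u v hu hv
      rw [Fin.sub_def]
      simp only
      rcases le_or_gt v u with h | h
      · rw [show a + b + 2 - v + u = (u - v) + (a + b + 2) by omega, Nat.add_mod_right,
          Nat.mod_eq_of_lt (by omega)]
        omega
      · rw [Nat.mod_eq_of_lt (by omega)]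
        omega
    rw [hsub, hsub]
    change G.Adj (c ⟨k, hk⟩) (c ⟨l, hl⟩) ↔ _
    simp only [c]
    split_ifs with h1 h2 h2
    · rw [hfa _ h1 _ h2]; omega
    · rw [hfg _ h1 _ (by omega)]; omega
    · rw [G.adj_comm, hfg _ h2 _ (by omega)]; omega
    · rw [hga _ (by omega) _ (by omega)]; omega

/-- Going from parent to parent, a path from `v` to the root meets only vertices closer to the root,
and these all lie in `S`. -/
lemma restrictTo_reachable_root (hc : G.Connected) {v : V} {S : Set V}
    (hv : ∀ u, G.dist r u < G.dist r v → u ∈ S) (hvS : v ∈ S) :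
    (restrictTo G S).Reachable r v := by
  induction h : G.dist r v generalizing v with
  | zero =>
    rw [hc.dist_eq_zero_iff] at h
    subst h
    exact SimpleGraph.Reachable.refl _
  | succ i ih =>
    obtain ⟨u, huv, hu⟩ := exists_parent hc h
    have huS : u ∈ S := hv u (by omega)
    refine (ih (fun w hw => hv w (by omega)) huS hu).trans ?_
    exact SimpleGraph.Adj.reachable ⟨huv, huS, hvS⟩

/-- In a connected chordal bipartite graph, two vertices of a layer that are connected through
later layers have comparable neighborhoods in the preceding layer. -/
lemma neighbors_comparable (hc : G.Connected) (hG : IsChordalBipartite G) {i : ℕ} {x y : V}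
    (hx : G.dist r x = i + 1) (hy : G.dist r y = i + 1)
    (h : (restrictTo G ({x, y} ∪ {v | i + 1 < G.dist r v})).Reachable x y) :
    G.neighborSet x ∩ layer G r i ⊆ G.neighborSet y ∩ layer G r i ∨
      G.neighborSet y ∩ layer G r i ⊆ G.neighborSet x ∩ layer G r i := by
  -- Otherwise `x` has a parent `x'` not adjacent to `y`, and `y` has a parent `y'` not adjacent to
  -- `x`. An induced path from `x` to `y` through later layers and one from `y'` to `x'` through
  -- earlier layers will form an induced cycle.
  by_contra! hcon
  obtain ⟨h1, h2⟩ := hcon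
  obtain ⟨x', ⟨hxx', hx'⟩, hx'y⟩ := Set.not_subset.1 h1
  obtain ⟨y', ⟨hyy', hy'⟩, hy'x⟩ := Set.not_subset.1 h2
  rw [SimpleGraph.mem_neighborSet] at hxx' hyy'
  simp only [layer, Set.mem_ofPred_eq] at hx' hy'
  replace hx'y : ¬ G.Adj y x' := fun h => hx'y ⟨h, hx'⟩
  replace hy'x : ¬ G.Adj x y' := fun h => hy'x ⟨h, hy'⟩
  have hb := hG.1
  have hxy : x ≠ y := by rintro rfl; exact hx'y hxx'
  have hxy' : y' ≠ x' := by rintro rfl; exact hx'y hyy'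
  have hi : i ≠ 0 := by
    rintro rfl
    rw [hc.dist_eq_zero_iff] at hx' hy'
    exact hxy' (hy'.symm.trans hx')
  have hlow : (restrictTo G ({y', x'} ∪ {v | G.dist r v < i})).Reachable y' x' := by
    refine SimpleGraph.Reachable.trans (SimpleGraph.Reachable.symm (v := y') (u := r) ?_) ?_
    · exact restrictTo_reachable_root hc (fun u hu => Or.inr (by simpa [hy'] using hu)) (by simp)
    · exact restrictTo_reachable_root hc (fun u hu => Or.inr (by simpa [hx'] using hu)) (by simp)
  obtain ⟨a, f, ha, f0, fa, fS, finj, fadj⟩ := exists_induced_path hxy h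
  obtain ⟨b, g, hb1, g0, gb, gS, ginj, gadj⟩ := exists_induced_path hxy' hlow
  have hfd : ∀ k ≤ a, (k = 0 ∨ k = a) ∧ G.dist r (f k) = i + 1 ∨
      k ≠ 0 ∧ k ≠ a ∧ i + 1 < G.dist r (f k) := by
    intro k hk
    rcases eq_or_ne k 0 with rfl | hk0
    · exact Or.inl ⟨by simp, by rw [f0, hx]⟩
    rcases eq_or_ne k a with rfl | hka
    · exact Or.inl ⟨by simp, by rw [fa, hy]⟩
    refine Or.inr ⟨hk0, hka, ?_⟩
    rcases fS k hk with (h | h) | h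
    · exact absurd (finj k hk 0 (by omega) (h.trans f0.symm)) hk0
    · exact absurd (finj k hk a le_rfl ((Set.mem_singleton_iff.1 h).trans fa.symm)) hka
    · exact h
  have hgd : ∀ k ≤ b, (k = 0 ∨ k = b) ∧ G.dist r (g k) = i ∨
      k ≠ 0 ∧ k ≠ b ∧ G.dist r (g k) < i := by
    intro k hk
    rcases eq_or_ne k 0 with rfl | hk0
    · exact Or.inl ⟨by simp, by rw [g0, hy']⟩
    rcases eq_or_ne k b with rfl | hkb
    · exact Or.inl ⟨by simp, by rw [gb, hx']⟩
    refine Or.inr ⟨hk0, hkb, ?_⟩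
    rcases gS k hk with (h | h) | h
    · exact absurd (ginj k hk 0 (by omega) (h.trans g0.symm)) hk0
    · exact absurd (ginj k hk b le_rfl ((Set.mem_singleton_iff.1 h).trans gb.symm)) hkb
    · exact h
  -- The interiors of the paths lie after layer `i + 1` and before layer `i`. By distances only the
  -- ends of the two paths can be adjacent, which leaves the edges `x x'` and `y y'`.
  have hcyc := cycle_of_paths (G := G) ha hb1 finj ginj fadj gadj
    (by
      intro k hk l hl he
      have h1 := hfd k hk
      have h2 := hgd l hl
      rw [he] at h1
      omega)
    (by
      intro k hk l hl
      have h1 := hfd k hk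
      have h2 := hgd l hl
      constructor
      · intro hadj
        have h3 := dist_of_adj (r := r) hc hb hadj
        have h4 : (k = 0 ∨ k = a) ∧ (l = 0 ∨ l = b) := by omega
        rcases h4 with ⟨rfl | rfl, rfl | rfl⟩
        · rw [f0, g0] at hadj; exact absurd hadj hy'x
        · exact Or.inr ⟨rfl, rfl⟩
        · exact Or.inl ⟨rfl, rfl⟩
        · rw [fa, gb] at hadj; exact absurd hadj hx'y
      · rintro (⟨rfl, rfl⟩ | ⟨rfl, rfl⟩)
        · rw [fa, g0]; exact hyy'
        · rw [f0, gb]; exact hxx')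
  -- As `a` and `b` are at least one, length four forces `a = 1`, so `x` and `y` would be adjacent
  -- within a layer.
  have hlen := hG.2 _ (by omega) hcyc
  obtain rfl : a = 1 := by omega
  have h3 : G.Adj x y := by
    rw [← f0, ← fa, fadj 0 (by omega) 1 (by omega)]
    simp
  exact dist_ne_of_adj (r := r) hc hb h3 (hx.trans hy.symm)

end Layers

/-! ### Positions in lists -/

section Lists

variable {V : Type*} [DecidableEq V]

/-- A vertex that is missing from the list has the length of the list as its index, so it precedes
nothing. -/
lemma Before.mem {σ : List V} {x y : V} (h : Before σ x y) : x ∈ σ :=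
  List.idxOf_lt_length_iff.1 (lt_of_lt_of_le h List.idxOf_le_length)

lemma Before.ne {σ : List V} {x y : V} (h : Before σ x y) : x ≠ y := by
  rintro rfl
  exact lt_irrefl _ h

lemma before_or_before {σ : List V} {x y : V} (hx : x ∈ σ) (hne : x ≠ y) :
    Before σ x y ∨ Before σ y x :=
  Nat.lt_or_gt_of_ne fun h => hne ((List.idxOf_inj hx).1 h)

lemma before_filter {P : V → Bool} {σ : List V} {x y : V} (hx : P x) (hy : P y) :
    Before (σ.filter P) x y ↔ Before σ x y := by
  unfold Before
  induction σ with
  | nil => simp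
  | cons c l ih =>
    by_cases hc : P c
    · rw [List.filter_cons_of_pos hc]
      grind
    · rw [List.filter_cons_of_neg hc]
      have h1 : c ≠ x := by rintro rfl; exact hc hx
      have h2 : c ≠ y := by rintro rfl; exact hc hy
      rw [ih, List.idxOf_cons_ne _ h1, List.idxOf_cons_ne _ h2]
      omega

lemma before_of_prefix {p σ : List V} (h : p <+: σ) {u w : V} (hw : w ∈ p) :
    Before p u w ↔ Before σ u w := by
  obtain ⟨t, rfl⟩ := h
  unfold Before
  rw [List.idxOf_append_of_mem hw]
  by_cases hu : u ∈ p
  · rw [List.idxOf_append_of_mem hu]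
  · have := List.idxOf_lt_length_iff.2 hw
    rw [List.idxOf_append_of_notMem hu, List.idxOf_eq_length hu]
    omega

lemma exists_prefix {σ : List V} {v : V} (hv : v ∈ σ) :
    ∃ p, (p ++ [v]) <+: σ ∧ ∀ u, u ∈ p ↔ Before σ u v := by
  induction σ with
  | nil => simp at hv
  | cons c l ih =>
    by_cases hcv : c = v
    · subst hcv
      exact ⟨[], ⟨l, rfl⟩, by simp [Before]⟩
    · have hv' : v ∈ l := by
        rcases List.mem_cons.1 hv with h | h
        · exact absurd h.symm hcv
        · exact h
      obtain ⟨p, hp, hpm⟩ := ih hv'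
      refine ⟨c :: p, by simpa using hp, fun u => ?_⟩
      rw [List.mem_cons, hpm]
      unfold Before
      rw [List.idxOf_cons_ne _ hcv]
      by_cases huc : c = u
      · subst huc; simp
      · rw [List.idxOf_cons_ne _ huc]
        have : u ≠ c := fun h => huc h.symm
        simp [this]

lemma exists_leftmost [Finite V] (σ : List V) {S : Set V} (hS : S.Nonempty) (hσ : ∀ v ∈ S, v ∈ σ) :
    ∃ x ∈ S, ∀ y ∈ S, y ≠ x → Before σ x y := by
  obtain ⟨x, hx, hmin⟩ := Set.exists_min_image S σ.idxOf S.toFinite hS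
  refine ⟨x, hx, fun y hy hyx => lt_of_le_of_ne (hmin y hy) ?_⟩
  intro h
  exact hyx ((List.idxOf_inj (hσ x hx)).1 h).symm

end Lists

/-! ### Labels -/

/-- Both alternatives of `LabelLess` say that the least element of the symmetric difference exists
and belongs to `B`. -/
lemma labelLess_iff {A B : Set ℕ} :
    LabelLess A B ↔ ∃ m ∈ B, m ∉ A ∧ ∀ j < m, (j ∈ A ↔ j ∈ B) := by
  constructor
  · rintro (h | ⟨h1, h2, h3⟩)
    · have hne : (B \ A).Nonempty := Set.sdiff_nonempty.2 h.2
      refine ⟨sInf (B \ A), (Nat.sInf_mem hne).1, (Nat.sInf_mem hne).2, fun j hj => ?_⟩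
      refine ⟨fun hA => h.1 hA, fun hB => ?_⟩
      by_contra hA
      exact Nat.notMem_of_lt_sInf hj ⟨hB, hA⟩
    · refine ⟨sInf (B \ A), (Nat.sInf_mem h2).1, (Nat.sInf_mem h2).2, fun j hj => ?_⟩
      constructor
      · intro hA
        by_contra hB
        exact Nat.notMem_of_lt_sInf (hj.trans h3) ⟨hA, hB⟩
      · intro hB
        by_contra hA
        exact Nat.notMem_of_lt_sInf hj ⟨hB, hA⟩
  · rintro ⟨m, hmB, hmA, hm⟩
    have hBA : (B \ A).Nonempty := ⟨m, hmB, hmA⟩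
    rcases Set.eq_empty_or_nonempty (A \ B) with h | h
    · exact Or.inl ⟨Set.sdiff_eq_empty.1 h, fun h' => hmA (h' hmB)⟩
    · refine Or.inr ⟨h, hBA, ?_⟩
      have h1 : sInf (B \ A) ≤ m := Nat.sInf_le ⟨hmB, hmA⟩
      have h2 := Nat.sInf_mem h
      by_contra hcon
      rcases lt_trichotomy (sInf (A \ B)) m with h3 | h3 | h3
      · exact h2.2 ((hm _ h3).1 h2.1)
      · exact h2.2 (h3 ▸ hmB)
      · omega

lemma not_labelLess_of_labelLess {A B : Set ℕ} (h : LabelLess A B) : ¬ LabelLess B A := by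
  rw [labelLess_iff] at h ⊢
  rintro ⟨m, hm, hm', hmj⟩
  obtain ⟨l, hl, hl', hlj⟩ := h
  rcases lt_trichotomy l m with h | h | h
  · exact hl' ((hmj l h).1 hl)
  · exact hl' (h ▸ hm)
  · exact hm' ((hlj m h).1 hm)

lemma LabelLess.trans {A B C : Set ℕ} (h : LabelLess A B) (h' : LabelLess B C) :
    LabelLess A C := by
  rw [labelLess_iff] at *
  obtain ⟨m, hm, hm', hmj⟩ := h
  obtain ⟨l, hl, hl', hlj⟩ := h'
  rcases lt_trichotomy l m with h | h | h
  · exact ⟨l, hl, fun hA => hl' ((hmj l h).1 hA), fun j hj => by rw [hmj j (by omega), hlj j hj]⟩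
  · subst h; exact absurd hm hl'
  · exact ⟨m, (hlj m h).1 hm, hm', fun j hj => by rw [hmj j hj, hlj j (by omega)]⟩

/-! ### Labels in terms of vertices and the four-point condition -/

section Search

variable {V : Type*} [DecidableEq V] {G : SimpleGraph V}

lemma mem_label {p : List V} (hp : p.Nodup) {v : V} {j : ℕ} :
    j ∈ label G p v ↔ ∃ u ∈ p, G.Adj u v ∧ j = p.idxOf u + 1 := by
  constructor
  · rintro ⟨i, u, hi, hu, rfl⟩
    obtain ⟨hil, rfl⟩ := List.getElem?_eq_some_iff.1 hi
    exact ⟨_, List.getElem_mem hil, hu, by rw [List.Nodup.idxOf_getElem hp]⟩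
  · rintro ⟨u, hu, huv, rfl⟩
    refine ⟨p.idxOf u, u, ?_, huv, rfl⟩
    rw [List.getElem?_eq_getElem (List.idxOf_lt_length_iff.2 hu), List.getElem_idxOf]

lemma mem_label_idxOf {p : List V} (hp : p.Nodup) {u v : V} (hu : u ∈ p) :
    p.idxOf u + 1 ∈ label G p v ↔ G.Adj u v := by
  rw [mem_label hp]
  constructor
  · rintro ⟨w, hw, hwv, he⟩
    obtain rfl : u = w := (List.idxOf_inj hu).1 (by omega)
    exact hwv
  · intro h
    exact ⟨u, hu, h, rfl⟩

/-- As `p` has no repetitions, numbers correspond to vertices, and the least number in which two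
labels differ becomes the leftmost vertex adjacent to exactly one of `x` and `y`. -/
lemma labelLess_label_iff {p : List V} (hp : p.Nodup) {x y : V} :
    LabelLess (label G p x) (label G p y) ↔
      ∃ w ∈ p, G.Adj w y ∧ ¬ G.Adj w x ∧ ∀ u, Before p u w → (G.Adj u x ↔ G.Adj u y) := by
  rw [labelLess_iff]
  constructor
  · rintro ⟨m, hmB, hmA, hm⟩
    obtain ⟨w, hw, hwy, rfl⟩ := (mem_label hp).1 hmB
    refine ⟨w, hw, hwy, fun h => hmA ((mem_label_idxOf hp hw).2 h), fun u hu => ?_⟩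
    have := hm (p.idxOf u + 1) (Nat.succ_lt_succ hu)
    rwa [mem_label_idxOf hp hu.mem, mem_label_idxOf hp hu.mem] at this
  · rintro ⟨w, hw, hwy, hwx, h⟩
    refine ⟨p.idxOf w + 1, (mem_label_idxOf hp hw).2 hwy, fun h' =>
      hwx ((mem_label_idxOf hp hw).1 h'), fun j hj => ?_⟩
    constructor
    · intro hjx
      obtain ⟨u, hu, hux, rfl⟩ := (mem_label hp).1 hjx
      exact (mem_label_idxOf hp hu).2 ((h u (by unfold Before; omega)).1 hux)
    · intro hjy
      obtain ⟨u, hu, huy, rfl⟩ := (mem_label hp).1 hjy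
      exact (mem_label_idxOf hp hu).2 ((h u (by unfold Before; omega)).2 huy)

/-- The four-point condition of LBFS orderings. -/
lemma IsLBFSOrdering.four_point [Finite V] {σ : List V} (hσ : IsLBFSOrdering G σ) {a b w : V}
    (hab : Before σ a b) (hwa : Before σ w a) (hwb : G.Adj w b) (hnwa : ¬ G.Adj w a) :
    ∃ u, Before σ u w ∧ G.Adj u a ∧ ¬ G.Adj u b := by
  obtain ⟨p, hp, hpm⟩ := exists_prefix hab.mem
  have hpσ : p <+: σ := (List.prefix_append p [a]).trans hp
  have hpn : p.Nodup := hσ.1.1.sublist hpσ.sublist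
  have hel := (hσ.2 p a hp).2
  -- Look at the moment when `a` is numbered. If the claim fails, every neighbor of `a` before `w`
  -- is also a neighbor of `b`. The leftmost vertex up to `w` that is adjacent to `b` only is then
  -- the first difference of the labels, so `a` was not eligible.
  by_contra! hcon
  apply hel
  refine ⟨b, fun hb => ?_, ?_⟩
  · have := (hpm b).1 hb
    unfold Before at *
    omega
  obtain ⟨w', ⟨hw'b, hw'a, hw'le⟩, hmin⟩ := exists_leftmost σ
    (S := {w' | G.Adj w' b ∧ ¬ G.Adj w' a ∧ σ.idxOf w' ≤ σ.idxOf w})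
    ⟨w, hwb, hnwa, le_rfl⟩ (fun v _ => hσ.1.2 v)
  rw [labelLess_label_iff hpn]
  have hw'p : w' ∈ p := (hpm w').2 (lt_of_le_of_lt hw'le hwa)
  refine ⟨w', hw'p, hw'b, hw'a, fun u hu => ?_⟩
  rw [before_of_prefix hpσ hw'p] at hu
  refine ⟨fun hua => hcon u (lt_of_lt_of_le hu hw'le) hua, fun hub => ?_⟩
  by_contra hua
  have hle : σ.idxOf u ≤ σ.idxOf w := (le_of_lt hu).trans hw'le
  have := hmin u ⟨hub, hua, hle⟩ hu.ne
  unfold Before at *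
  omega

/-- LBFS visits the vertices layer by layer. -/
lemma IsLBFSOrdering.before_of_dist_lt [Finite V] {σ : List V} (hσ : IsLBFSOrdering G σ)
    (hc : G.Connected) {r : V} (hr : σ.head? = some r) {u v : V}
    (h : G.dist r u < G.dist r v) : Before σ u v := by
  have hr0 : σ.idxOf r = 0 := by
    cases σ with
    | nil => simp at hr
    | cons c l =>
      simp only [List.head?_cons, Option.some.injEq] at hr
      simp [hr]
  induction hk : G.dist r u using Nat.strong_induction_on generalizing u v with
  | _ k ih =>
    have huv : u ≠ v := by rintro rfl; exact lt_irrefl _ h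
    rcases before_or_before (hσ.1.2 u) huv with h1 | h1
    · exact h1
    exfalso
    rcases Nat.eq_zero_or_pos k with rfl | hk0
    · rw [hc.dist_eq_zero_iff] at hk
      subst hk
      unfold Before at h1
      omega
    -- A parent `u'` of `u` precedes `v` by induction. If `v` came before `u`, the four-point
    -- condition would give a neighbor `w` of `v` before `u'`; but `w` is farther from `r` than `u'`
    -- and so comes after it by induction.
    obtain ⟨u', hu'u, hu'⟩ := exists_parent (i := k - 1) hc (hk.trans (Nat.sub_add_cancel hk0).symm)
    have hu'v : Before σ u' v := ih (k - 1) (by omega) (by omega) hu'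
    have hnadj : ¬ G.Adj u' v := fun hadj => by
      have := hadj.diff_dist_adj (u := r)
      omega
    obtain ⟨w, hwu', hwv, -⟩ := hσ.four_point h1 hu'v hu'u hnadj
    have h2 := hwv.diff_dist_adj (u := r)
    have h3 : Before σ u' w := ih (k - 1) (by omega) (by omega) hu'
    unfold Before at *
    omega

end Search

/-! ### The relations of the algorithm -/

section Relations

variable {V : Type*} {G : SimpleGraph V} {r : V} {π : V → V → Prop}

lemma OBARel.one_le {i : ℕ} {A B : Set V} (h : OBARel G r π i A B) : 1 ≤ i := by
  cases h with
  | base hi => exact hi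
  | step => omega

lemma OBARel.left_subset {i : ℕ} {A B : Set V} (h : OBARel G r π i A B) : A ⊆ layer G r i := by
  cases h with
  | base hi hx => simpa using hx
  | step => exact fun v hv => hv.1.1.2

lemma OBARel.right_subset {i : ℕ} {A B : Set V} (h : OBARel G r π i A B) : B ⊆ layer G r i := by
  cases h with
  | base hi hx hy => simpa using hy
  | step => exact fun v hv => hv.1.2

/-- All vertices in the first component of a pair have the same neighbors in the preceding
layer. -/
lemma OBARel.left_neighbors {i : ℕ} {A B : Set V} (h : OBARel G r π (i + 1) A B) {a : V}
    (ha : a ∈ A) : G.neighborSet a ∩ layer G r i = setNeighbors G A ∩ layer G r i := by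
  cases h with
  | base hi hx =>
    rw [Set.mem_singleton_iff] at ha
    subst ha
    ext v
    simp [setNeighbors]
  | step h =>
    refine Set.Subset.antisymm ?_ ?_
    · exact fun v hv => ⟨⟨a, ha, hv.1⟩, hv.2⟩
    · rw [ha.2]
      rintro v ⟨⟨b, hb, hbv⟩, hv⟩
      exact ⟨⟨b, hb.1, hbv⟩, hv⟩

/-- The vertices in the second component of a pair are connected through later layers. -/
lemma OBARel.right_reachable {i : ℕ} {A B : Set V} (h : OBARel G r π i A B) {b b' : V}
    (hb : b ∈ B) (hb' : b' ∈ B) :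
    (restrictTo G ({b, b'} ∪ {v | i < G.dist r v})).Reachable b b' := by
  induction h generalizing b b' with
  | base =>
    rw [Set.mem_singleton_iff] at hb hb'
    subst hb hb'
    exact SimpleGraph.Reachable.refl _
  | @step i A B h ih =>
    -- Both vertices have neighbors in the second component of the pair of the next layer, and these
    -- are connected by induction.
    obtain ⟨⟨⟨c, hc, hcb⟩, -⟩, -⟩ := hb
    obtain ⟨⟨⟨c', hc', hcb'⟩, -⟩, -⟩ := hb'
    have hd : G.dist r c = i + 2 := h.right_subset hc
    have hd' : G.dist r c' = i + 2 := h.right_subset hc'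
    have hcS : c ∈ ({b, b'} ∪ {v | i + 1 < G.dist r v} : Set V) := Or.inr (by simp [hd])
    have hcS' : c' ∈ ({b, b'} ∪ {v | i + 1 < G.dist r v} : Set V) := Or.inr (by simp [hd'])
    have h1 : (restrictTo G ({b, b'} ∪ {v | i + 1 < G.dist r v})).Adj b c :=
      ⟨hcb.symm, by simp, hcS⟩
    have h2 : (restrictTo G ({b, b'} ∪ {v | i + 1 < G.dist r v})).Adj c' b' :=
      ⟨hcb', hcS', by simp⟩
    refine h1.reachable.trans (((ih hc hc').mono (restrictTo_mono ?_)).trans h2.reachable)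
    rintro v ((rfl | hv) | hv)
    · exact hcS
    · rw [Set.mem_singleton_iff] at hv
      exact hv ▸ hcS'
    · refine Or.inr ?_
      simp only [Set.mem_ofPred_eq] at hv ⊢
      omega

/-- The vertices of the set `A'` of a pair are connected through later layers. -/
lemma OBARel.exclusive_reachable {i : ℕ} {A B : Set V} (h : OBARel G r π (i + 2) A B) {v w : V}
    (hv : v ∈ exclusiveNeighbors G r (i + 1) A B) (hw : w ∈ exclusiveNeighbors G r (i + 1) A B) :
    (restrictTo G ({v, w} ∪ {u | i + 1 < G.dist r u})).Reachable v w := by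
  obtain ⟨⟨⟨a, ha, hav⟩, -⟩, -⟩ := hv
  -- As all vertices of `A` have the same parents, a single `a` is adjacent to both `v` and `w`.
  have haw : w ∈ G.neighborSet a ∩ layer G r (i + 1) := by
    rw [h.left_neighbors ha]
    exact hw.1
  have hd : G.dist r a = i + 2 := h.left_subset ha
  have haS : a ∈ ({v, w} ∪ {u | i + 1 < G.dist r u} : Set V) := Or.inr (by simp [hd])
  have h1 : (restrictTo G ({v, w} ∪ {u | i + 1 < G.dist r u})).Adj v a :=
    ⟨hav.symm, by simp, haS⟩
  have h2 : (restrictTo G ({v, w} ∪ {u | i + 1 < G.dist r u})).Adj a w :=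
    ⟨haw.1, haS, by simp⟩
  exact h1.reachable.trans h2.reachable

/-- If the vertices of a subset of a layer are connected through later layers, then a vertex with
the maximal number of neighbors in the preceding layer has all neighbors of this set. -/
lemma neighbors_of_maximal [Finite V] (hc : G.Connected) (hG : IsChordalBipartite G) {i : ℕ}
    {S : Set V} (hS : S ⊆ layer G r (i + 1))
    (hreach : ∀ x ∈ S, ∀ y ∈ S,
      (restrictTo G ({x, y} ∪ {v | i + 1 < G.dist r v})).Reachable x y)
    {b : V} (hb : b ∈ S)
    (hmax : ∀ x ∈ S, (G.neighborSet x ∩ layer G r i).ncard ≤ (G.neighborSet b ∩ layer G r i).ncard) :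
    G.neighborSet b ∩ layer G r i = setNeighbors G S ∩ layer G r i := by
  refine Set.Subset.antisymm (fun v hv => ⟨⟨b, hb, hv.1⟩, hv.2⟩) ?_
  rintro v ⟨⟨x, hx, hxv⟩, hv⟩
  rcases neighbors_comparable hc hG (hS hx) (hS hb) (hreach x hx b hb) with h | h
  · exact h ⟨hxv, hv⟩
  · rw [Set.eq_of_subset_of_ncard_le h (hmax x hx)]
    exact ⟨hxv, hv⟩

lemma exists_maximal_neighbors [Finite V] (hc : G.Connected) (hG : IsChordalBipartite G) {i : ℕ}
    {S : Set V} (hS : S ⊆ layer G r (i + 1))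
    (hreach : ∀ x ∈ S, ∀ y ∈ S,
      (restrictTo G ({x, y} ∪ {v | i + 1 < G.dist r v})).Reachable x y) (hne : S.Nonempty) :
    ∃ b ∈ S, G.neighborSet b ∩ layer G r i = setNeighbors G S ∩ layer G r i := by
  obtain ⟨b, hb, hmax⟩ := Set.exists_max_image S
    (fun x => (G.neighborSet x ∩ layer G r i).ncard) S.toFinite hne
  exact ⟨b, hb, neighbors_of_maximal hc hG hS hreach hb hmax⟩

end Relations

/-! ### Correctness of rejections -/

section Necessity

variable {V : Type*} [DecidableEq V] {G : SimpleGraph V} {r : V} {π : V → V → Prop} {σ : List V}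

/-- The conditions propagate towards the root: for `b` to lose against `a`, the first private parent
of `b` must come after some private parent of `a`. Taking for `b` a vertex with all parents of `B`
makes this a condition on the whole set `B'`. -/
lemma OBARel.exists_before [Finite V] (hc : G.Connected) (hG : IsChordalBipartite G)
    (hσ : IsRootedLBFSExtension G r π σ) {i : ℕ} {A B : Set V} (h : OBARel G r π i A B)
    (hB : B.Nonempty) : ∃ x ∈ A, ∀ y ∈ B, Before σ x y := by
  obtain ⟨hL, hr, hext⟩ := hσ
  induction h with
  | base hi hx hy hxy hne => exact ⟨_, rfl, fun z hz => hz ▸ hext _ _ hxy hne⟩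
  | @step i A B h ih =>
    have hBn : B.Nonempty := by
      obtain ⟨v, ⟨⟨b, hb, -⟩, -⟩, -⟩ := hB
      exact ⟨b, hb⟩
    obtain ⟨a, ha, hab⟩ := ih hBn
    obtain ⟨b, hb, hbN⟩ := exists_maximal_neighbors hc hG h.right_subset
      (fun x hx y hy => h.right_reachable hx hy) hBn
    obtain ⟨w, hw, hwmin⟩ := exists_leftmost σ hB (fun v _ => hL.1.2 v)
    have hda : G.dist r a = i + 2 := h.left_subset ha
    have hdw : G.dist r w = i + 1 := hw.1.2
    have hwb : G.Adj w b := by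
      have : w ∈ setNeighbors G B ∩ layer G r (i + 1) := hw.1
      rw [← hbN] at this
      exact this.1.symm
    have hwa : ¬ G.Adj w a := fun h => hw.2 ⟨a, ha, h.symm⟩
    obtain ⟨u, huw, hua, hub⟩ := hL.four_point (hab b hb)
      (hL.before_of_dist_lt hc hr (by omega)) hwb hwa
    -- A neighbor of `a` outside this layer would lie in layer `i + 3` and come after `w`.
    have hdu : G.dist r u = i + 1 := by
      have h1 := dist_of_adj (r := r) hc hG.1 hua
      by_contra hne
      have := hL.before_of_dist_lt hc hr (u := w) (v := u) (by omega)
      unfold Before at *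
      omega
    have huA : u ∈ exclusiveNeighbors G r (i + 1) A B := by
      refine ⟨⟨⟨a, ha, hua.symm⟩, hdu⟩, fun hu => ?_⟩
      have : u ∈ G.neighborSet b ∩ layer G r (i + 1) := by
        rw [hbN]; exact ⟨hu, hdu⟩
      exact hub this.1.symm
    obtain ⟨a', ha', hmin⟩ := exists_leftmost σ ⟨u, huA⟩ (fun v _ => hL.1.2 v)
    have ha'w : Before σ a' w := by
      rcases eq_or_ne u a' with rfl | hne
      · exact huw
      · exact (hmin u huA hne).trans huw
    refine ⟨a', ⟨ha', ?_⟩, fun y hy => ?_⟩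
    -- The leftmost vertex `a'` of `A'` lies in `A''`: let `m` have all parents of `A'`. If `a'`
    -- missed a parent `z` of `m`, the four-point condition would yield a parent of `a'` that is not
    -- adjacent to `m`.
    · obtain ⟨m, hm, hmN⟩ := exists_maximal_neighbors hc hG
        (S := exclusiveNeighbors G r (i + 1) A B) (fun v hv => hv.1.2)
        (fun x hx y hy => h.exclusive_reachable hx hy) ⟨u, huA⟩
      refine Set.Subset.antisymm (fun v hv => ⟨⟨a', ha', hv.1⟩, hv.2⟩) ?_
      intro z hz
      by_contra hza
      have hzm : z ∈ G.neighborSet m ∩ layer G r i := by rw [hmN]; exact hz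
      have hza' : ¬ G.Adj z a' := fun h => hza ⟨h.symm, hz.2⟩
      have hma : m ≠ a' := by
        rintro rfl
        exact hza' hzm.1.symm
      have hda' : G.dist r a' = i + 1 := ha'.1.2
      have hdz : G.dist r z = i := hz.2
      obtain ⟨t, htz, hta, htm⟩ := hL.four_point (hmin m hm hma)
        (hL.before_of_dist_lt hc hr (by omega)) hzm.1.symm hza'
      have hdt : G.dist r t = i := by
        have h1 := dist_of_adj (r := r) hc hG.1 hta
        by_contra hne
        have := hL.before_of_dist_lt hc hr (u := z) (v := t) (by omega)
        unfold Before at *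
        omega
      have : t ∈ G.neighborSet m ∩ layer G r i := by
        rw [hmN]; exact ⟨⟨a', ha', hta.symm⟩, hdt⟩
      exact htm this.1.symm
    · rcases eq_or_ne y w with rfl | hne
      · exact ha'w
      · exact ha'w.trans (hwmin y hy hne)

lemma IsRootedLBFSExtension.isOBAOrdering_filter [Finite V] (hc : G.Connected)
    (hG : IsChordalBipartite G) (hσ : IsRootedLBFSExtension G r π σ) (i : ℕ) :
    IsOBAOrdering (layer G r i) (OBARel G r π i) (σ.filter fun v => G.dist r v = i) := by
  refine ⟨hσ.1.1.1.filter _, fun v => ?_, fun A B h hB => ?_⟩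
  · simp [hσ.1.1.2 v, layer]
  · obtain ⟨x, hx, hxB⟩ := h.exists_before hc hG hσ hB
    refine ⟨x, hx, fun y hy => (before_filter ?_ ?_).2 (hxB y hy)⟩
    · exact decide_eq_true (h.left_subset hx)
    · exact decide_eq_true (h.right_subset hy)

end Necessity

/-! ### Correctness of returned orderings -/

section Sufficiency

variable {V : Type*} [DecidableEq V] {G : SimpleGraph V} {r : V} {π : V → V → Prop}
  {ρ σ : List V}

lemma IsLBFSPlusOrdering.isLBFSOrdering (h : IsLBFSPlusOrdering G ρ σ) : IsLBFSOrdering G σ :=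
  ⟨h.1, fun p v hp => (h.2 p v hp).1⟩

/-- At the start all labels are empty, so every vertex is eligible and the tie-breaker alone
decides. -/
lemma IsLBFSPlusOrdering.head_eq (h : IsLBFSPlusOrdering G ρ σ) (hρ : ρ.head? = some r) :
    σ.head? = some r := by
  cases σ with
  | nil => exact absurd (h.1.2 r) (by simp)
  | cons c l =>
    rw [List.head?_cons, Option.some.injEq]
    by_contra hne
    have h1 : Eligible G [] r := by
      refine ⟨by simp, ?_⟩
      rintro ⟨y, -, hy⟩
      simp [labelLess_iff, label] at hy
    have h2 := (h.2 [] c ⟨l, rfl⟩).2 r h1 (fun h => hne h.symm)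
    have h3 : ρ.idxOf r = 0 := by
      cases ρ with
      | nil => simp at hρ
      | cons d l' =>
        simp only [List.head?_cons, Option.some.injEq] at hρ
        simp [hρ]
    unfold Before at h2
    omega

/-- Vertices with the same neighbors in the preceding layer are ordered by the tie-breaker. -/
lemma IsLBFSPlusOrdering.before_of_neighbors_eq [Finite V] (hc : G.Connected) (hb : G.IsBipartite)
    (hσ : IsLBFSPlusOrdering G ρ σ) (hr : σ.head? = some r) {i : ℕ} {a b : V}
    (ha : G.dist r a = i + 1) (hb' : G.dist r b = i + 1)
    (hN : G.neighborSet a ∩ layer G r i = G.neighborSet b ∩ layer G r i) (hab : Before ρ a b) :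
    Before σ a b := by
  have hL := hσ.isLBFSOrdering
  rcases before_or_before (hL.1.2 a) hab.ne with h | h
  · exact h
  exfalso
  obtain ⟨p, hp, hpm⟩ := exists_prefix h.mem
  have hpn : p.Nodup := hL.1.1.sublist ((List.prefix_append p [b]).trans hp).sublist
  obtain ⟨hel, hmin⟩ := hσ.2 p b hp
  have hap : a ∉ p := fun hap => by
    have := (hpm a).1 hap
    unfold Before at *
    omega
  -- Vertices of layer `i + 2` are numbered after `b`, so the numbered neighbors of `a` and `b` are
  -- their parents. Hence their labels agree, and the tie-breaker would have preferred `a`.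
  have hadj : ∀ w ∈ p, (G.Adj w a ↔ G.Adj w b) := by
    intro w hw
    have hwb := (hpm w).1 hw
    have hdw : ¬ i + 1 < G.dist r w := fun hlt => by
      have := hL.before_of_dist_lt hc hr (u := b) (v := w) (by omega)
      unfold Before at *
      omega
    constructor
    · intro hwa
      have := dist_of_adj (r := r) hc hb hwa
      have : w ∈ G.neighborSet b ∩ layer G r i := by
        rw [← hN]
        exact ⟨hwa.symm, show G.dist r w = i by omega⟩
      exact this.1.symm
    · intro hwb
      have := dist_of_adj (r := r) hc hb hwb
      have : w ∈ G.neighborSet a ∩ layer G r i := by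
        rw [hN]
        exact ⟨hwb.symm, show G.dist r w = i by omega⟩
      exact this.1.symm
  have hlab : label G p a = label G p b := by
    ext j
    rw [mem_label hpn, mem_label hpn]
    constructor
    · rintro ⟨u, hu, hua, hj⟩
      exact ⟨u, hu, (hadj u hu).1 hua, hj⟩
    · rintro ⟨u, hu, hua, hj⟩
      exact ⟨u, hu, (hadj u hu).2 hua, hj⟩
  have := hmin a ⟨hap, by rw [hlab]; exact hel.2⟩ hab.ne
  unfold Before at *
  omega

/-- The induction runs away from the root: what holds for `(A'', B')` in the preceding layer decides
`(A, B)` through the labels. The tie-breaker is consulted only when no vertex of `B` has a parent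
that is missing in `A`. -/
lemma OBARel.exists_before_of_plus [Finite V] (hc : G.Connected) (hb : G.IsBipartite)
    (hσ : IsLBFSPlusOrdering G ρ σ) (hr : σ.head? = some r)
    (hρ : ∀ i A B, OBARel G r π i A B → B.Nonempty → ∃ x ∈ A, ∀ y ∈ B, Before ρ x y)
    {i : ℕ} {A B : Set V} (h : OBARel G r π i A B) (hB : B.Nonempty) :
    ∃ x ∈ A, ∀ y ∈ B, Before σ x y := by
  have hL := hσ.isLBFSOrdering
  induction i generalizing A B with
  | zero => exact absurd h.one_le (by omega)
  | succ i ih =>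
    -- a neighbor of `a` but not of `b` that precedes all neighbors of `b` but not of `a`
    have key : ∀ a ∈ A, ∀ b ∈ B, ∀ w, G.Adj w a → ¬ G.Adj w b → G.dist r w = i →
        (∀ u, G.Adj u b → ¬ G.Adj u a → G.dist r u = i → Before σ w u) → Before σ a b := by
      intro a ha b hb' w hwa hwb hdw hu
      have hda : G.dist r a = i + 1 := h.left_subset ha
      have hdb : G.dist r b = i + 1 := h.right_subset hb'
      have hne : a ≠ b := by
        rintro rfl
        exact hwb hwa
      rcases before_or_before (hL.1.2 a) hne with h | hba
      · exact h
      exfalso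
      obtain ⟨u, huw, hub, hua⟩ := hL.four_point hba
        (hL.before_of_dist_lt hc hr (by omega)) hwa hwb
      have h1 := dist_of_adj (r := r) hc hb hub
      by_cases hdu : G.dist r u = i
      · have := hu u hub hua hdu
        unfold Before at *
        omega
      · have := hL.before_of_dist_lt hc hr (u := w) (v := u) (by omega)
        unfold Before at *
        omega
    by_cases hex : ∃ a' ∈ setNeighbors G A ∩ layer G r i, a' ∉ setNeighbors G B ∧
        ∀ y ∈ exclusiveNeighbors G r i B A, Before σ a' y
    · obtain ⟨a', ⟨⟨a, ha, haa'⟩, hda'⟩, hB', hbef⟩ := hex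
      refine ⟨a, ha, fun b hb' => key a ha b hb' a' haa'.symm (fun h => hB' ⟨b, hb', h.symm⟩) hda' ?_⟩
      intro u hub hua hdu
      refine hbef u ⟨⟨⟨b, hb', hub.symm⟩, hdu⟩, fun huA => ?_⟩
      have : u ∈ G.neighborSet a ∩ layer G r i := by
        rw [h.left_neighbors ha]; exact ⟨huA, hdu⟩
      exact hua this.1.symm
    -- If `B'` were nonempty, the induction hypothesis for the derived pair would provide the
    -- excluded vertex; so all parents of `B` are parents of every vertex of `A`. In layer `1` this
    -- holds because the root is the only parent.
    · have hempty : ∀ a ∈ A, ∀ b ∈ B,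
          G.neighborSet b ∩ layer G r i ⊆ G.neighborSet a ∩ layer G r i := by
        intro a ha b hb' v hv
        by_contra hva
        have hvB : v ∈ exclusiveNeighbors G r i B A := by
          refine ⟨⟨⟨b, hb', hv.1⟩, hv.2⟩, fun hvA => hva ?_⟩
          rw [h.left_neighbors ha]
          exact ⟨hvA, hv.2⟩
        rcases i with _ | i
        · have hdv : G.dist r v = 0 := hv.2
          obtain ⟨u, hu, hdu⟩ := exists_parent hc (h.left_subset ha)
          rw [hc.dist_eq_zero_iff] at hdu hdv
          subst hdu hdv
          exact hva ⟨hu.symm, hv.2⟩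
        · obtain ⟨a', ha', hbef⟩ := ih h.step ⟨v, hvB⟩
          exact hex ⟨a', ha'.1.1, ha'.1.2, hbef⟩
      obtain ⟨a, ha, hab⟩ := hρ _ _ _ h hB
      refine ⟨a, ha, fun b hb' => ?_⟩
      -- With equal parents the tie-breaker decides for `a`. Otherwise `a` has a parent that `b`
      -- lacks while `b` has no private parent, so the label of `a` wins.
      by_cases heq : G.neighborSet a ∩ layer G r i ⊆ G.neighborSet b ∩ layer G r i
      · exact hσ.before_of_neighbors_eq hc hb hr (h.left_subset ha) (h.right_subset hb')
          (heq.antisymm (hempty a ha b hb')) (hab b hb')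
      · obtain ⟨w, hwa, hwb⟩ := Set.not_subset.1 heq
        refine key a ha b hb' w hwa.1.symm (fun h => hwb ⟨h.symm, hwa.2⟩) hwa.2 ?_
        intro u hub hua hdu
        exact absurd (hempty a ha b hb' ⟨hub.symm, hdu⟩).1.symm hua

end Sufficiency

/-! ### Concatenations of layer orderings -/

section Concatenation

variable {V : Type*} {G : SimpleGraph V} {r : V}

lemma filter_concatLayers {k : ℕ} {s : ℕ → List V}
    (hs : ∀ j, 1 ≤ j → j ≤ k → ∀ v ∈ s j, G.dist r v = j) {i : ℕ} (hi : 1 ≤ i) (hik : i ≤ k) :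
    (concatLayers r k s).filter (fun v => G.dist r v = i) = s i := by
  have haux : ∀ m, m ≤ k → (((List.range m).map (fun i => s (i + 1))).flatten).filter
      (fun v => G.dist r v = i) = if i ≤ m then s i else [] := by
    intro m
    induction m with
    | zero => intro _; rw [if_neg (by omega)]; simp
    | succ m ih =>
      intro hm
      rw [List.range_succ, List.map_append, List.flatten_append, List.filter_append, ih (by omega)]
      simp only [List.map_cons, List.map_nil, List.flatten_cons, List.flatten_nil, List.append_nil]
      by_cases him : i = m + 1
      · subst him
        rw [if_neg (by omega), if_pos le_rfl, List.nil_append, List.filter_eq_self]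
        intro v hv
        simpa using hs _ hi hik v hv
      · have : (s (m + 1)).filter (fun v => G.dist r v = i) = [] := by
          rw [List.filter_eq_nil_iff]
          intro v hv
          have := hs (m + 1) (by omega) hm v hv
          simp only [decide_eq_true_eq]
          omega
        rw [this, List.append_nil]
        by_cases h : i ≤ m
        · rw [if_pos h, if_pos (by omega)]
        · rw [if_neg h, if_neg (by omega)]
  unfold concatLayers
  rw [List.filter_cons_of_neg (by simp; omega), haux k le_rfl, if_pos hik]

lemma dist_le_depth [Fintype V] (v : V) : G.dist r v ≤ depth G r :=
  Finset.le_sup (f := fun v => G.dist r v) (Finset.mem_univ v)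

lemma mem_concatLayers [Fintype V] (hc : G.Connected) {s : ℕ → List V}
    (hs : ∀ j, 1 ≤ j → j ≤ depth G r → ∀ v, v ∈ s j ↔ v ∈ layer G r j) (v : V) :
    v ∈ concatLayers r (depth G r) s := by
  unfold concatLayers
  rcases Nat.eq_zero_or_pos (G.dist r v) with h | h
  · rw [hc.dist_eq_zero_iff] at h
    simp [h]
  · have hd := dist_le_depth (G := G) (r := r) v
    refine List.mem_cons_of_mem _ (List.mem_flatten.2 ⟨s (G.dist r v), ?_, (hs _ h hd v).2 rfl⟩)
    exact List.mem_map.2 ⟨G.dist r v - 1, List.mem_range.2 (by omega), by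
      rw [Nat.sub_add_cancel h]⟩

end Concatenation

/-! ### Existence of LBFS⁺ orderings -/

section Existence

variable {V : Type*} {G : SimpleGraph V} {ρ : List V}

/-- Comparing labels is a strict order, so a finite nonempty set of vertices contains one whose
label is not exceeded. -/
lemma exists_eligible [Finite V] (q : List V) (h : ∃ v, v ∉ q) : ∃ v, Eligible G q v := by
  let R : V → V → Prop := fun y x => LabelLess (label G q x) (label G q y)
  have : IsTrans V R := ⟨fun a b c h1 h2 => h2.trans h1⟩
  have : Std.Irrefl R := ⟨fun a h => not_labelLess_of_labelLess h h⟩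
  have hwf : WellFounded R := Finite.wellFounded_of_trans_of_irrefl R
  obtain ⟨v, hv, hmin⟩ := hwf.has_min {v | v ∉ q} h
  exact ⟨v, hv, fun ⟨y, hy, hlt⟩ => hmin y hy hlt⟩

variable [DecidableEq V]

/-- `q` is an initial segment of an LBFS⁺ ordering. -/
def IsPlusPrefix (G : SimpleGraph V) (ρ q : List V) : Prop :=
  q.Nodup ∧ ∀ p v, (p ++ [v]) <+: q →
    Eligible G p v ∧ ∀ w, Eligible G p w → w ≠ v → Before ρ v w

lemma IsPlusPrefix.append {q : List V} (hq : IsPlusPrefix G ρ q) {v : V} (hv : Eligible G q v)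
    (hmin : ∀ w, Eligible G q w → w ≠ v → Before ρ v w) : IsPlusPrefix G ρ (q ++ [v]) := by
  refine ⟨List.nodup_append.2 ⟨hq.1, by simp, ?_⟩, fun p w hp => ?_⟩
  · rintro a ha b hb rfl
    rw [List.mem_singleton] at hb
    exact hv.1 (hb ▸ ha)
  · rcases List.prefix_concat_iff.1 hp with h | h
    · rw [List.append_eq_append_iff_of_size_eq_right (by simp)] at h
      obtain ⟨rfl, h⟩ := h
      obtain rfl : w = v := by simpa using h
      exact ⟨hv, hmin⟩
    · exact hq.2 p w h

lemma exists_leftmost_eligible [Finite V] (hρ : ∀ v, v ∈ ρ) (q : List V) (h : ∃ v, v ∉ q) :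
    ∃ v, Eligible G q v ∧ ∀ w, Eligible G q w → w ≠ v → Before ρ v w :=
  exists_leftmost ρ (S := {v | Eligible G q v}) (exists_eligible q h) (fun v _ => hρ v)

lemma List.Nodup.mem_of_length_eq_card [Fintype V] {q : List V} (hq : q.Nodup)
    (hlen : q.length = Fintype.card V) (v : V) : v ∈ q := by
  have : q.toFinset = Finset.univ :=
    Finset.eq_univ_of_card _ ((List.toFinset_card_of_nodup hq).trans hlen)
  rw [← List.mem_toFinset, this]
  exact Finset.mem_univ v

lemma exists_notMem_of_length_lt_card [Fintype V] {q : List V}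
    (hq : q.length < Fintype.card V) : ∃ v, v ∉ q := by
  by_contra! h
  have h1 := Finset.card_le_card (Finset.subset_iff.2 fun v _ => List.mem_toFinset.2 (h v) :
    Finset.univ ⊆ q.toFinset)
  have h2 := q.toFinset_card_le
  rw [Finset.card_univ] at h1
  omega

lemma exists_isLBFSPlusOrdering [Fintype V] (hρ : ∀ v, v ∈ ρ) :
    ∃ σ, IsLBFSPlusOrdering G ρ σ := by
  have : ∀ k ≤ Fintype.card V, ∃ q, IsPlusPrefix G ρ q ∧ q.length = k := by
    intro k
    induction k with
    | zero =>
      exact fun _ => ⟨[], ⟨List.nodup_nil, fun p v hp => by simp at hp⟩, rfl⟩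
    | succ k ih =>
      intro hk
      obtain ⟨q, hq, hqk⟩ := ih (by omega)
      have hex := exists_notMem_of_length_lt_card (q := q) (by omega)
      obtain ⟨v, hv, hmin⟩ := exists_leftmost_eligible hρ q hex
      exact ⟨q ++ [v], hq.append hv hmin, by simp [hqk]⟩
  obtain ⟨q, hq, hlen⟩ := this _ le_rfl
  exact ⟨q, ⟨hq.1, hq.1.mem_of_length_eq_card hlen⟩, hq.2⟩

end Existence

/-! ### Correctness of the algorithm -/

section Correctness

variable {V : Type*} [Fintype V] [DecidableEq V] {G : SimpleGraph V} {r : V} {π : V → V → Prop}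

lemma PSOPAlgorithm.exists_result (hc : G.Connected) : ∃ o, PSOPAlgorithm G r π o := by
  by_cases hv : ViolatesLayers G r π
  · exact ⟨none, .rejectLayers hv⟩
  by_cases hs : ∀ i, 1 ≤ i → i ≤ depth G r → ∃ s, IsOBAOrdering (layer G r i) (OBARel G r π i) s
  · choose! s hs using hs
    obtain ⟨σ, hσ⟩ := exists_isLBFSPlusOrdering (G := G)
      (mem_concatLayers (G := G) (r := r) hc (s := s) fun j h1 h2 => (hs j h1 h2).2.1)
    exact ⟨_, .accept hv s σ hs hσ⟩
  · push Not at hs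
    obtain ⟨i, hi, hik, hs⟩ := hs
    exact ⟨none, .rejectOBA hv i hi hik (fun ⟨s, h⟩ => hs s h)⟩

lemma PSOPAlgorithm.not_exists_of_reject (hc : G.Connected) (hG : IsChordalBipartite G)
    (h : PSOPAlgorithm G r π none) : ¬ ∃ σ, IsRootedLBFSExtension G r π σ := by
  rintro ⟨σ, hσ⟩
  cases h with
  | rejectLayers h =>
    obtain ⟨x, y, hxy, hlt⟩ := h
    have h1 := hσ.1.before_of_dist_lt hc hσ.2.1 hlt
    have h2 := hσ.2.2 x y hxy h1.ne.symm
    unfold Before at *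
    omega
  | rejectOBA h i hi hik hs => exact hs ⟨_, hσ.isOBAOrdering_filter hc hG i⟩

/-- Tuples between different layers are respected by every LBFS ordering from `r`, since none of
them points to an earlier layer. Tuples inside a layer are pairs of singletons in the relation of
that layer. -/
lemma PSOPAlgorithm.isRootedLBFSExtension (hc : G.Connected) (hb : G.IsBipartite) {ρ σ : List V}
    (h : PSOPAlgorithm G r π (some (ρ, σ))) : IsRootedLBFSExtension G r π σ := by
  cases h with
  | accept hv s _ hs hσ =>
    have hL := hσ.isLBFSOrdering
    have hr : σ.head? = some r := hσ.head_eq (by simp [concatLayers])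
    refine ⟨hL, hr, fun x y hxy hne => ?_⟩
    have hle : ¬ G.dist r y < G.dist r x := fun h => hv ⟨x, y, hxy, h⟩
    rcases (not_lt.1 hle).lt_or_eq with hlt | heq
    · exact hL.before_of_dist_lt hc hr hlt
    -- Two distinct vertices of the same layer cannot lie in layer `0`, which consists of the root.
    have h1 : 1 ≤ G.dist r x := by
      by_contra h0
      have hx : G.dist r x = 0 := by omega
      have hy : G.dist r y = 0 := by omega
      rw [hc.dist_eq_zero_iff] at hx hy
      exact hne (hx.symm.trans hy)
    have hρ : ∀ i A B, OBARel G r π i A B → B.Nonempty →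
        ∃ x ∈ A, ∀ y ∈ B, Before (concatLayers r (depth G r) s) x y := by
      intro i A B h hB
      obtain ⟨b, hb'⟩ := hB
      have hik : i ≤ depth G r := by
        rw [← show G.dist r b = i from h.right_subset hb']
        exact dist_le_depth b
      obtain ⟨x, hx, hxB⟩ := (hs i h.one_le hik).2.2 A B h ⟨b, hb'⟩
      refine ⟨x, hx, fun y hy => ?_⟩
      rw [← before_filter (P := fun v => G.dist r v = i), filter_concatLayers _ h.one_le hik]
      · exact hxB y hy
      · exact fun j h1 h2 v hv => ((hs j h1 h2).2.1 v).1 hv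
      · exact decide_eq_true (h.left_subset hx)
      · exact decide_eq_true (h.right_subset hy)
    obtain ⟨x', rfl, hx'⟩ := (OBARel.base (G := G) (r := r) h1 rfl heq.symm hxy hne).exists_before_of_plus
      hc hb hσ hr hρ ⟨y, rfl⟩
    exact hx' y rfl

end Correctness

namespace Machine

/-! ### Semantics of programs -/

/-- The final memory of an execution. -/
def Program.run (c : Program) (s : State) : State := (c.exec s).1

/-- The register `x` may be written by the program. -/
def Program.writesReg (x : ℕ) : Program → Bool
  | .skip => false
  | .setReg y _ => y == x
  | .setCell .. => false
  | .seq c₁ c₂ => c₁.writesReg x || c₂.writesReg x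
  | .ifLt _ _ c₁ c₂ => c₁.writesReg x || c₂.writesReg x
  | .ifEq _ _ c₁ c₂ => c₁.writesReg x || c₂.writesReg x
  | .loop y _ c => y == x || c.writesReg x

/-- The array `a` may be written by the program. -/
def Program.writesArr (a : ℕ) : Program → Bool
  | .skip => false
  | .setReg .. => false
  | .setCell b .. => b == a
  | .seq c₁ c₂ => c₁.writesArr a || c₂.writesArr a
  | .ifLt _ _ c₁ c₂ => c₁.writesArr a || c₂.writesArr a
  | .ifEq _ _ c₁ c₂ => c₁.writesArr a || c₂.writesArr a
  | .loop _ _ c => c.writesArr a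

@[simp] lemma reg_writeReg (s : State) (x v y : ℕ) :
    (s.writeReg x v).reg y = if y = x then v else s.reg y := rfl

@[simp] lemma arr_writeReg (s : State) (x v : ℕ) : (s.writeReg x v).arr = s.arr := rfl

@[simp] lemma reg_writeCell (s : State) (a i j k v : ℕ) : (s.writeCell a i j k v).reg = s.reg := rfl

@[simp] lemma arr_writeCell (s : State) (a i j k v a' i' j' k' : ℕ) :
    (s.writeCell a i j k v).arr a' i' j' k' =
      if a' = a ∧ i' = i ∧ j' = j ∧ k' = k then v else s.arr a' i' j' k' := rfl

@[simp] lemma reg_ite (p : Prop) [Decidable p] (s t : State) (x : ℕ) :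
    (if p then s else t).reg x = if p then s.reg x else t.reg x := by
  split_ifs <;> rfl

@[simp] lemma arr_ite (p : Prop) [Decidable p] (s t : State) (a i j k : ℕ) :
    (if p then s else t).arr a i j k = if p then s.arr a i j k else t.arr a i j k := by
  split_ifs <;> rfl

lemma arr_writeCell_of_ne (s : State) {a i j k v a' : ℕ} (h : a' ≠ a) :
    (s.writeCell a i j k v).arr a' = s.arr a' := by
  ext i' j' k'
  simp [h]

attribute [simp] Expr.eval

@[simp] lemma run_skip (s : State) : Program.skip.run s = s := rfl

@[simp] lemma run_setReg (x : ℕ) (e : Expr) (s : State) :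
    (Program.setReg x e).run s = s.writeReg x (e.eval s) := rfl

@[simp] lemma run_setCell (a : ℕ) (i j k e : Expr) (s : State) :
    (Program.setCell a i j k e).run s =
      s.writeCell a (i.eval s) (j.eval s) (k.eval s) (e.eval s) := rfl

@[simp] lemma run_seq (c₁ c₂ : Program) (s : State) :
    (Program.seq c₁ c₂).run s = c₂.run (c₁.run s) := rfl

@[simp] lemma run_ifLt (e₁ e₂ : Expr) (c₁ c₂ : Program) (s : State) :
    (Program.ifLt e₁ e₂ c₁ c₂).run s =
      if e₁.eval s < e₂.eval s then c₁.run s else c₂.run s := by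
  simp only [Program.run, Program.exec]
  split_ifs <;> rfl

@[simp] lemma run_ifEq (e₁ e₂ : Expr) (c₁ c₂ : Program) (s : State) :
    (Program.ifEq e₁ e₂ c₁ c₂).run s =
      if e₁.eval s = e₂.eval s then c₁.run s else c₂.run s := by
  simp only [Program.run, Program.exec]
  split_ifs <;> rfl

/-- One iteration of a loop. -/
def loopStep (x : ℕ) (c : Program) (q : State × ℕ) (i : ℕ) : State × ℕ :=
  ((c.exec (q.1.writeReg x i)).1, q.2 + 1 + (c.exec (q.1.writeReg x i)).2)

/-- The invariant speaks of the memory and the number of steps, so this rule serves both correctness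
and running time. -/
lemma exec_loop_induction {x : ℕ} {e : Expr} {c : Program} {s : State}
    (I : ℕ → State × ℕ → Prop) (h0 : I 0 (s, 1 + e.cost))
    (hstep : ∀ i < e.eval s, ∀ q, I i q → I (i + 1) (loopStep x c q i)) :
    I (e.eval s) ((Program.loop x e c).exec s) := by
  have : ∀ m ≤ e.eval s, I m ((List.range m).foldl (loopStep x c) (s, 1 + e.cost)) := by
    intro m
    induction m with
    | zero => exact fun _ => h0
    | succ m ih =>
      intro hm
      rw [List.range_succ, List.foldl_append]
      exact hstep m hm _ (ih (by omega))
  exact this _ le_rfl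

/-- The hypothesis is syntactic. For a concrete program it is closed by `rfl`, which makes framing
cheap. -/
lemma run_reg {c : Program} {x : ℕ} (h : c.writesReg x = false) (s : State) :
    (c.run s).reg x = s.reg x := by
  induction c generalizing s with
  | skip => rfl
  | setReg y e =>
    have : x ≠ y := by rintro rfl; simp [Program.writesReg] at h
    simp [this]
  | setCell => rfl
  | seq c₁ c₂ ih₁ ih₂ =>
    simp only [Program.writesReg, Bool.or_eq_false_iff] at h
    rw [run_seq, ih₂ h.2, ih₁ h.1]
  | ifLt e₁ e₂ c₁ c₂ ih₁ ih₂ =>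
    simp only [Program.writesReg, Bool.or_eq_false_iff] at h
    rw [run_ifLt]
    split_ifs
    · exact ih₁ h.1 s
    · exact ih₂ h.2 s
  | ifEq e₁ e₂ c₁ c₂ ih₁ ih₂ =>
    simp only [Program.writesReg, Bool.or_eq_false_iff] at h
    rw [run_ifEq]
    split_ifs
    · exact ih₁ h.1 s
    · exact ih₂ h.2 s
  | loop y e c ih =>
    simp only [Program.writesReg, Bool.or_eq_false_iff, beq_eq_false_iff_ne] at h
    refine exec_loop_induction (I := fun _ q => q.1.reg x = s.reg x) rfl (fun i _ q hq => ?_)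
    refine (ih h.2 _).trans ?_
    rw [reg_writeReg, if_neg h.1.symm, hq]

lemma run_arr {c : Program} {a : ℕ} (h : c.writesArr a = false) (s : State) :
    (c.run s).arr a = s.arr a := by
  induction c generalizing s with
  | skip => rfl
  | setReg y e => rfl
  | setCell b i j k e =>
    simp only [Program.writesArr, beq_eq_false_iff_ne] at h
    rw [run_setCell, arr_writeCell_of_ne _ h.symm]
  | seq c₁ c₂ ih₁ ih₂ =>
    simp only [Program.writesArr, Bool.or_eq_false_iff] at h
    rw [run_seq, ih₂ h.2, ih₁ h.1]
  | ifLt e₁ e₂ c₁ c₂ ih₁ ih₂ =>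
    simp only [Program.writesArr, Bool.or_eq_false_iff] at h
    rw [run_ifLt]
    split_ifs
    · exact ih₁ h.1 s
    · exact ih₂ h.2 s
  | ifEq e₁ e₂ c₁ c₂ ih₁ ih₂ =>
    simp only [Program.writesArr, Bool.or_eq_false_iff] at h
    rw [run_ifEq]
    split_ifs
    · exact ih₁ h.1 s
    · exact ih₂ h.2 s
  | loop y e c ih =>
    simp only [Program.writesArr] at h
    refine exec_loop_induction (I := fun _ q => q.1.arr a = s.arr a) rfl (fun i _ q hq => ?_)
    exact (ih h _).trans hq

/-- The memory `s'` agrees with `s` on everything that is not written by `c`. -/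
structure Frame (c : Program) (s s' : State) : Prop where
  reg : ∀ y, c.writesReg y = false → s'.reg y = s.reg y
  arr : ∀ a, c.writesArr a = false → s'.arr a = s.arr a

/-- The invariant rule for loops; what the loop does not write may be assumed unchanged. -/
lemma run_loop {x : ℕ} {e : Expr} {c : Program} {s : State} (I : ℕ → State → Prop) (h0 : I 0 s)
    (hstep : ∀ i < e.eval s, ∀ s', Frame (Program.loop x e c) s s' → I i s' →
      I (i + 1) (c.run (s'.writeReg x i))) :
    I (e.eval s) ((Program.loop x e c).run s) := by
  have := exec_loop_induction (x := x) (e := e) (c := c) (s := s)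
    (I := fun i q => Frame (Program.loop x e c) s q.1 ∧ I i q.1)
    ⟨⟨fun _ _ => rfl, fun _ _ => rfl⟩, h0⟩ (fun i hi q hq => ⟨⟨fun y hy => ?_, fun a ha => ?_⟩,
      hstep i hi q.1 hq.1 hq.2⟩)
  · exact this.2
  · have h := hy
    simp only [Program.writesReg, Bool.or_eq_false_iff, beq_eq_false_iff_ne] at h
    refine (run_reg h.2 _).trans ?_
    rw [reg_writeReg, if_neg h.1.symm, hq.1.reg y hy]
  · exact (run_arr (c := c) ha _).trans (hq.1.arr a ha)

/-! ### Costs of programs with uniform loop bounds -/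

/-- The expression is the register `x`. -/
def Expr.isReg (x : ℕ) : Expr → Bool
  | .reg y => y == x
  | _ => false

lemma Expr.eval_of_isReg {x : ℕ} {e : Expr} (h : e.isReg x = true) (s : State) :
    e.eval s = s.reg x := by
  cases e <;> simp_all [Expr.isReg]

/-- All loops run up to register `0` or register `2`, these registers are not written, and
the nesting of loops is at most `d` up to register `0`, with possibly another loop up to
register `0` or register `2` if `b` is true. -/
def Program.fits : Program → ℕ → Bool → Bool
  | .skip, _, _ => true
  | .setReg x _, _, _ => x != 0 && x != 2
  | .setCell .., _, _ => true
  | .seq c₁ c₂, d, b => c₁.fits d b && c₂.fits d b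
  | .ifLt _ _ c₁ c₂, d, b => c₁.fits d b && c₂.fits d b
  | .ifEq _ _ c₁ c₂, d, b => c₁.fits d b && c₂.fits d b
  | .loop x e c, d, b => x != 0 && x != 2 &&
      ((e.isReg 0 && d != 0 && c.fits (d - 1) b) ||
        ((e.isReg 0 || e.isReg 2) && b && c.fits d false))

/-- The size of a program, a factor for its running time. -/
def Program.size : Program → ℕ
  | .skip => 1
  | .setReg _ e => 1 + e.cost
  | .setCell _ i j k e => 1 + i.cost + j.cost + k.cost + e.cost
  | .seq c₁ c₂ => c₁.size + c₂.size
  | .ifLt e₁ e₂ c₁ c₂ => 1 + e₁.cost + e₂.cost + c₁.size + c₂.size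
  | .ifEq e₁ e₂ c₁ c₂ => 1 + e₁.cost + e₂.cost + c₁.size + c₂.size
  | .loop _ e c => 2 + e.cost + c.size

lemma cost_loop_le {x : ℕ} {e : Expr} {c : Program} {s : State} {w N : ℕ} (hw : 1 ≤ w) (hN : 1 ≤ N)
    (he : e.eval s ≤ N) {n p : ℕ} (h0 : s.reg 0 = n) (h2 : s.reg 2 = p) (hx0 : x ≠ 0) (hx2 : x ≠ 2)
    (hc : ∀ s : State, s.reg 0 = n → s.reg 2 = p →
      (c.exec s).2 ≤ c.size * w ∧ (c.exec s).1.reg 0 = n ∧ (c.exec s).1.reg 2 = p) :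
    ((Program.loop x e c).exec s).2 ≤ (Program.loop x e c).size * (N * w) ∧
      ((Program.loop x e c).exec s).1.reg 0 = n ∧ ((Program.loop x e c).exec s).1.reg 2 = p := by
  have := exec_loop_induction (x := x) (e := e) (c := c) (s := s)
    (I := fun i q => q.2 ≤ 1 + e.cost + i * (1 + c.size * w) ∧ q.1.reg 0 = n ∧ q.1.reg 2 = p)
    ⟨by simp, h0, h2⟩ (fun i hi q hq => ?_)
  · refine ⟨this.1.trans ?_, this.2⟩
    -- Of the summand `2` in the size of a loop, one unit pays for entering the loop and one for the
    -- extra step of each iteration.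
    have h1 : e.eval s * (1 + c.size * w) ≤ N * (1 + c.size * w) := Nat.mul_le_mul_right _ he
    have h3 : 1 ≤ N * w := Nat.mul_pos hN hw
    have h4 : N * 1 ≤ N * w := Nat.mul_le_mul_left _ hw
    have h5 : (1 + e.cost) * 1 ≤ (1 + e.cost) * (N * w) := Nat.mul_le_mul_left _ h3
    simp only [Program.size]
    nlinarith
  · have h := hc (q.1.writeReg x i) (by simpa [hx0.symm] using hq.2.1)
      (by simpa [hx2.symm] using hq.2.2)
    refine ⟨?_, h.2⟩
    have h1 := hq.1
    have h3 := h.1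
    simp only [loopStep]
    rw [Nat.succ_mul]
    omega

/-- Each nested loop multiplies the bound by the number of its iterations: `n` for the loops counted
by `d`, and `p` for the single loop that the flag `b` permits. By `n ≤ p` this last loop may also
run up to `n`. -/
lemma cost_le_of_fits {c : Program} {d : ℕ} {b : Bool} (hf : c.fits d b = true) {n p : ℕ}
    (hn : 1 ≤ n) (hnp : n ≤ p) {s : State} (h0 : s.reg 0 = n) (h2 : s.reg 2 = p) :
    (c.exec s).2 ≤ c.size * (n ^ d * (if b then p else 1)) ∧
      (c.exec s).1.reg 0 = n ∧ (c.exec s).1.reg 2 = p := by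
  have hw : ∀ (d : ℕ) (b : Bool), 1 ≤ n ^ d * (if b then p else 1) := fun d b =>
    Nat.mul_pos (Nat.pow_pos hn) (by split_ifs <;> omega)
  have hle : ∀ (d : ℕ) (b : Bool) (k : ℕ), k ≤ k * (n ^ d * (if b then p else 1)) := fun d b k =>
    Nat.le_mul_of_pos_right k (hw d b)
  induction c generalizing d b s with
  | skip => exact ⟨hw d b |>.trans (by simp [Program.size]), h0, h2⟩
  | setReg x e =>
    simp only [Program.fits, Bool.and_eq_true, bne_iff_ne] at hf
    refine ⟨hle d b _, ?_, ?_⟩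
    · simpa [Program.exec, hf.1.symm] using h0
    · simpa [Program.exec, hf.2.symm] using h2
  | setCell => exact ⟨hle d b _, h0, h2⟩
  | seq c₁ c₂ ih₁ ih₂ =>
    simp only [Program.fits, Bool.and_eq_true] at hf
    obtain ⟨h1, h10, h12⟩ := ih₁ hf.1 h0 h2
    obtain ⟨h3, h30, h32⟩ := ih₂ hf.2 h10 h12
    refine ⟨?_, h30, h32⟩
    simp only [Program.exec, Program.size, Nat.add_mul]
    omega
  | ifLt e₁ e₂ c₁ c₂ ih₁ ih₂ =>
    simp only [Program.fits, Bool.and_eq_true] at hf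
    obtain ⟨h1, h10, h12⟩ := ih₁ hf.1 h0 h2
    obtain ⟨h3, h30, h32⟩ := ih₂ hf.2 h0 h2
    have h4 := hle d b (1 + e₁.cost + e₂.cost)
    simp only [Program.exec, Program.size, Nat.add_mul] at h4 ⊢
    split_ifs at h1 h3 h4 ⊢ <;> refine ⟨?_, by assumption, by assumption⟩ <;> dsimp only <;> omega
  | ifEq e₁ e₂ c₁ c₂ ih₁ ih₂ =>
    simp only [Program.fits, Bool.and_eq_true] at hf
    obtain ⟨h1, h10, h12⟩ := ih₁ hf.1 h0 h2
    obtain ⟨h3, h30, h32⟩ := ih₂ hf.2 h0 h2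
    have h4 := hle d b (1 + e₁.cost + e₂.cost)
    simp only [Program.exec, Program.size, Nat.add_mul] at h4 ⊢
    split_ifs at h1 h3 h4 ⊢ <;> refine ⟨?_, by assumption, by assumption⟩ <;> dsimp only <;> omega
  | loop x e c ih =>
    simp only [Program.fits, Bool.and_eq_true, Bool.or_eq_true, bne_iff_ne] at hf
    obtain ⟨⟨hx0, hx2⟩, ⟨⟨he, hd⟩, hf⟩ | ⟨⟨he, hb⟩, hf⟩⟩ := hf
    · have h := cost_loop_le (x := x) (e := e) (c := c) (s := s) (hw (d - 1) b) hn
        (by rw [Expr.eval_of_isReg he, h0]) h0 h2 hx0 hx2 (fun s h0 h2 => ih hf h0 h2)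
      obtain ⟨d, rfl⟩ := Nat.exists_eq_succ_of_ne_zero hd
      rwa [Nat.succ_sub_one, ← mul_assoc n, ← pow_succ'] at h
    · have h := cost_loop_le (x := x) (e := e) (c := c) (s := s) (N := p) (hw d false) (by omega)
        (by
          rcases he with he | he
          · rw [Expr.eval_of_isReg he, h0]; exact hnp
          · rw [Expr.eval_of_isReg he, h2]) h0 h2 hx0 hx2 (fun s h0 h2 => ih hf h0 h2)
      rw [if_pos hb]
      simpa [mul_comm] using h

variable {n : ℕ} {G : SimpleGraph (Fin n)} {r : Fin n} {L : List (Fin n × Fin n)}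

/-! ### The input -/

/-- The memory contains the input. -/
structure HasInput (G : SimpleGraph (Fin n)) (r : Fin n) (L : List (Fin n × Fin n))
    (s : State) : Prop where
  card : s.reg 0 = n
  root : s.reg 1 = r
  tuples : s.reg 2 = L.length
  adj : ∀ u v : Fin n, s.arr 0 u v 0 = 1 ↔ G.Adj u v
  -- The number `n` will stand for a missing vertex, and its row in the matrix is empty.
  adj_card : ∀ j, s.arr 0 n j 0 = 0
  fst : ∀ t (h : t < L.length), s.arr 1 t 0 0 = (L[t].1 : ℕ)
  snd : ∀ t (h : t < L.length), s.arr 1 t 1 0 = (L[t].2 : ℕ)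

lemma hasInput_input (G : SimpleGraph (Fin n)) (r : Fin n) (L : List (Fin n × Fin n)) :
    HasInput G r L (input G r L) where
  card := by simp [input]
  root := by simp [input]
  tuples := by simp [input]
  adj u v := by
    simp only [input, if_true]
    constructor
    · intro h
      by_contra hcon
      rw [if_neg] at h
      · exact absurd h (by simp)
      · rintro ⟨u', v', h1, h2, h3, -⟩
        rw [Fin.val_inj] at h2 h3
        exact hcon (h2 ▸ h3 ▸ h1)
    · exact fun h => if_pos ⟨u, v, h, rfl, rfl, rfl⟩
  adj_card j := by
    simp only [input, if_true]
    rw [if_neg]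
    rintro ⟨u, v, -, h, -⟩
    omega
  fst t h := by simp [input, List.getElem?_eq_getElem h]
  snd t h := by simp [input, List.getElem?_eq_getElem h]

/-- The program does not write to the input. -/
def Program.keepsInput (c : Program) : Bool :=
  !c.writesReg 0 && !c.writesReg 1 && !c.writesReg 2 && !c.writesArr 0 && !c.writesArr 1

lemma HasInput.of_eq {s s' : State} (h : HasInput G r L s) (h0 : s'.reg 0 = s.reg 0)
    (h1 : s'.reg 1 = s.reg 1) (h2 : s'.reg 2 = s.reg 2) (ha0 : s'.arr 0 = s.arr 0)
    (ha1 : s'.arr 1 = s.arr 1) : HasInput G r L s' := by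
  obtain ⟨h3, h4, h5, h6, h7, h8, h9⟩ := h
  rw [← h0] at h3
  rw [← h1] at h4
  rw [← h2] at h5
  rw [← ha0] at h6 h7
  rw [← ha1] at h8 h9
  exact ⟨h3, h4, h5, h6, h7, h8, h9⟩

lemma HasInput.run {s : State} (h : HasInput G r L s) {c : Program}
    (hc : c.keepsInput = true) : HasInput G r L (c.run s) := by
  simp only [Program.keepsInput, Bool.and_eq_true, Bool.not_eq_true'] at hc
  obtain ⟨⟨⟨⟨h0, h1⟩, h2⟩, h3⟩, h4⟩ := hc
  exact h.of_eq (run_reg h0 s) (run_reg h1 s) (run_reg h2 s) (run_arr h3 s) (run_arr h4 s)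

lemma HasInput.frame {s s' : State} (h : HasInput G r L s) {c : Program} (hF : Frame c s s')
    (hc : c.keepsInput = true) : HasInput G r L s' := by
  simp only [Program.keepsInput, Bool.and_eq_true, Bool.not_eq_true'] at hc
  obtain ⟨⟨⟨⟨h0, h1⟩, h2⟩, h3⟩, h4⟩ := hc
  exact h.of_eq (hF.reg _ h0) (hF.reg _ h1) (hF.reg _ h2) (hF.arr _ h3) (hF.arr _ h4)

lemma HasInput.writeReg {s : State} (h : HasInput G r L s) (x v : ℕ) (hx : 3 ≤ x) :
    HasInput G r L (s.writeReg x v) := by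
  refine h.of_eq ?_ ?_ ?_ rfl rfl <;> rw [reg_writeReg, if_neg (by omega)]

/-- The invariant rule for loops over all vertices. -/
lemma HasInput.run_loop {s : State} (hs : HasInput G r L s) {x : ℕ} {c : Program}
    (hc : (Program.loop x (.reg 0) c).keepsInput = true) (I : ℕ → State → Prop) (h0 : I 0 s)
    (hstep : ∀ (i : Fin n) s', Frame (Program.loop x (.reg 0) c) s s' → HasInput G r L s' →
      I i s' → I (i + 1) (c.run (s'.writeReg x i))) :
    I n ((Program.loop x (.reg 0) c).run s) := by
  have h := Machine.run_loop (s := s) (x := x) (e := .reg 0) (c := c) I h0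
    (fun i hi s' hF hI => hstep ⟨i, by simpa [hs.card] using hi⟩ s' hF (hs.frame hF hc) hI)
  simpa [hs.card] using h

/-- The invariant rule for loops over all tuples. -/
lemma HasInput.run_loop_tuples {s : State} (hs : HasInput G r L s) {x : ℕ} {c : Program}
    (hc : (Program.loop x (.reg 2) c).keepsInput = true) (I : ℕ → State → Prop) (h0 : I 0 s)
    (hstep : ∀ i < L.length, ∀ s', Frame (Program.loop x (.reg 2) c) s s' → HasInput G r L s' →
      I i s' → I (i + 1) (c.run (s'.writeReg x i))) :
    I L.length ((Program.loop x (.reg 2) c).run s) := by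
  have h := Machine.run_loop (s := s) (x := x) (e := .reg 2) (c := c) I h0
    (fun i hi s' hF hI => hstep i (by simpa [hs.tuples] using hi) s' hF (hs.frame hF hc) hI)
  simpa [hs.tuples] using h

/-- The cell `i` of a one-dimensional array. -/
abbrev Expr.at (a : ℕ) (i : Expr) : Expr := .cell a i (.const 0) (.const 0)

/-- Write a cell of a one-dimensional array. -/
abbrev Program.put (a : ℕ) (i e : Expr) : Program := .setCell a i (.const 0) (.const 0) e

/-! ### Distances -/

/-- The vertices without a distance that are adjacent to the vertex in register `11` get the
distance following the one in register `10`. -/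
def visitNeighbors : Program :=
  .loop 12 (.reg 0) (.ifEq (.cell 0 (.reg 11) (.reg 12) (.const 0)) (.const 1)
    (.ifEq (.at 7 (.reg 12)) (.const 0) (.put 7 (.reg 12) (.succ (.succ (.reg 10)))) .skip) .skip)

/-- Visit the neighbors of all vertices at the distance in register `10`. -/
def visitLayer : Program :=
  .loop 11 (.reg 0) (.ifEq (.at 7 (.reg 11)) (.succ (.reg 10)) visitNeighbors .skip)

/-- Array `7` gets the distances from the root, increased by one. -/
def computeDist : Program :=
  .seq (.put 7 (.reg 1) (.const 1)) (.loop 10 (.reg 0) visitLayer)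

open Classical in
lemma visitNeighbors_spec {s : State} (hs : HasInput G r L s) {u : Fin n} (hu : s.reg 11 = u)
    (v : Fin n) : (visitNeighbors.run s).arr 7 v 0 0 =
      if s.arr 7 v 0 0 = 0 ∧ G.Adj u v then s.reg 10 + 2 else s.arr 7 v 0 0 := by
  refine (hs.run_loop rfl (fun i s' => ∀ v : Fin n, s'.arr 7 v 0 0 =
    if v < i ∧ s.arr 7 v 0 0 = 0 ∧ G.Adj u v then s.reg 10 + 2 else s.arr 7 v 0 0)
    (by simp) (fun i s' hF hs' hI v => ?_) v).trans (by simp)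
  have hadj := hs'.adj u i
  have h10 := hF.reg 10 rfl
  have h11 := hF.reg 11 rfl
  have h1 := hI i
  have h2 := hI v
  simp only [run_ifEq, run_setCell, run_skip, Expr.eval, reg_writeReg, arr_writeReg, arr_writeCell,
    arr_ite, h10, h11, hu]
  norm_num
  grind

lemma exists_lt_succ_iff (P : Fin n → Prop) (i : Fin n) :
    (∃ u : Fin n, (u : ℕ) < i + 1 ∧ P u) ↔ (∃ u : Fin n, (u : ℕ) < i ∧ P u) ∨ P i := by
  constructor
  · rintro ⟨u, hu, h⟩
    rcases Nat.lt_succ_iff_lt_or_eq.1 hu with hu | hu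
    · exact Or.inl ⟨u, hu, h⟩
    · rw [Fin.val_inj] at hu
      exact Or.inr (hu ▸ h)
  · rintro (⟨u, hu, h⟩ | h)
    · exact ⟨u, by omega, h⟩
    · exact ⟨i, by omega, h⟩

/-- A vertex discovered in this round gets `s.reg 10 + 2` and cannot be mistaken for a vertex of the
current layer, which has `s.reg 10 + 1`. So the order of the visits is irrelevant. -/
lemma visitLayer_spec {s : State} (hs : HasInput G r L s) (v : Fin n) :
    ((s.arr 7 v 0 0 = 0 ∧ ∃ u : Fin n, s.arr 7 u 0 0 = s.reg 10 + 1 ∧ G.Adj u v) →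
      (visitLayer.run s).arr 7 v 0 0 = s.reg 10 + 2) ∧
    (¬ (s.arr 7 v 0 0 = 0 ∧ ∃ u : Fin n, s.arr 7 u 0 0 = s.reg 10 + 1 ∧ G.Adj u v) →
      (visitLayer.run s).arr 7 v 0 0 = s.arr 7 v 0 0) := by
  have := hs.run_loop (x := 11) (c := .ifEq (.at 7 (.reg 11)) (.succ (.reg 10)) visitNeighbors .skip)
    rfl (fun i s' => ∀ v : Fin n,
    ((s.arr 7 v 0 0 = 0 ∧ ∃ u : Fin n, u < i ∧ s.arr 7 u 0 0 = s.reg 10 + 1 ∧ G.Adj u v) →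
      s'.arr 7 v 0 0 = s.reg 10 + 2) ∧
    (¬ (s.arr 7 v 0 0 = 0 ∧ ∃ u : Fin n, u < i ∧ s.arr 7 u 0 0 = s.reg 10 + 1 ∧ G.Adj u v) →
      s'.arr 7 v 0 0 = s.arr 7 v 0 0))
    (by simp) (fun i s' hF hs' hI v => ?_)
  · simpa [visitLayer] using this v
  have h := visitNeighbors_spec (hs'.writeReg 11 i (by norm_num)) (u := i) rfl v
  have h10 := hF.reg 10 rfl
  have h1 := hI i
  have h2 := hI v
  rw [exists_lt_succ_iff]
  generalize (∃ u : Fin n, (u : ℕ) < i ∧ s.arr 7 u 0 0 = s.reg 10 + 1 ∧ G.Adj u i) = P at *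
  generalize (∃ u : Fin n, (u : ℕ) < i ∧ s.arr 7 u 0 0 = s.reg 10 + 1 ∧ G.Adj u v) = Q at *
  clear hI hF
  simp only [run_ifEq, run_skip, Expr.eval, reg_writeReg, arr_writeReg, arr_ite, h10] at h ⊢
  norm_num at h ⊢
  grind

lemma dist_lt_card (hc : G.Connected) (v : Fin n) : G.dist r v < n := by
  obtain ⟨p, hp⟩ := hc.exists_path_of_dist r v
  have := hp.1.length_lt
  simpa [hp.2] using this

/-- An entry `0` means that no distance is known yet, hence the shift by one. Before round `i`
exactly the vertices at distance at most `i` have their entries, and `n` rounds suffice because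
distances are less than `n`. -/
lemma computeDist_spec (hc : G.Connected) {s : State} (hs : HasInput G r L s)
    (h0 : ∀ v : Fin n, s.arr 7 v 0 0 = 0) (v : Fin n) :
    (computeDist.run s).arr 7 v 0 0 = G.dist r v + 1 := by
  have hs1 : HasInput G r L ((Program.put 7 (.reg 1) (.const 1)).run s) := hs.run rfl
  have h := hs1.run_loop (x := 10) (c := visitLayer) rfl (fun i s' => ∀ v : Fin n, s'.arr 7 v 0 0 =
    if G.dist r v ≤ i then G.dist r v + 1 else 0) ?_ ?_ v
  · rw [if_pos (dist_lt_card hc v).le] at h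
    exact h
  · intro v
    simp only [run_setCell, Expr.eval, arr_writeCell, hs.root, h0, Fin.val_inj, Nat.le_zero,
      hc.dist_eq_zero_iff]
    by_cases hv : v = r
    · subst hv; simp
    · simp [hv, Ne.symm hv]
  · intro i s' hF hs' hI v
    have h := visitLayer_spec (hs'.writeReg 10 i (by norm_num)) v
    have h1 : ∀ u : Fin n, (if G.dist r u ≤ i then G.dist r u + 1 else 0) = (i : ℕ) + 1 ↔
        G.dist r u = i := by
      intro u
      grind
    simp only [reg_writeReg, arr_writeReg, hI, if_true, h1] at h
    by_cases h2 : G.dist r v ≤ i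
    · rw [h.2 (by rw [if_pos h2]; simp), if_pos h2, if_pos (by omega)]
    · by_cases h3 : G.dist r v = i + 1
      · obtain ⟨u, huv, hu⟩ := exists_parent hc h3
        rw [h.1 ⟨if_neg h2, u, hu, huv⟩, if_pos h3.le, h3]
      · rw [h.2, if_neg h2, if_neg (by omega)]
        rintro ⟨-, u, hu, huv⟩
        have := huv.diff_dist_adj (u := r)
        omega

/-! ### Numbers of neighbors in the preceding layer -/

/-- The number of neighbors of `v` in the layer before the layer of `v`. -/
noncomputable def parents (G : SimpleGraph (Fin n)) (r v : Fin n) : ℕ :=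
  {w | G.Adj v w ∧ G.dist r w + 1 = G.dist r v}.ncard

/-- Count the parents of the vertex in register `10`. -/
def countRow : Program :=
  .loop 11 (.reg 0) (.ifEq (.cell 0 (.reg 10) (.reg 11) (.const 0)) (.const 1)
    (.ifEq (.succ (.at 7 (.reg 11))) (.at 7 (.reg 10))
      (.put 8 (.reg 10) (.succ (.at 8 (.reg 10)))) .skip) .skip)

/-- Array `8` gets the numbers of parents. -/
def countParents : Program := .loop 10 (.reg 0) countRow

lemma ncard_lt_succ (P : Fin n → Prop) (i : Fin n) [Decidable (P i)] :
    {w : Fin n | (w : ℕ) < i + 1 ∧ P w}.ncard =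
      {w : Fin n | (w : ℕ) < i ∧ P w}.ncard + if P i then 1 else 0 := by
  split_ifs with h
  · rw [← Set.ncard_insert_of_notMem (a := i) (by simp)]
    congr 1
    ext w
    simp only [Set.mem_ofPred_eq, Set.mem_insert_iff, Nat.lt_succ_iff_lt_or_eq, Fin.val_inj]
    constructor
    · rintro ⟨h1 | h1, h2⟩
      · exact Or.inr ⟨h1, h2⟩
      · exact Or.inl h1
    · rintro (rfl | h1)
      · exact ⟨Or.inr rfl, h⟩
      · exact ⟨Or.inl h1.1, h1.2⟩
  · rw [add_zero]
    congr 1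
    ext w
    simp only [Set.mem_ofPred_eq, Nat.lt_succ_iff_lt_or_eq, Fin.val_inj]
    constructor
    · rintro ⟨h1 | rfl, h2⟩
      · exact ⟨h1, h2⟩
      · exact absurd h2 h
    · exact fun h => ⟨Or.inl h.1, h.2⟩

lemma countRow_spec {s : State} (hs : HasInput G r L s)
    (hd : ∀ v : Fin n, s.arr 7 v 0 0 = G.dist r v + 1) {v : Fin n} (hv : s.reg 10 = v) (j : ℕ) :
    (countRow.run s).arr 8 j 0 0 = s.arr 8 j 0 0 + if j = v then parents G r v else 0 := by
  classical
  refine (hs.run_loop rfl (fun i s' => ∀ j, s'.arr 8 j 0 0 = s.arr 8 j 0 0 +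
    if j = v then {w : Fin n | (w : ℕ) < i ∧ G.Adj v w ∧ G.dist r w + 1 = G.dist r v}.ncard else 0)
    (by simp) (fun i s' hF hs' hI j => ?_) j).trans (by simp [parents])
  have h7 := hF.arr 7 rfl
  have h10 := hF.reg 10 rfl
  have hadj := hs'.adj v i
  have h1 := hI v
  have h2 := hI j
  simp only [run_ifEq, run_setCell, run_skip, Expr.eval, reg_writeReg, arr_writeReg, arr_writeCell,
    arr_ite, h7, h10, hv, ncard_lt_succ]
  norm_num [hd]
  grind

lemma countParents_spec {s : State} (hs : HasInput G r L s)
    (hd : ∀ v : Fin n, s.arr 7 v 0 0 = G.dist r v + 1) (h0 : ∀ j, s.arr 8 j 0 0 = 0) :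
    (∀ v : Fin n, (countParents.run s).arr 8 v 0 0 = parents G r v) ∧
      (countParents.run s).arr 8 n 0 0 = 0 := by
  have := hs.run_loop (x := 10) (c := countRow) rfl (fun i s' =>
    (∀ v : Fin n, s'.arr 8 v 0 0 = if v < i then parents G r v else 0) ∧ s'.arr 8 n 0 0 = 0)
    (by simp [h0]) ?_
  · exact ⟨fun v => (this.1 v).trans (if_pos v.2), this.2⟩
  · intro i s' hF hs' hI
    have h7 := hF.arr 7 rfl
    have h := countRow_spec (hs'.writeReg 10 i (by norm_num)) (by simpa [h7] using hd) (v := i) rfl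
    simp only [arr_writeReg] at h
    refine ⟨fun v => ?_, ?_⟩
    · rw [h, hI.1]
      rcases eq_or_ne v i with rfl | hvi
      · simp
      · have : (v : ℕ) ≠ i := fun h => hvi (Fin.ext h)
        grind
    · rw [h, hI.2, if_neg (by omega)]

/-! ### Layers and the partial order -/

/-- Register `3` gets `0` if some tuple points to an earlier layer and `1` otherwise. -/
def checkLayers : Program :=
  .seq (.setReg 3 (.const 1)) (.loop 10 (.reg 2)
    (.ifLt (.at 7 (.cell 1 (.reg 10) (.const 1) (.const 0)))
      (.at 7 (.cell 1 (.reg 10) (.const 0) (.const 0))) (.setReg 3 (.const 0)) .skip))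

lemma checkLayers_spec {π : Fin n → Fin n → Prop} (hL : ∀ x y, (x, y) ∈ L ↔ π x y) {s : State}
    (hs : HasInput G r L s) (hd : ∀ v : Fin n, s.arr 7 v 0 0 = G.dist r v + 1) :
    (checkLayers.run s).reg 3 = 1 ↔ ¬ ViolatesLayers G r π := by
  have hs1 : HasInput G r L ((Program.setReg 3 (.const 1)).run s) := hs.run rfl
  have h := hs1.run_loop_tuples (x := 10) (c := .ifLt
    (.at 7 (.cell 1 (.reg 10) (.const 1) (.const 0)))
    (.at 7 (.cell 1 (.reg 10) (.const 0) (.const 0))) (.setReg 3 (.const 0)) .skip) rfl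
    (fun i s' => s'.reg 3 = 1 ↔ ∀ j (hj : j < L.length), j < i →
      ¬ G.dist r L[j].2 < G.dist r L[j].1) (by simp) ?_
  · refine h.trans ⟨?_, ?_⟩
    · rintro h ⟨x, y, hxy, hlt⟩
      obtain ⟨j, hj, he⟩ := List.getElem_of_mem ((hL x y).2 hxy)
      exact h j hj hj (by rw [he]; exact hlt)
    · intro h j hj _ hlt
      exact h ⟨L[j].1, L[j].2, (hL _ _).1 (List.getElem_mem hj), hlt⟩
  · intro i hi s' hF hs' hI
    have h7 : s'.arr 7 = s.arr 7 := hF.arr 7 rfl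
    simp only [run_ifLt, run_setReg, run_skip, Expr.eval, reg_writeReg, arr_writeReg, reg_ite,
      if_true, hs'.fst i hi, hs'.snd i hi, h7, hd]
    norm_num
    constructor
    · intro h j hj hji
      rcases hji.lt_or_eq with h3 | rfl
      · refine not_lt.1 (hI.1 ?_ j hj h3)
        grind
      · grind
    · intro h
      rw [if_neg (not_lt.2 (h i hi le_rfl))]
      exact hI.2 fun j hj hji => not_lt.2 (h j hj (by omega))

end Machine

/-! ### Lists of the pairs in the relations -/

section Pairs

variable {n : ℕ} {G : SimpleGraph (Fin n)} {r : Fin n} {L : List (Fin n × Fin n)}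

/-- The pairs of singletons that form the initial relation of layer `i`. -/
noncomputable def basePairs (G : SimpleGraph (Fin n)) (r : Fin n) (L : List (Fin n × Fin n)) (i : ℕ) :
    List (Set (Fin n) × Set (Fin n)) :=
  (L.filter fun t => t.1 ≠ t.2 ∧ G.dist r t.1 = i ∧ G.dist r t.2 = i).map fun t => ({t.1}, {t.2})

/-- The pair that a pair of layer `i + 2` contributes to layer `i + 1`. -/
def stepPair (G : SimpleGraph (Fin n)) (r : Fin n) (i : ℕ) (q : Set (Fin n) × Set (Fin n)) :
    Set (Fin n) × Set (Fin n) :=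
  (maximalVertices G r i (exclusiveNeighbors G r (i + 1) q.1 q.2),
    exclusiveNeighbors G r (i + 1) q.2 q.1)

/-- The pairs of layer `i` that come from the layers `i, …, i + f`. -/
noncomputable def pairsUpTo (G : SimpleGraph (Fin n)) (r : Fin n) (L : List (Fin n × Fin n)) :
    ℕ → ℕ → List (Set (Fin n) × Set (Fin n))
  | 0, i => basePairs G r L i
  -- For `i ≥ 1`, `stepPair` with index `i - 1` leads from layer `i + 1` to layer `i`.
  | f + 1, i => basePairs G r L i ++ (pairsUpTo G r L f (i + 1)).map (stepPair G r (i - 1))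

/-- The pairs of layer `i`. -/
noncomputable def layerPairs (G : SimpleGraph (Fin n)) (r : Fin n) (L : List (Fin n × Fin n)) (i : ℕ) :
    List (Set (Fin n) × Set (Fin n)) :=
  -- As all distances are less than `n`, no pair comes from a layer after `n`.
  if i = 0 then [] else pairsUpTo G r L (n - i) i

lemma layerPairs_of_le {i : ℕ} (hi : 1 ≤ i) (hn : n ≤ i) :
    layerPairs G r L i = basePairs G r L i := by
  rw [layerPairs, if_neg (by omega), Nat.sub_eq_zero_of_le hn, pairsUpTo]

lemma layerPairs_succ {i : ℕ} (hi : i + 1 < n) :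
    layerPairs G r L (i + 1) =
      basePairs G r L (i + 1) ++ (layerPairs G r L (i + 2)).map (stepPair G r i) := by
  rw [layerPairs, if_neg (by omega), layerPairs, if_neg (by omega),
    show n - (i + 1) = (n - (i + 2)) + 1 by omega, pairsUpTo, Nat.add_sub_cancel]

lemma basePairs_zero (hc : G.Connected) : basePairs G r L 0 = [] := by
  rw [basePairs, List.map_eq_nil_iff, List.filter_eq_nil_iff]
  rintro ⟨x, y⟩ -
  simp only [hc.dist_eq_zero_iff, decide_eq_true_eq]
  rintro ⟨h1, h2, h3⟩
  exact h1 (h2.symm.trans h3)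

/-- A tuple gives a pair of singletons in at most one layer, and each pair of a layer contributes
one pair to the preceding layer. So every pair of layer `i` goes back to its own tuple inside a
layer not before `i`. -/
lemma length_pairsUpTo_le (f i : ℕ) : (pairsUpTo G r L f i).length ≤
    L.countP fun t => i ≤ G.dist r t.1 := by
  induction f generalizing i with
  | zero =>
    rw [pairsUpTo, basePairs, List.length_map, ← List.countP_eq_length_filter]
    refine List.countP_mono_left fun t _ ht => ?_
    simp only [decide_eq_true_eq] at ht ⊢
    omega
  | succ f ih =>
    rw [pairsUpTo, List.length_append, List.length_map, basePairs, List.length_map,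
      ← List.countP_eq_length_filter]
    refine (Nat.add_le_add_left (ih (i + 1)) _).trans ?_
    clear ih
    induction L with
    | nil => simp
    | cons t L ih =>
      simp only [List.countP_cons, decide_eq_true_eq]
      grind

lemma length_layerPairs_le (i : ℕ) : (layerPairs G r L i).length ≤ L.length := by
  rw [layerPairs]
  split_ifs
  · simp
  · exact (length_pairsUpTo_le _ _).trans List.countP_le_length

variable {π : Fin n → Fin n → Prop}

lemma OBARel.lt_card (hc : G.Connected) {i : ℕ} {A B : Set (Fin n)} (h : OBARel G r π i A B) :
    i < n := by
  induction h with
  | @base i x y hi hx =>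
    rw [← show G.dist r x = i from hx]
    exact Machine.dist_lt_card hc x
  | step => omega

lemma oBARel_of_mem_basePairs (hL : ∀ x y, (x, y) ∈ L ↔ π x y) {i : ℕ} (hi : 1 ≤ i)
    {q : Set (Fin n) × Set (Fin n)} (h : q ∈ basePairs G r L i) : OBARel G r π i q.1 q.2 := by
  simp only [basePairs, List.mem_map, List.mem_filter, decide_eq_true_eq] at h
  obtain ⟨⟨x, y⟩, ⟨hxy, hne, hx, hy⟩, rfl⟩ := h
  exact .base hi hx hy ((hL x y).1 hxy) hne

lemma oBARel_of_mem_pairsUpTo (hL : ∀ x y, (x, y) ∈ L ↔ π x y) {f i : ℕ}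
    {q : Set (Fin n) × Set (Fin n)} (h : q ∈ pairsUpTo G r L f (i + 1)) :
    OBARel G r π (i + 1) q.1 q.2 := by
  induction f generalizing i q with
  | zero => exact oBARel_of_mem_basePairs hL (by omega) h
  | succ f ih =>
    rw [pairsUpTo, List.mem_append, List.mem_map] at h
    rcases h with h | ⟨q', hq', rfl⟩
    · exact oBARel_of_mem_basePairs hL (by omega) h
    · exact (ih hq').step

/-- The bounded recursion loses nothing, since only layers with index less than `n` have pairs. -/
lemma mem_layerPairs (hc : G.Connected) (hL : ∀ x y, (x, y) ∈ L ↔ π x y) {i : ℕ}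
    {A B : Set (Fin n)} : (A, B) ∈ layerPairs G r L i ↔ OBARel G r π i A B := by
  constructor
  · intro h
    rw [layerPairs] at h
    split_ifs at h with hi
    · simp at h
    · obtain ⟨i, rfl⟩ := Nat.exists_eq_succ_of_ne_zero hi
      exact oBARel_of_mem_pairsUpTo hL h
  · intro h
    have hbase : ∀ {j : ℕ} {q}, 1 ≤ j → j < n → q ∈ basePairs G r L j → q ∈ layerPairs G r L j := by
      intro j q hj hjn hq
      obtain ⟨j, rfl⟩ := Nat.exists_eq_add_of_le' hj
      rw [layerPairs_succ hjn]
      exact List.mem_append_left _ hq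
    induction h with
    | @base i x y hi hx hy hxy hne =>
      refine hbase hi (by rw [← show G.dist r x = i from hx]; exact Machine.dist_lt_card hc x) ?_
      exact List.mem_map.2 ⟨(x, y), List.mem_filter.2 ⟨(hL x y).2 hxy,
        decide_eq_true ⟨hne, hx, hy⟩⟩, rfl⟩
    | @step i A B h ih =>
      rw [layerPairs_succ (by have := h.lt_card hc; omega)]
      exact List.mem_append_right _ (List.mem_map.2 ⟨(A, B), ih, rfl⟩)

end Pairs

namespace Machine

variable {n : ℕ} {G : SimpleGraph (Fin n)} {r : Fin n} {L : List (Fin n × Fin n)}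

/-! ### Storing pairs of sets -/

/-- The pairs of the list are stored for layer `i`, and the memory behind them is unused. -/
structure StoresPairs (s : State) (i : ℕ) (l : List (Set (Fin n) × Set (Fin n))) : Prop where
  count : s.arr 2 i 0 0 = l.length
  left : ∀ j (h : j < l.length) (v : Fin n), s.arr 3 i j v = 1 ↔ v ∈ l[j].1
  right : ∀ j (h : j < l.length) (v : Fin n), s.arr 4 i j v = 1 ↔ v ∈ l[j].2
  fresh_left : ∀ j, l.length ≤ j → ∀ v : Fin n, s.arr 3 i j v = 0
  fresh_right : ∀ j, l.length ≤ j → ∀ v : Fin n, s.arr 4 i j v = 0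

lemma StoresPairs.congr {s s' : State} {i : ℕ} {l : List (Set (Fin n) × Set (Fin n))}
    (h : StoresPairs s i l) (h2 : s'.arr 2 i 0 0 = s.arr 2 i 0 0)
    (h3 : ∀ j k, s'.arr 3 i j k = s.arr 3 i j k) (h4 : ∀ j k, s'.arr 4 i j k = s.arr 4 i j k) :
    StoresPairs s' i l :=
  ⟨h2.trans h.count, fun j hj v => by rw [h3, h.left j hj], fun j hj v => by rw [h4, h.right j hj],
    fun j hj v => by rw [h3, h.fresh_left j hj], fun j hj v => by rw [h4, h.fresh_right j hj]⟩

lemma StoresPairs.append {s s' : State} {i : ℕ} {l : List (Set (Fin n) × Set (Fin n))}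
    (h : StoresPairs s i l) {A B : Set (Fin n)} (h2 : s'.arr 2 i 0 0 = s.arr 2 i 0 0 + 1)
    (h3 : ∀ j (v : Fin n), j ≠ s.arr 2 i 0 0 → s'.arr 3 i j v = s.arr 3 i j v)
    (h4 : ∀ j (v : Fin n), j ≠ s.arr 2 i 0 0 → s'.arr 4 i j v = s.arr 4 i j v)
    (hA : ∀ v : Fin n, s'.arr 3 i (s.arr 2 i 0 0) v = 1 ↔ v ∈ A)
    (hB : ∀ v : Fin n, s'.arr 4 i (s.arr 2 i 0 0) v = 1 ↔ v ∈ B) :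
    StoresPairs s' i (l ++ [(A, B)]) := by
  rw [h.count] at h2 h3 h4 hA hB
  refine ⟨by simpa using h2, fun j hj v => ?_, fun j hj v => ?_, fun j hj v => ?_, fun j hj v => ?_⟩
  · rw [List.length_append, List.length_singleton] at hj
    rcases Nat.lt_succ_iff_lt_or_eq.1 hj with hj | rfl
    · rw [h3 j v hj.ne, h.left j hj, List.getElem_append_left hj]
    · rw [hA, List.getElem_append_right le_rfl]
      simp
  · rw [List.length_append, List.length_singleton] at hj
    rcases Nat.lt_succ_iff_lt_or_eq.1 hj with hj | rfl
    · rw [h4 j v hj.ne, h.right j hj, List.getElem_append_left hj]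
    · rw [hB, List.getElem_append_right le_rfl]
      simp
  · rw [List.length_append, List.length_singleton] at hj
    rw [h3 j v (by omega), h.fresh_left j (by omega)]
  · rw [List.length_append, List.length_singleton] at hj
    rw [h4 j v (by omega), h.fresh_right j (by omega)]

lemma StoresPairs.storesRelation {s : State} {i : ℕ} {l : List (Set (Fin n) × Set (Fin n))}
    (h : StoresPairs s i l) {R : Set (Fin n) → Set (Fin n) → Prop}
    (hR : ∀ A B, (A, B) ∈ l ↔ R A B) : StoresRelation s i R := by
  intro A B
  rw [← hR, List.mem_iff_getElem, h.count]
  have key : ∀ j (hj : j < l.length), l[j] = ({v : Fin n | s.arr 3 i j v = 1},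
      {v : Fin n | s.arr 4 i j v = 1}) := fun j hj => by
    refine Prod.ext ?_ ?_ <;> ext v
    · exact (h.left j hj v).symm
    · exact (h.right j hj v).symm
  constructor
  · rintro ⟨j, hj, he⟩
    rw [key j hj, Prod.mk.injEq] at he
    exact ⟨j, hj, he.1.symm, he.2.symm⟩
  · rintro ⟨j, hj, rfl, rfl⟩
    exact ⟨j, hj, key j hj⟩

/-- Store the initial relations of all layers. -/
def storeBase : Program :=
  .loop 10 (.reg 2)
    (.seq (.setReg 11 (.cell 1 (.reg 10) (.const 0) (.const 0)))
    (.seq (.setReg 12 (.cell 1 (.reg 10) (.const 1) (.const 0)))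
    -- Distances are stored increased by one, so this is the number of the layer.
    (.seq (.setReg 13 (.sub (.at 7 (.reg 11)) (.const 1)))
    (.ifEq (.reg 11) (.reg 12) .skip (.ifEq (.at 7 (.reg 11)) (.at 7 (.reg 12))
      (.seq (.setCell 3 (.reg 13) (.at 2 (.reg 13)) (.reg 11) (.const 1))
      (.seq (.setCell 4 (.reg 13) (.at 2 (.reg 13)) (.reg 12) (.const 1))
      (.put 2 (.reg 13) (.succ (.at 2 (.reg 13)))))) .skip)))))

lemma basePairs_take_succ {k : ℕ} (hk : k < L.length) (i : ℕ) :
    basePairs G r (L.take (k + 1)) i = basePairs G r (L.take k) i ++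
      if L[k].1 ≠ L[k].2 ∧ G.dist r L[k].1 = i ∧ G.dist r L[k].2 = i then [({L[k].1}, {L[k].2})]
      else [] := by
  rw [basePairs, List.take_succ_eq_append_getElem hk, List.filter_append, List.map_append]
  congr 1
  split_ifs with h
  · rw [List.filter_cons_of_pos (by simpa using h)]
    rfl
  · rw [List.filter_cons_of_neg (by simpa using h)]
    rfl

lemma storeBase_spec {s : State} (hs : HasInput G r L s)
    (hd : ∀ v : Fin n, s.arr 7 v 0 0 = G.dist r v + 1)
    (h0 : ∀ i, StoresPairs (n := n) s i []) (i : ℕ) :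
    StoresPairs (storeBase.run s) i (basePairs G r L i) := by
  suffices h : ∀ i, StoresPairs (storeBase.run s) i (basePairs G r (L.take L.length) i) by
    simpa using h i
  refine hs.run_loop_tuples rfl (fun k s' => ∀ i,
    StoresPairs s' i (basePairs G r (L.take k) i)) (by simpa [basePairs] using h0) ?_
  · intro k hk s' hF hs' hI i
    have h7 : s'.arr 7 = s.arr 7 := hF.arr 7 rfl
    have hI := hI i
    rw [basePairs_take_succ hk]
    simp only [run_seq, run_ifEq, run_setCell, run_setReg, run_skip, Expr.eval, reg_writeReg,
      arr_writeReg, arr_writeCell, reg_writeCell, h7]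
    norm_num [hs'.fst k hk, hs'.snd k hk, hd, Fin.val_inj]
    by_cases h1 : L[k].1 = L[k].2
    · rw [if_pos h1, if_neg (fun h => h.1 h1), List.append_nil]
      exact hI.congr rfl (fun _ _ => rfl) (fun _ _ => rfl)
    by_cases h2 : G.dist r L[k].1 = G.dist r L[k].2
    · by_cases h3 : G.dist r L[k].1 = i
      · subst h3
        rw [if_neg h1, if_pos h2, if_pos ⟨h1, rfl, h2.symm⟩]
        refine hI.append ?_ ?_ ?_ ?_ ?_
        · simp
        · intro j v hj
          simp [hj]
        · intro j v hj
          simp [hj]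
        · intro v
          -- Only the bit of one vertex is written; the others are zero because the memory behind
          -- the stored pairs is unused.
          have := hI.fresh_left _ le_rfl v
          rw [← hI.count] at this
          by_cases hv : v = L[k].1 <;> simp [hv, this, Fin.val_inj]
        · intro v
          have := hI.fresh_right _ le_rfl v
          rw [← hI.count] at this
          by_cases hv : v = L[k].2 <;> simp [hv, this, Fin.val_inj]
      · rw [if_neg h1, if_pos h2, if_neg (fun h => h3 h.2.1), List.append_nil]
        refine hI.congr ?_ ?_ ?_
        · simp [Ne.symm h3]
        · intro j v
          simp [Ne.symm h3]
        · intro j v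
          simp [Ne.symm h3]
    · rw [if_neg h1, if_neg h2, if_neg (fun h => h2 (h.2.1.trans h.2.2.symm)), List.append_nil]
      exact hI.congr rfl (fun _ _ => rfl) (fun _ _ => rfl)

/-! ### Deriving the pairs of the preceding layer -/

/-- The memory contains the input, the distances and the numbers of parents. -/
structure Prepared (G : SimpleGraph (Fin n)) (r : Fin n) (L : List (Fin n × Fin n))
    (s : State) : Prop where
  input : HasInput G r L s
  dist : ∀ v : Fin n, s.arr 7 v 0 0 = G.dist r v + 1
  parents : ∀ v : Fin n, s.arr 8 v 0 0 = parents G r v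
  parents_card : s.arr 8 n 0 0 = 0

/-- The program does not write to the input, the distances and the numbers of parents. -/
def Program.keepsPrepared (c : Program) : Bool :=
  c.keepsInput && (!c.writesArr 7 && !c.writesArr 8)

lemma Prepared.of_eq {s s' : State} (h : Prepared G r L s) (hs' : HasInput G r L s')
    (h7 : s'.arr 7 = s.arr 7) (h8 : s'.arr 8 = s.arr 8) : Prepared G r L s' :=
  ⟨hs', by rw [h7]; exact h.dist, by rw [h8]; exact h.parents, by rw [h8]; exact h.parents_card⟩

lemma Prepared.frame {s s' : State} (h : Prepared G r L s) {c : Program} (hF : Frame c s s')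
    (hc : c.keepsPrepared = true) : Prepared G r L s' := by
  simp only [Program.keepsPrepared, Bool.and_eq_true, Bool.not_eq_true'] at hc
  exact h.of_eq (h.input.frame hF hc.1) (hF.arr _ hc.2.1) (hF.arr _ hc.2.2)

lemma Prepared.run {s : State} (h : Prepared G r L s) {c : Program}
    (hc : c.keepsPrepared = true) : Prepared G r L (c.run s) :=
  h.frame ⟨fun _ hy => run_reg hy s, fun _ ha => run_arr ha s⟩ hc

lemma Prepared.writeReg {s : State} (h : Prepared G r L s) (x v : ℕ) (hx : 3 ≤ x) :
    Prepared G r L (s.writeReg x v) :=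
  h.of_eq (h.input.writeReg x v hx) rfl rfl

/-- Register `x` gets an element with the most parents of the set that array `a` stores for the
layer in register `20` and the index in register `21`, or `n` if there is none. -/
def selectMax (a x : ℕ) : Program :=
  .seq (.setReg x (.reg 0)) (.loop 23 (.reg 0)
    (.ifEq (.cell a (.reg 20) (.reg 21) (.reg 23)) (.const 1)
      (.ifLt (.at 8 (.reg x)) (.at 8 (.reg 23)) (.setReg x (.reg 23)) .skip) .skip))

/-- The number `x` is a vertex of `S` with the most parents, or `n`. -/
def IsSelected (G : SimpleGraph (Fin n)) (r : Fin n) (S : Set (Fin n)) (x : ℕ) : Prop :=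
  (x = n ∧ ∀ v ∈ S, parents G r v = 0) ∨
    ∃ b ∈ S, x = b ∧ ∀ v ∈ S, parents G r v ≤ parents G r b

/-- The start value `n` counts as a vertex without parents by `parents_card`, so the first element
with a parent replaces it. Inside a layer other than layer `0` every vertex has a parent, so there
`n` survives only for the empty set. -/
lemma selectMax_spec {s : State} (hs : Prepared G r L s) {a x : ℕ}
    (hax : (a = 3 ∧ x = 22) ∨ (a = 4 ∧ x = 24)) {S : Set (Fin n)}
    (hS : ∀ v : Fin n, s.arr a (s.reg 20) (s.reg 21) v = 1 ↔ v ∈ S) :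
    IsSelected G r S ((selectMax a x).run s |>.reg x) := by
  have hs1 : Prepared G r L ((Program.setReg x (.reg 0)).run s) := by
    rcases hax with ⟨rfl, rfl⟩ | ⟨rfl, rfl⟩ <;> exact hs.run rfl
  suffices h : (((selectMax a x).run s).reg x = n ∧ ∀ v ∈ S, v < n → parents G r v = 0) ∨
      ∃ b ∈ S, ((selectMax a x).run s).reg x = b ∧ ∀ v ∈ S, v < n → parents G r v ≤ parents G r b by
    simpa [IsSelected] using h
  refine hs1.input.run_loop (x := 23) ?_ (fun i s' =>
    (s'.reg x = n ∧ ∀ v ∈ S, v < i → parents G r v = 0) ∨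
      ∃ b ∈ S, s'.reg x = b ∧ ∀ v ∈ S, v < i → parents G r v ≤ parents G r b) ?_ ?_
  · rcases hax with ⟨rfl, rfl⟩ | ⟨rfl, rfl⟩ <;> rfl
  · simp [hs.input.card]
  · intro i s' hF hs' hI
    have hs2 := hs1.frame hF (by rcases hax with ⟨rfl, rfl⟩ | ⟨rfl, rfl⟩ <;> rfl)
    have h20 : s'.reg 20 = s.reg 20 := by
      rcases hax with ⟨rfl, rfl⟩ | ⟨rfl, rfl⟩ <;> exact hF.reg 20 rfl
    have h21 : s'.reg 21 = s.reg 21 := by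
      rcases hax with ⟨rfl, rfl⟩ | ⟨rfl, rfl⟩ <;> exact hF.reg 21 rfl
    have hSi : s'.arr a (s.reg 20) (s.reg 21) i = 1 ↔ i ∈ S := by
      have ha : s'.arr a = s.arr a := by
        rcases hax with ⟨rfl, rfl⟩ | ⟨rfl, rfl⟩
        · exact hF.arr 3 rfl
        · exact hF.arr 4 rfl
      rw [← hS i, ha]
    have hx23 : x ≠ 23 := by rcases hax with ⟨-, rfl⟩ | ⟨-, rfl⟩ <;> norm_num
    have hval : (((Program.ifEq (.cell a (.reg 20) (.reg 21) (.reg 23)) (.const 1)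
        (.ifLt (.at 8 (.reg x)) (.at 8 (.reg 23)) (.setReg x (.reg 23)) .skip) .skip).run
          (s'.writeReg 23 i)).reg x) =
        if s'.arr a (s.reg 20) (s.reg 21) i = 1 then
          if s'.arr 8 (s'.reg x) 0 0 < parents G r i then (i : ℕ) else s'.reg x else s'.reg x := by
      simp only [run_ifEq, run_ifLt, run_setReg, run_skip, Expr.eval, reg_writeReg, arr_writeReg,
        reg_ite, h20, h21, hx23]
      norm_num [hs2.parents]
    simp only [hval]
    have hsucc : ∀ v : Fin n, (v : ℕ) < i + 1 ↔ (v : ℕ) < i ∨ v = i := by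
      intro v
      rw [Nat.lt_succ_iff_lt_or_eq, Fin.val_inj]
    simp only [hsucc]
    by_cases hi : i ∈ S
    · rw [if_pos (hSi.2 hi)]
      rcases hI with ⟨hx, hv⟩ | ⟨b, hb, hx, hv⟩
      · rw [hx, hs2.parents_card]
        rcases Nat.eq_zero_or_pos (parents G r i) with h | h
        · rw [if_neg (by omega)]
          refine Or.inl ⟨rfl, fun v hvS => ?_⟩
          rintro (h' | rfl)
          · exact hv v hvS h'
          · exact h
        · rw [if_pos h]
          refine Or.inr ⟨i, hi, rfl, fun v hvS => ?_⟩
          rintro (h' | rfl)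
          · rw [hv v hvS h']; omega
          · exact le_rfl
      · rw [hx, hs2.parents]
        split_ifs with h
        · refine Or.inr ⟨i, hi, rfl, fun v hvS => ?_⟩
          rintro (h' | rfl)
          · exact (hv v hvS h').trans h.le
          · exact le_rfl
        · refine Or.inr ⟨b, hb, rfl, fun v hvS => ?_⟩
          rintro (h' | rfl)
          · exact hv v hvS h'
          · exact not_lt.1 h
    · rw [if_neg (fun h => hi (hSi.1 h))]
      rcases hI with ⟨hx, hv⟩ | ⟨b, hb, hx, hv⟩
      · refine Or.inl ⟨hx, fun v hvS => ?_⟩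
        rintro (h' | rfl)
        · exact hv v hvS h'
        · exact absurd hvS hi
      · refine Or.inr ⟨b, hb, hx, fun v hvS => ?_⟩
        rintro (h' | rfl)
        · exact hv v hvS h'
        · exact absurd hvS hi

lemma parents_eq {i : ℕ} {v : Fin n} (hv : G.dist r v = i + 1) :
    parents G r v = (G.neighborSet v ∩ layer G r i).ncard := by
  unfold parents
  congr 1
  ext w
  simp [layer, hv]

lemma parents_pos (hc : G.Connected) {i : ℕ} {v : Fin n} (hv : G.dist r v = i + 1) :
    0 < parents G r v := by
  obtain ⟨u, huv, hu⟩ := exists_parent hc hv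
  rw [parents_eq hv, Set.ncard_pos]
  exact ⟨u, huv.symm, hu⟩

/-- The neighbors of the selected vertex are those of the whole set. -/
lemma IsSelected.adj_iff (hc : G.Connected) {s : State} (hs : HasInput G r L s) {i : ℕ}
    {S : Set (Fin n)} (hS : S ⊆ layer G r (i + 1))
    (hmax : ∀ b ∈ S, (∀ x ∈ S, parents G r x ≤ parents G r b) →
      G.neighborSet b ∩ layer G r i = setNeighbors G S ∩ layer G r i)
    {x : ℕ} (hx : IsSelected G r S x) {v : Fin n} (hv : G.dist r v = i) :
    s.arr 0 x v 0 = 1 ↔ v ∈ setNeighbors G S := by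
  rcases hx with ⟨rfl, h0⟩ | ⟨b, hb, rfl, hle⟩
  -- The value `n` means that `S` is empty, as its vertices would have parents. This agrees with the
  -- empty row `n` of the adjacency matrix.
  · rw [hs.adj_card]
    simp only [zero_ne_one, false_iff]
    rintro ⟨b, hb, -⟩
    have := parents_pos hc (hS hb)
    rw [h0 b hb] at this
    exact lt_irrefl _ this
  · rw [hs.adj]
    have := Set.ext_iff.1 (hmax b hb hle) v
    simpa [layer, hv] using this

/-- Register `25` gets the maximal number of parents in the set `A'` for the selected vertices. -/
def maxExclusive : Program :=
  .seq (.setReg 25 (.const 0)) (.loop 23 (.reg 0)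
    (.ifEq (.at 7 (.reg 23)) (.reg 20)
      (.ifEq (.cell 0 (.reg 22) (.reg 23) (.const 0)) (.const 1)
        (.ifEq (.cell 0 (.reg 24) (.reg 23) (.const 0)) (.const 1) .skip
          (.ifLt (.reg 25) (.at 8 (.reg 23)) (.setReg 25 (.at 8 (.reg 23))) .skip)) .skip) .skip))

/-- The alternative `0` covers an empty set `S`. -/
lemma maxExclusive_spec {s : State} (hs : Prepared G r L s) {S : Set (Fin n)}
    (hS : ∀ v, v ∈ S ↔ G.dist r v + 1 = s.reg 20 ∧ s.arr 0 (s.reg 22) v 0 = 1 ∧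
      s.arr 0 (s.reg 24) v 0 ≠ 1) :
    (∀ v ∈ S, parents G r v ≤ (maxExclusive.run s).reg 25) ∧
      ((maxExclusive.run s).reg 25 = 0 ∨ ∃ v ∈ S, parents G r v = (maxExclusive.run s).reg 25) := by
  have hs1 : Prepared G r L ((Program.setReg 25 (.const 0)).run s) := hs.run rfl
  suffices h : (∀ v ∈ S, v < n → parents G r v ≤ (maxExclusive.run s).reg 25) ∧
      ((maxExclusive.run s).reg 25 = 0 ∨ ∃ v ∈ S, parents G r v = (maxExclusive.run s).reg 25) by
    simpa using h
  refine hs1.input.run_loop (x := 23) rfl (fun i s' =>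
    (∀ v ∈ S, v < i → parents G r v ≤ s'.reg 25) ∧
      (s'.reg 25 = 0 ∨ ∃ v ∈ S, parents G r v = s'.reg 25)) (by simp) ?_
  intro i s' hF hs' ⟨hI1, hI2⟩
  have hs2 := hs1.frame hF rfl
  have hSi := hS i
  have h20 : s'.reg 20 = s.reg 20 := hF.reg 20 rfl
  have h22 : s'.reg 22 = s.reg 22 := hF.reg 22 rfl
  have h24 : s'.reg 24 = s.reg 24 := hF.reg 24 rfl
  have h0 : s'.arr 0 = s.arr 0 := hF.arr 0 rfl
  have hval : ((Program.ifEq (.at 7 (.reg 23)) (.reg 20)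
      (.ifEq (.cell 0 (.reg 22) (.reg 23) (.const 0)) (.const 1)
        (.ifEq (.cell 0 (.reg 24) (.reg 23) (.const 0)) (.const 1) .skip
          (.ifLt (.reg 25) (.at 8 (.reg 23)) (.setReg 25 (.at 8 (.reg 23))) .skip)) .skip) .skip).run
        (s'.writeReg 23 i)).reg 25 = if G.dist r i + 1 = s.reg 20 then
          if s.arr 0 (s.reg 22) i 0 = 1 then
            if s.arr 0 (s.reg 24) i 0 = 1 then s'.reg 25 else
              max (s'.reg 25) (parents G r i) else s'.reg 25 else s'.reg 25 := by
    simp only [run_ifEq, run_ifLt, run_setReg, run_skip, Expr.eval, reg_writeReg, arr_writeReg,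
      reg_ite, h20, h22, h24, h0]
    norm_num [hs2.parents, hs2.dist]
    grind
  rw [hval]
  have hsucc : ∀ v : Fin n, (v : ℕ) < i + 1 ↔ (v : ℕ) < i ∨ v = i := by
    intro v
    rw [Nat.lt_succ_iff_lt_or_eq, Fin.val_inj]
  simp only [hsucc]
  have hval2 : (if G.dist r i + 1 = s.reg 20 then
          if s.arr 0 (s.reg 22) i 0 = 1 then
            if s.arr 0 (s.reg 24) i 0 = 1 then s'.reg 25 else
              max (s'.reg 25) (parents G r i) else s'.reg 25 else s'.reg 25) = s'.reg 25 ∧ i ∉ S ∨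
      (if G.dist r i + 1 = s.reg 20 then
          if s.arr 0 (s.reg 22) i 0 = 1 then
            if s.arr 0 (s.reg 24) i 0 = 1 then s'.reg 25 else
              max (s'.reg 25) (parents G r i) else s'.reg 25 else s'.reg 25) =
        max (s'.reg 25) (parents G r i) ∧ i ∈ S := by
    grind
  rcases hval2 with ⟨he, hi⟩ | ⟨he, hi⟩
  · rw [he]
    refine ⟨fun v hv => ?_, hI2⟩
    rintro (h | rfl)
    · exact hI1 v hv h
    · exact absurd hv hi
  · rw [he]
    refine ⟨fun v hv => ?_, ?_⟩
    · rintro (h | rfl)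
      · exact (hI1 v hv h).trans (le_max_left _ _)
      · exact le_max_right _ _
    · rcases le_total (s'.reg 25) (parents G r i) with h | h
      · exact Or.inr ⟨i, hi, (max_eq_right h).symm⟩
      · rwa [max_eq_left h]

/-- Write the pair `(A'', B')` for the vertex in register `23`. -/
def writeBits : Program :=
  .ifEq (.at 7 (.reg 23)) (.reg 20)
    (.seq (.ifEq (.cell 0 (.reg 22) (.reg 23) (.const 0)) (.const 1)
      (.ifEq (.cell 0 (.reg 24) (.reg 23) (.const 0)) (.const 1) .skip
        (.ifEq (.at 8 (.reg 23)) (.reg 25)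
          (.setCell 3 (.reg 26) (.reg 27) (.reg 23) (.const 1)) .skip)) .skip)
    (.ifEq (.cell 0 (.reg 24) (.reg 23) (.const 0)) (.const 1)
      (.ifEq (.cell 0 (.reg 22) (.reg 23) (.const 0)) (.const 1) .skip
        (.setCell 4 (.reg 26) (.reg 27) (.reg 23) (.const 1))) .skip)) .skip

/-- Append the pair `(A'', B')` for the selected vertices to the preceding layer. -/
def writePair : Program :=
  .seq (.setReg 26 (.sub (.reg 20) (.const 1)))
  (.seq (.setReg 27 (.at 2 (.reg 26)))
  (.seq (.loop 23 (.reg 0) writeBits)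
  (.put 2 (.reg 26) (.succ (.reg 27)))))

lemma writeBits_loop_spec {s : State} (hs : Prepared G r L s) {A B : Set (Fin n)}
    (hA : ∀ v, v ∈ A ↔ G.dist r v + 1 = s.reg 20 ∧ s.arr 0 (s.reg 22) v 0 = 1 ∧
      s.arr 0 (s.reg 24) v 0 ≠ 1 ∧ parents G r v = s.reg 25)
    (hB : ∀ v, v ∈ B ↔ G.dist r v + 1 = s.reg 20 ∧ s.arr 0 (s.reg 24) v 0 = 1 ∧
      s.arr 0 (s.reg 22) v 0 ≠ 1)
    (h3 : ∀ v : Fin n, s.arr 3 (s.reg 26) (s.reg 27) v = 0)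
    (h4 : ∀ v : Fin n, s.arr 4 (s.reg 26) (s.reg 27) v = 0) :
    let s' := (Program.loop 23 (.reg 0) writeBits).run s
    (∀ i j k, ¬ (i = s.reg 26 ∧ j = s.reg 27) → s'.arr 3 i j k = s.arr 3 i j k) ∧
    (∀ i j k, ¬ (i = s.reg 26 ∧ j = s.reg 27) → s'.arr 4 i j k = s.arr 4 i j k) ∧
    (∀ v : Fin n, s'.arr 3 (s.reg 26) (s.reg 27) v = 1 ↔ v ∈ A) ∧
    (∀ v : Fin n, s'.arr 4 (s.reg 26) (s.reg 27) v = 1 ↔ v ∈ B) := by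
  intro s'
  suffices h : (∀ i j k, ¬ (i = s.reg 26 ∧ j = s.reg 27) → s'.arr 3 i j k = s.arr 3 i j k) ∧
      (∀ i j k, ¬ (i = s.reg 26 ∧ j = s.reg 27) → s'.arr 4 i j k = s.arr 4 i j k) ∧
      (∀ v : Fin n, s'.arr 3 (s.reg 26) (s.reg 27) v = 1 ↔ (v : ℕ) < n ∧ v ∈ A) ∧
      (∀ v : Fin n, s'.arr 4 (s.reg 26) (s.reg 27) v = 1 ↔ (v : ℕ) < n ∧ v ∈ B) by
    simpa using h
  refine hs.input.run_loop rfl (fun m s' =>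
    (∀ i j k, ¬ (i = s.reg 26 ∧ j = s.reg 27) → s'.arr 3 i j k = s.arr 3 i j k) ∧
      (∀ i j k, ¬ (i = s.reg 26 ∧ j = s.reg 27) → s'.arr 4 i j k = s.arr 4 i j k) ∧
      (∀ v : Fin n, s'.arr 3 (s.reg 26) (s.reg 27) v = 1 ↔ (v : ℕ) < m ∧ v ∈ A) ∧
      (∀ v : Fin n, s'.arr 4 (s.reg 26) (s.reg 27) v = 1 ↔ (v : ℕ) < m ∧ v ∈ B))
    (by simp [h3, h4]) ?_
  rintro m s' hF hs' ⟨hI3, hI4, hIA, hIB⟩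
  have hs2 := hs.frame hF rfl
  have h20 : s'.reg 20 = s.reg 20 := hF.reg 20 rfl
  have h22 : s'.reg 22 = s.reg 22 := hF.reg 22 rfl
  have h24 : s'.reg 24 = s.reg 24 := hF.reg 24 rfl
  have h25 : s'.reg 25 = s.reg 25 := hF.reg 25 rfl
  have h26 : s'.reg 26 = s.reg 26 := hF.reg 26 rfl
  have h27 : s'.reg 27 = s.reg 27 := hF.reg 27 rfl
  have h0 : s'.arr 0 = s.arr 0 := hF.arr 0 rfl
  have hAm := hA m
  have hBm := hB m
  have hval3 : ∀ i j k, (writeBits.run (s'.writeReg 23 m)).arr 3 i j k =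
      if (i = s.reg 26 ∧ j = s.reg 27 ∧ k = m) ∧ (G.dist r m + 1 = s.reg 20 ∧
        s.arr 0 (s.reg 22) m 0 = 1 ∧ s.arr 0 (s.reg 24) m 0 ≠ 1 ∧ parents G r m = s.reg 25)
      then 1 else s'.arr 3 i j k := by
    intro i j k
    simp only [writeBits, run_seq, run_ifEq, run_setCell, run_skip, Expr.eval, reg_writeReg,
      arr_writeReg, arr_writeCell, reg_writeCell, arr_ite, reg_ite, h20, h22, h24, h25, h26, h27, h0]
    norm_num [hs2.dist, hs2.parents]
    grind
  have hval4 : ∀ i j k, (writeBits.run (s'.writeReg 23 m)).arr 4 i j k =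
      if (i = s.reg 26 ∧ j = s.reg 27 ∧ k = m) ∧ (G.dist r m + 1 = s.reg 20 ∧
        s.arr 0 (s.reg 24) m 0 = 1 ∧ s.arr 0 (s.reg 22) m 0 ≠ 1)
      then 1 else s'.arr 4 i j k := by
    intro i j k
    simp only [writeBits, run_seq, run_ifEq, run_setCell, run_skip, Expr.eval, reg_writeReg,
      arr_writeReg, arr_writeCell, reg_writeCell, arr_ite, reg_ite, h20, h22, h24, h25, h26, h27, h0]
    norm_num [hs2.dist, hs2.parents]
    grind
  classical
  replace hval3 := fun i j k => (hval3 i j k).trans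
    (if_congr (and_congr_right' hAm.symm) rfl rfl)
  replace hval4 := fun i j k => (hval4 i j k).trans
    (if_congr (and_congr_right' hBm.symm) rfl rfl)
  refine ⟨fun i j k h => ?_, fun i j k h => ?_, fun v => ?_, fun v => ?_⟩
  · rw [hval3, if_neg (by tauto), hI3 i j k h]
  · rw [hval4, if_neg (by tauto), hI4 i j k h]
  · rw [hval3]
    have := hIA v
    rcases eq_or_ne v m with rfl | hv
    · by_cases h : v ∈ A <;> simp [h, this]
    · have : (v : ℕ) ≠ m := fun h => hv (Fin.ext h)
      grind
  · rw [hval4]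
    have := hIB v
    rcases eq_or_ne v m with rfl | hv
    · by_cases h : v ∈ B <;> simp [h, this]
    · have : (v : ℕ) ≠ m := fun h => hv (Fin.ext h)
      grind

lemma writePair_spec {s : State} (hs : Prepared G r L s) {i : ℕ} (hi : s.reg 20 = i + 2)
    {A B : Set (Fin n)}
    (hA : ∀ v, v ∈ A ↔ G.dist r v = i + 1 ∧ s.arr 0 (s.reg 22) v 0 = 1 ∧
      s.arr 0 (s.reg 24) v 0 ≠ 1 ∧ parents G r v = s.reg 25)
    (hB : ∀ v, v ∈ B ↔ G.dist r v = i + 1 ∧ s.arr 0 (s.reg 24) v 0 = 1 ∧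
      s.arr 0 (s.reg 22) v 0 ≠ 1)
    {l : List (Set (Fin n) × Set (Fin n))} (hl : StoresPairs s (i + 1) l) :
    StoresPairs (writePair.run s) (i + 1) (l ++ [(A, B)]) ∧
      ∀ j ≠ i + 1, ∀ l : List (Set (Fin n) × Set (Fin n)), StoresPairs s j l →
        StoresPairs (writePair.run s) j l := by
  let s1 := (Program.setReg 27 (.at 2 (.reg 26))).run
    ((Program.setReg 26 (.sub (.reg 20) (.const 1))).run s)
  have hs1 : Prepared G r L s1 := (hs.run (c := .setReg 26 (.sub (.reg 20) (.const 1))) rfl).run rfl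
  have h20 : s1.reg 20 = i + 2 := by simpa [s1] using hi
  have h22 : s1.reg 22 = s.reg 22 := by simp [s1]
  have h24 : s1.reg 24 = s.reg 24 := by simp [s1]
  have h25 : s1.reg 25 = s.reg 25 := by simp [s1]
  have h26 : s1.reg 26 = i + 1 := by simp [s1, hi]
  have h27 : s1.reg 27 = l.length := by
    simp [s1, hi, hl.count]
  have harr : s1.arr = s.arr := rfl
  obtain ⟨h3, h4, hA', hB'⟩ := writeBits_loop_spec hs1 (A := A) (B := B)
    (fun v => by rw [hA, h20, h22, h24, h25, harr]; simp)
    (fun v => by rw [hB, h20, h22, h24, harr]; simp)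
    (fun v => by rw [h26, h27, harr]; exact hl.fresh_left _ le_rfl v)
    (fun v => by rw [h26, h27, harr]; exact hl.fresh_right _ le_rfl v)
  have hrun : writePair.run s = (Program.put 2 (.reg 26) (.succ (.reg 27))).run
    ((Program.loop 23 (.reg 0) writeBits).run s1) := rfl
  rw [h26, h27] at h3 h4 hA' hB'
  have h26' : ((Program.loop 23 (.reg 0) writeBits).run s1).reg 26 = i + 1 := by
    rw [run_reg rfl, h26]
  have h27' : ((Program.loop 23 (.reg 0) writeBits).run s1).reg 27 = l.length := by
    rw [run_reg rfl, h27]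
  have h2' : ((Program.loop 23 (.reg 0) writeBits).run s1).arr 2 = s.arr 2 := by
    rw [run_arr rfl, harr]
  rw [hrun]
  generalize (Program.loop 23 (.reg 0) writeBits).run s1 = s2 at *
  simp only [run_setCell, Expr.eval, h26', h27']
  constructor
  · refine hl.append ?_ ?_ ?_ ?_ ?_
    · simp [hl.count]
    · intro j v hj
      rw [hl.count] at hj
      simpa [harr] using h3 (i + 1) j v (by simp [hj])
    · intro j v hj
      rw [hl.count] at hj
      simpa [harr] using h4 (i + 1) j v (by simp [hj])
    · intro v
      rw [hl.count]
      simpa using hA' v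
    · intro v
      rw [hl.count]
      simpa using hB' v
  · intro j hj l' hl'
    refine hl'.congr ?_ ?_ ?_
    · simp [hj, h2']
    · intro k v
      simpa [harr] using h3 j k v (by simp [hj])
    · intro k v
      simpa [harr] using h4 j k v (by simp [hj])

/-- Append the pair `(A'', B')` that belongs to the pair with the index in register `21` of the
layer in register `20`. -/
def derivePair : Program :=
  .seq (selectMax 3 22) (.seq (selectMax 4 24) (.seq maxExclusive writePair))

/-- Constantly many passes over the vertices suffice, because `N(A)` and `N(B)` restricted to the
preceding layer are the parent sets of single vertices: of any vertex of `A`, and of any vertex of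
`B` with the most parents. -/
lemma derivePair_spec (hc : G.Connected) (hG : IsChordalBipartite G) {π : Fin n → Fin n → Prop}
    {s : State} (hs : Prepared G r L s) {i : ℕ} (hi : s.reg 20 = i + 2) {A B : Set (Fin n)}
    (hAB : OBARel G r π (i + 2) A B)
    (hA : ∀ v : Fin n, s.arr 3 (i + 2) (s.reg 21) v = 1 ↔ v ∈ A)
    (hB : ∀ v : Fin n, s.arr 4 (i + 2) (s.reg 21) v = 1 ↔ v ∈ B)
    {l : List (Set (Fin n) × Set (Fin n))} (hl : StoresPairs s (i + 1) l) :
    StoresPairs (derivePair.run s) (i + 1) (l ++ [stepPair G r i (A, B)]) ∧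
      ∀ j ≠ i + 1, ∀ l : List (Set (Fin n) × Set (Fin n)), StoresPairs s j l →
        StoresPairs (derivePair.run s) j l := by
  have hsel1 := selectMax_spec hs (Or.inl ⟨rfl, rfl⟩) (S := A) (by rwa [hi])
  have hs1 : Prepared G r L ((selectMax 3 22).run s) := hs.run rfl
  have hr1 : ∀ x ∈ [20, 21], ((selectMax 3 22).run s).reg x = s.reg x := by
    intro x hx
    fin_cases hx <;> exact run_reg rfl s
  have ha1 : ∀ a ∈ [0, 2, 3, 4], ((selectMax 3 22).run s).arr a = s.arr a := by
    intro x hx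
    fin_cases hx <;> exact run_arr rfl s
  have hrun : derivePair.run s =
    writePair.run (maxExclusive.run ((selectMax 4 24).run ((selectMax 3 22).run s))) := rfl
  rw [hrun]
  generalize (selectMax 3 22).run s = s1 at *
  have hsel2 := selectMax_spec hs1 (Or.inr ⟨rfl, rfl⟩) (S := B)
    (by rw [ha1 4 (by simp), hr1 20 (by simp), hr1 21 (by simp), hi]; exact hB)
  have hs2 : Prepared G r L ((selectMax 4 24).run s1) := hs1.run rfl
  have hr2 : ∀ x ∈ [20, 21, 22], ((selectMax 4 24).run s1).reg x = s1.reg x := by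
    intro x hx
    fin_cases hx <;> exact run_reg rfl s1
  have ha2 : ∀ a ∈ [0, 2, 3, 4], ((selectMax 4 24).run s1).arr a = s1.arr a := by
    intro x hx
    fin_cases hx <;> exact run_arr rfl s1
  generalize (selectMax 4 24).run s1 = s2 at *
  have hadjA : ∀ v, G.dist r v = i + 1 → (s2.arr 0 (s2.reg 22) v 0 = 1 ↔ v ∈ setNeighbors G A) := by
    intro v hv
    rw [hr2 22 (by simp)]
    exact hsel1.adj_iff hc hs2.input hAB.left_subset (fun b hb _ => hAB.left_neighbors hb) hv
  have hadjB : ∀ v, G.dist r v = i + 1 → (s2.arr 0 (s2.reg 24) v 0 = 1 ↔ v ∈ setNeighbors G B) :=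
    fun v hv => hsel2.adj_iff hc hs2.input hAB.right_subset (fun b hb hle =>
      neighbors_of_maximal hc hG hAB.right_subset (fun x hx y hy => hAB.right_reachable hx hy) hb
        fun x hx => by
          rw [← parents_eq (hAB.right_subset hx), ← parents_eq (hAB.right_subset hb)]
          exact hle x hx) hv
  have hi2 : s2.reg 20 = i + 2 := by rw [hr2 20 (by simp), hr1 20 (by simp), hi]
  have hexA : ∀ v, v ∈ exclusiveNeighbors G r (i + 1) A B ↔ G.dist r v = i + 1 ∧
      s2.arr 0 (s2.reg 22) v 0 = 1 ∧ s2.arr 0 (s2.reg 24) v 0 ≠ 1 := by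
    intro v
    have h1 := hadjA v
    have h2 := hadjB v
    simp only [exclusiveNeighbors, layer, Set.mem_sdiff, Set.mem_inter_iff, Set.mem_ofPred_eq]
    tauto
  have hexB : ∀ v, v ∈ exclusiveNeighbors G r (i + 1) B A ↔ G.dist r v = i + 1 ∧
      s2.arr 0 (s2.reg 24) v 0 = 1 ∧ s2.arr 0 (s2.reg 22) v 0 ≠ 1 := by
    intro v
    have h1 := hadjA v
    have h2 := hadjB v
    simp only [exclusiveNeighbors, layer, Set.mem_sdiff, Set.mem_inter_iff, Set.mem_ofPred_eq]
    tauto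
  obtain ⟨hle, hmax⟩ := maxExclusive_spec hs2 (S := exclusiveNeighbors G r (i + 1) A B)
    (fun v => by rw [hexA, hi2]; simp)
  have hs3 : Prepared G r L (maxExclusive.run s2) := hs2.run rfl
  have hr3 : ∀ x ∈ [20, 22, 24], (maxExclusive.run s2).reg x = s2.reg x := by
    intro x hx
    fin_cases hx <;> exact run_reg rfl s2
  have ha3 : ∀ a ∈ [0, 2, 3, 4], (maxExclusive.run s2).arr a = s2.arr a := by
    intro x hx
    fin_cases hx <;> exact run_arr rfl s2
  generalize maxExclusive.run s2 = s3 at *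
  have hcongr : ∀ (j : ℕ) (l : List (Set (Fin n) × Set (Fin n))), StoresPairs s j l →
      StoresPairs s3 j l := by
    intro j l hl
    refine hl.congr ?_ ?_ ?_
    · rw [ha3 2 (by simp), ha2 2 (by simp), ha1 2 (by simp)]
    · intro k v
      rw [ha3 3 (by simp), ha2 3 (by simp), ha1 3 (by simp)]
    · intro k v
      rw [ha3 4 (by simp), ha2 4 (by simp), ha1 4 (by simp)]
  have hw := writePair_spec hs3 (i := i) (by rw [hr3 20 (by simp), hi2])
    (A := (stepPair G r i (A, B)).1) (B := (stepPair G r i (A, B)).2) (fun v => ?_) (fun v => ?_)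
    (hcongr _ _ hl)
  · exact ⟨hw.1, fun j hj l hl => hw.2 j hj l (hcongr j l hl)⟩
  · rw [hr3 22 (by simp), hr3 24 (by simp), ha3 0 (by simp), ← and_assoc, ← and_assoc,
      and_assoc (a := G.dist r v = i + 1), ← hexA]
    change v ∈ maximalVertices G r i (exclusiveNeighbors G r (i + 1) A B) ↔ _
    simp only [maximalVertices, Set.mem_ofPred_eq]
    refine and_congr_right fun hv => ?_
    have hdist : ∀ w ∈ exclusiveNeighbors G r (i + 1) A B, G.dist r w = i + 1 := fun w hw => hw.1.2
    -- A vertex of `A'` has all parents of `A'` exactly if its number of parents is the maximum. One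
    -- direction is monotonicity of the cardinality, the other is the comparability of the parent
    -- sets.
    constructor
    · intro hN
      refine le_antisymm (hle v hv) ?_
      rcases hmax with h | ⟨w, hw, h⟩
      · omega
      · rw [← h, parents_eq (hdist w hw), parents_eq (hdist v hv), hN]
        exact Set.ncard_le_ncard (fun z hz => ⟨⟨w, hw, hz.1⟩, hz.2⟩) (Set.toFinite _)
    · intro hp
      refine neighbors_of_maximal hc hG (fun w hw => hdist w hw)
        (fun x hx y hy => hAB.exclusive_reachable hx hy) hv fun w hw => ?_
      rw [← parents_eq (hdist w hw), ← parents_eq (hdist v hv), hp]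
      exact hle w hw
  · rw [hr3 22 (by simp), hr3 24 (by simp), ha3 0 (by simp), ← hexB]
    rfl

/-- Derive the relations of all layers. -/
def deriveLayers : Program :=
  .loop 19 (.reg 0) (.seq (.setReg 20 (.sub (.reg 0) (.reg 19)))
    (.ifLt (.const 1) (.reg 20)
      (.loop 21 (.reg 2) (.ifLt (.reg 21) (.at 2 (.reg 20)) derivePair .skip)) .skip))

/-- The loop has one iteration for every tuple, and indices behind the last pair are skipped. It
reaches all pairs because a layer has at most as many pairs as there are tuples. -/
lemma deriveLayer_spec (hc : G.Connected) (hG : IsChordalBipartite G) {π : Fin n → Fin n → Prop}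
    (hL : ∀ x y, (x, y) ∈ L ↔ π x y) {s : State} (hs : Prepared G r L s) {i : ℕ}
    (hi : s.reg 20 = i + 2) (hin : i + 1 < n)
    (h1 : StoresPairs s (i + 1) (basePairs G r L (i + 1)))
    (h2 : StoresPairs s (i + 2) (layerPairs G r L (i + 2))) :
    let s' := (Program.loop 21 (.reg 2) (.ifLt (.reg 21) (.at 2 (.reg 20)) derivePair .skip)).run s
    StoresPairs s' (i + 1) (layerPairs G r L (i + 1)) ∧
      ∀ j ≠ i + 1, ∀ l : List (Set (Fin n) × Set (Fin n)), StoresPairs s j l →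
        StoresPairs s' j l := by
  intro s'
  have key : StoresPairs s' (i + 1) (basePairs G r L (i + 1) ++
      ((layerPairs G r L (i + 2)).take L.length).map (stepPair G r i)) ∧
      ∀ j ≠ i + 1, ∀ l : List (Set (Fin n) × Set (Fin n)), StoresPairs s j l →
        StoresPairs s' j l := by
    refine hs.input.run_loop_tuples rfl (fun k s' => StoresPairs s' (i + 1)
      (basePairs G r L (i + 1) ++ ((layerPairs G r L (i + 2)).take k).map (stepPair G r i)) ∧
      ∀ j ≠ i + 1, ∀ l : List (Set (Fin n) × Set (Fin n)), StoresPairs s j l →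
        StoresPairs s' j l) ⟨by simpa using h1, fun _ _ _ h => h⟩ ?_
    rintro k hk s' hF hs' ⟨hI1, hI2⟩
    have hs2 := (hs.frame hF rfl).writeReg 21 k (by norm_num)
    have h20 : (s'.writeReg 21 k).reg 20 = i + 2 := (hF.reg 20 rfl).trans hi
    have hI2' := hI2 (i + 2) (by omega) _ h2
    have hI1' : StoresPairs (s'.writeReg 21 k) (i + 1) _ :=
      hI1.congr rfl (fun _ _ => rfl) (fun _ _ => rfl)
    rw [run_ifLt]
    have hcond : (Expr.reg 21).eval (s'.writeReg 21 k) <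
        (Expr.at 2 (.reg 20)).eval (s'.writeReg 21 k) ↔ k < (layerPairs G r L (i + 2)).length := by
      simp only [Expr.eval, h20, arr_writeReg, hI2'.count, reg_writeReg, if_true]
    by_cases hkl : k < (layerPairs G r L (i + 2)).length
    · rw [if_pos (hcond.2 hkl), List.take_succ_eq_append_getElem hkl, List.map_append,
        ← List.append_assoc]
      have := derivePair_spec hc hG (π := π) hs2 h20 (A := (layerPairs G r L (i + 2))[k].1)
        (B := (layerPairs G r L (i + 2))[k].2)
        ((mem_layerPairs hc hL).1 (List.getElem_mem hkl)) (fun v => ?_) (fun v => ?_) hI1'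
      · exact ⟨this.1, fun j hj l hl => this.2 j hj l
          ((hI2 j hj l hl).congr rfl (fun _ _ => rfl) (fun _ _ => rfl))⟩
      · exact hI2'.left k hkl v
      · exact hI2'.right k hkl v
    · rw [if_neg (fun h => hkl (hcond.1 h)), run_skip, List.take_of_length_le (by omega)]
      rw [List.take_of_length_le (by omega)] at hI1'
      exact ⟨hI1', fun j hj l hl => (hI2 j hj l hl).congr rfl (fun _ _ => rfl) (fun _ _ => rfl)⟩
  rwa [List.take_of_length_le (length_layerPairs_le _), ← layerPairs_succ hin] at key

lemma deriveLayers_spec (hc : G.Connected) (hG : IsChordalBipartite G)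
    {π : Fin n → Fin n → Prop} (hL : ∀ x y, (x, y) ∈ L ↔ π x y) {s : State}
    (hs : Prepared G r L s) (h0 : ∀ i, StoresPairs s i (basePairs G r L i)) (i : ℕ) :
    StoresPairs (deriveLayers.run s) i (layerPairs G r L i) := by
  -- After `t` rounds the layers from `n - t` on are complete and the earlier ones hold only their
  -- pairs of singletons; layer `0` never has pairs. Round `t` reads layer `n - t` and completes the
  -- preceding one. The bound `n - n` is the invariant at the end.
  suffices h : ∀ i, (i = 0 ∨ n - n ≤ i → StoresPairs (deriveLayers.run s) i (layerPairs G r L i)) ∧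
      (i < n - n → StoresPairs (deriveLayers.run s) i (basePairs G r L i)) by
    exact (h i).1 (by omega)
  refine hs.input.run_loop rfl (fun t s' => ∀ i,
    (i = 0 ∨ n - t ≤ i → StoresPairs s' i (layerPairs G r L i)) ∧
    (i < n - t → StoresPairs s' i (basePairs G r L i))) ?_ ?_
  · refine fun i => ⟨fun h => ?_, fun _ => h0 i⟩
    rcases Nat.eq_zero_or_pos i with rfl | hi
    · have := h0 0
      rwa [basePairs_zero hc] at this
    · rw [layerPairs_of_le hi (by omega)]
      exact h0 i
  · intro t s' hF hs' hI
    have hs2 := (((hs.frame hF rfl).writeReg 19 t (by norm_num)).writeReg 20 (n - t) (by norm_num))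
    have h1 : ∀ i l, StoresPairs (n := n) s' i l →
        StoresPairs ((s'.writeReg 19 t).writeReg 20 (n - t)) i l :=
      fun i l h => h.congr rfl (fun _ _ => rfl) (fun _ _ => rfl)
    have hset : (Program.setReg 20 (.sub (.reg 0) (.reg 19))).run (s'.writeReg 19 t) =
        (s'.writeReg 19 t).writeReg 20 (n - t) := by
      simp [hs'.card]
    rw [run_seq, hset, run_ifLt]
    simp only [Expr.eval, reg_writeReg, if_true]
    rcases Nat.lt_or_ge 1 (n - t) with hlt | hge
    · rw [if_pos hlt]
      obtain ⟨i, hi⟩ := Nat.exists_eq_add_of_le' hlt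
      have hd := deriveLayer_spec hc hG hL hs2 (i := i) (by simp [hi]) (by omega)
        (h1 _ _ ((hI (i + 1)).2 (by omega))) (h1 _ _ ((hI (i + 2)).1 (by omega)))
      intro j
      rcases eq_or_ne j (i + 1) with rfl | hj
      · exact ⟨fun _ => hd.1, fun h => by omega⟩
      · exact ⟨fun h => hd.2 j hj _ (h1 _ _ ((hI j).1 (by omega))),
          fun h => hd.2 j hj _ (h1 _ _ ((hI j).2 (by omega)))⟩
    · rw [if_neg (by omega), run_skip]
      intro j
      exact ⟨fun h => h1 _ _ ((hI j).1 (by omega)), fun h => h1 _ _ ((hI j).2 (by omega))⟩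

end Machine

/-! ### Greedy orderings of the layers -/

section Greedy

variable {V : Type*} {G : SimpleGraph V} {r : V} {R : ℕ → Set V → Set V → Prop}

/-- The list is built layer by layer, and no vertex precedes all vertices of the first component of
a pair whose second component contains it. -/
def IsGreedyPrefix (G : SimpleGraph V) (r : V) (R : ℕ → Set V → Set V → Prop) (q : List V) : Prop :=
  q.Nodup ∧ ∀ p v, (p ++ [v]) <+: q → (∀ u, G.dist r u < G.dist r v → u ∈ p) ∧
    ∀ A B, R (G.dist r v) A B → v ∈ B → ∃ a ∈ A, a ∈ p

lemma isGreedyPrefix_nil : IsGreedyPrefix G r R [] :=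
  ⟨List.nodup_nil, fun p v hp => by simp at hp⟩

lemma IsGreedyPrefix.append {q : List V} (hq : IsGreedyPrefix G r R q) {v : V} (hv : v ∉ q)
    (hlow : ∀ u, G.dist r u < G.dist r v → u ∈ q)
    (hR : ∀ A B, R (G.dist r v) A B → v ∈ B → ∃ a ∈ A, a ∈ q) :
    IsGreedyPrefix G r R (q ++ [v]) := by
  refine ⟨List.nodup_append.2 ⟨hq.1, by simp, ?_⟩, fun p w hp => ?_⟩
  · rintro a ha b hb rfl
    rw [List.mem_singleton] at hb
    exact hv (hb ▸ ha)
  · rcases List.prefix_concat_iff.1 hp with h | h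
    · rw [List.append_eq_append_iff_of_size_eq_right (by simp)] at h
      obtain ⟨rfl, h⟩ := h
      obtain rfl : w = v := by simpa using h
      exact ⟨hlow, hR⟩
    · exact hq.2 p w h

lemma filter_lt_succ_of_pairwise {f : V → ℕ} {q : List V}
    (hq : q.Pairwise fun u v => f u ≤ f v) (k : ℕ) :
    q.filter (fun v => f v < k + 1) = q.filter (fun v => f v < k) ++ q.filter (fun v => f v = k) := by
  induction q with
  | nil => rfl
  | cons c q ih =>
    rw [List.pairwise_cons] at hq
    have ih := ih hq.2
    have hnil : k ≤ f c → q.filter (fun v => f v < k) = [] := by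
      intro h
      rw [List.filter_eq_nil_iff]
      intro v hv
      have := hq.1 v hv
      simp only [decide_eq_true_eq]
      omega
    rcases lt_trichotomy (f c) k with h | h | h
    · rw [List.filter_cons_of_pos (by simp; omega), List.filter_cons_of_pos (by simpa using h),
        List.filter_cons_of_neg (by simp; omega), ih, List.cons_append]
    · rw [List.filter_cons_of_pos (by simp; omega), List.filter_cons_of_neg (by simp; omega),
        List.filter_cons_of_pos (by simpa using h), ih, hnil h.ge]
      rfl
    · rw [List.filter_cons_of_neg (by simp; omega), List.filter_cons_of_neg (by simp; omega),
        List.filter_cons_of_neg (by simp; omega), ih]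

lemma filter_lt_eq_flatten {f : V → ℕ} {q : List V}
    (hq : q.Pairwise fun u v => f u ≤ f v) (k : ℕ) :
    q.filter (fun v => f v < k) =
      ((List.range k).map fun i => q.filter (fun v => f v = i)).flatten := by
  induction k with
  | zero => simp
  | succ k ih =>
    rw [filter_lt_succ_of_pairwise hq, ih, List.range_succ, List.map_append, List.flatten_append]
    simp

variable [DecidableEq V]

lemma IsGreedyPrefix.pairwise {q : List V} (hq : IsGreedyPrefix G r R q) :
    q.Pairwise fun u v => G.dist r u ≤ G.dist r v := by
  rw [List.pairwise_iff_getElem]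
  intro i j hi hj hij
  by_contra! hlt
  obtain ⟨p, hp, hpm⟩ := exists_prefix (List.getElem_mem hi)
  have := (hpm _).1 ((hq.2 p _ hp).1 _ hlt)
  unfold Before at this
  rw [hq.1.idxOf_getElem, hq.1.idxOf_getElem] at this
  omega

/-- The list is sorted by distance, so it is the concatenation of its restrictions to the layers,
the first of which is `[r]`. -/
lemma IsGreedyPrefix.eq_concatLayers [Fintype V] (hc : G.Connected) {q : List V}
    (hq : IsGreedyPrefix G r R q) (hall : ∀ v, v ∈ q) :
    q = concatLayers r (depth G r) (fun i => q.filter fun v => G.dist r v = i) := by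
  have h := filter_lt_eq_flatten hq.pairwise (depth G r + 1)
  rw [List.filter_eq_self.2 (fun v _ => by
    simpa [Nat.lt_succ_iff] using dist_le_depth v), List.range_succ_eq_map, List.map_cons,
    List.flatten_cons, List.map_map] at h
  have h0 : q.filter (fun v => G.dist r v = 0) = [r] := by
    rw [← List.perm_singleton, List.perm_ext_iff_of_nodup (hq.1.filter _) (List.nodup_singleton r)]
    intro v
    simp [hall, hc.dist_eq_zero_iff, eq_comm]
  rw [h0] at h
  exact h

/-- When the first vertex of `B` was placed, some vertex of `A` had already been placed, and it
precedes all of `B`. -/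
lemma IsGreedyPrefix.isOBAOrdering_filter [Finite V] {q : List V} (hq : IsGreedyPrefix G r R q)
    (hall : ∀ v, v ∈ q) {i : ℕ} (hsub : ∀ A B, R i A B → A ⊆ layer G r i ∧ B ⊆ layer G r i) :
    IsOBAOrdering (layer G r i) (R i) (q.filter fun v => G.dist r v = i) := by
  refine ⟨hq.1.filter _, fun v => by simp [hall, layer], fun A B h hB => ?_⟩
  obtain ⟨b, hb, hmin⟩ := exists_leftmost q hB (fun v _ => hall v)
  obtain ⟨p, hp, hpm⟩ := exists_prefix (hall b)
  have hdb : G.dist r b = i := (hsub A B h).2 hb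
  obtain ⟨a, ha, hap⟩ := (hq.2 p b hp).2 A B (hdb ▸ h) hb
  refine ⟨a, ha, fun y hy => ?_⟩
  rw [before_filter (P := fun v => G.dist r v = i) (decide_eq_true (p := G.dist r a = i)
    ((hsub A B h).1 ha)) (decide_eq_true (p := G.dist r y = i) ((hsub A B h).2 hy))]
  have hab := (hpm a).1 hap
  rcases eq_or_ne y b with rfl | hne
  · exact hab
  · exact hab.trans (hmin y hy hne)

/-- If the greedy choice gets stuck in a layer, then the layer has no one-before-all ordering. -/
lemma not_exists_isOBAOrdering [Finite V] {q : List V} {i : ℕ} {v₀ : V} (hv₀ : v₀ ∈ layer G r i)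
    (hv₀q : v₀ ∉ q) (hstuck : ∀ v ∈ layer G r i, v ∉ q →
      ∃ A B, R i A B ∧ v ∈ B ∧ ∀ a ∈ A, a ∉ q) :
    ¬ ∃ s, IsOBAOrdering (layer G r i) (R i) s := by
  rintro ⟨s, hs⟩
  -- Let `v` be the first unplaced vertex of the layer in a supposed solution `s`. The pair blocking
  -- `v` forces a vertex of `A`, which is also unplaced, to come before `v` in `s`.
  obtain ⟨v, ⟨hv, hvq⟩, hmin⟩ := exists_leftmost s (S := {v | v ∈ layer G r i ∧ v ∉ q})
    ⟨v₀, hv₀, hv₀q⟩ (fun v hv => (hs.2.1 v).2 hv.1)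
  obtain ⟨A, B, hR, hvB, hA⟩ := hstuck v hv hvq
  obtain ⟨x, hx, hxB⟩ := hs.2.2 A B hR ⟨v, hvB⟩
  have hxv := hxB v hvB
  have := hmin x ⟨(hs.2.1 x).1 hxv.mem, hA x hx⟩ hxv.ne
  unfold Before at *
  omega

end Greedy

namespace Machine

variable {n : ℕ} {G : SimpleGraph (Fin n)} {r : Fin n} {L : List (Fin n × Fin n)}

/-! ### Choosing the tie-breaker -/

/-- Register `31` gets the minimal entry of array `7` among the vertices that are not placed. -/
def findLayer : Program :=
  .seq (.setReg 31 (.succ (.reg 0))) (.loop 32 (.reg 0)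
    (.ifEq (.at 9 (.reg 32)) (.const 0)
      (.ifLt (.at 7 (.reg 32)) (.reg 31) (.setReg 31 (.at 7 (.reg 32))) .skip) .skip))

lemma lt_succ_iff_lt_or_eq_fin (i v : Fin n) : (v : ℕ) < i + 1 ↔ (v : ℕ) < i ∨ v = i := by
  rw [Nat.lt_succ_iff_lt_or_eq, Fin.val_inj]

/-- The start value `n + 1` exceeds every stored entry, which is at most `n`, so it is replaced as
soon as an unplaced vertex is met. -/
lemma findLayer_spec (hc : G.Connected) {s : State} (hs : Prepared G r L s)
    (hex : ∃ v : Fin n, s.arr 9 v 0 0 = 0) :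
    ∃ v : Fin n, s.arr 9 v 0 0 = 0 ∧ (findLayer.run s).reg 31 = G.dist r v + 1 ∧
      ∀ u : Fin n, s.arr 9 u 0 0 = 0 → G.dist r v ≤ G.dist r u := by
  have hs1 : Prepared G r L ((Program.setReg 31 (.succ (.reg 0))).run s) := hs.run rfl
  have key : ((findLayer.run s).reg 31 = n + 1 ∧ ∀ v : Fin n, (v : ℕ) < n → s.arr 9 v 0 0 ≠ 0) ∨
      ∃ v : Fin n, s.arr 9 v 0 0 = 0 ∧ (findLayer.run s).reg 31 = G.dist r v + 1 ∧
        ∀ u : Fin n, (u : ℕ) < n → s.arr 9 u 0 0 = 0 → G.dist r v ≤ G.dist r u := by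
    refine hs1.input.run_loop (x := 32) rfl (fun i s' =>
      (s'.reg 31 = n + 1 ∧ ∀ v : Fin n, (v : ℕ) < i → s.arr 9 v 0 0 ≠ 0) ∨
      ∃ v : Fin n, s.arr 9 v 0 0 = 0 ∧ s'.reg 31 = G.dist r v + 1 ∧
        ∀ u : Fin n, (u : ℕ) < i → s.arr 9 u 0 0 = 0 → G.dist r v ≤ G.dist r u)
      (by simp [hs.input.card]) ?_
    intro i s' hF hs' hI
    have hs2 := hs1.frame hF rfl
    have h9 : s'.arr 9 = s.arr 9 := hF.arr 9 rfl
    simp only [lt_succ_iff_lt_or_eq_fin]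
    have hval : ((Program.ifEq (.at 9 (.reg 32)) (.const 0)
      (.ifLt (.at 7 (.reg 32)) (.reg 31) (.setReg 31 (.at 7 (.reg 32))) .skip) .skip).run
        (s'.writeReg 32 i)).reg 31 =
        if s.arr 9 i 0 0 = 0 then min (G.dist r i + 1) (s'.reg 31) else s'.reg 31 := by
      simp only [run_ifEq, run_ifLt, run_setReg, run_skip, Expr.eval, reg_writeReg, arr_writeReg,
        reg_ite, h9]
      norm_num [hs2.dist]
      grind
    rw [hval]
    have hdi := dist_lt_card (r := r) hc i
    by_cases hi : s.arr 9 i 0 0 = 0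
    · rw [if_pos hi]
      rcases hI with ⟨h1, h2⟩ | ⟨v, hv, h1, h2⟩
      · refine Or.inr ⟨i, hi, by omega, fun u hu hu9 => ?_⟩
        rcases hu with hu | rfl
        · exact absurd hu9 (h2 u hu)
        · exact le_rfl
      · rcases le_total (G.dist r i) (G.dist r v) with h | h
        · refine Or.inr ⟨i, hi, by omega, fun u hu hu9 => ?_⟩
          rcases hu with hu | rfl
          · exact h.trans (h2 u hu hu9)
          · exact le_rfl
        · refine Or.inr ⟨v, hv, by omega, fun u hu hu9 => ?_⟩
          rcases hu with hu | rfl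
          · exact h2 u hu hu9
          · exact h
    · rw [if_neg hi]
      rcases hI with ⟨h1, h2⟩ | ⟨v, hv, h1, h2⟩
      · refine Or.inl ⟨h1, fun u hu => ?_⟩
        rcases hu with hu | rfl
        · exact h2 u hu
        · exact hi
      · refine Or.inr ⟨v, hv, h1, fun u hu hu9 => ?_⟩
        rcases hu with hu | rfl
        · exact h2 u hu hu9
        · exact absurd hu9 hi
  rcases key with ⟨-, h⟩ | ⟨v, hv, h1, h2⟩
  · obtain ⟨v, hv⟩ := hex
    exact absurd hv (h v v.2)
  · exact ⟨v, hv, h1, fun u hu => h2 u u.2 hu⟩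

/-- Mark the vertices of the set that array `4` stores for the layer in register `33` and the index
in register `34` as blocked in round `30`. -/
def markSet : Program :=
  .loop 32 (.reg 0) (.ifEq (.cell 4 (.reg 33) (.reg 34) (.reg 32)) (.const 1)
    (.setCell 11 (.reg 30) (.reg 32) (.const 0) (.const 1)) .skip)

/-- Mark the vertices blocked by pairs of the layer in register `33` that are not satisfied. -/
def markBlocked : Program :=
  .loop 34 (.reg 2) (.ifLt (.reg 34) (.at 2 (.reg 33))
    (.ifEq (.cell 10 (.reg 33) (.reg 34) (.const 0)) (.const 0) markSet .skip) .skip)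

/-- Every round has its own row of array `11`, so nothing ever has to be cleared. The clause for `t
≠ s.reg 30` keeps the rows of later rounds zero. -/
lemma markSet_spec {s : State} (hs : HasInput G r L s) :
    (∀ (t : ℕ) (v : Fin n), t ≠ s.reg 30 → (markSet.run s).arr 11 t v 0 = s.arr 11 t v 0) ∧
    ∀ v : Fin n, (markSet.run s).arr 11 (s.reg 30) v 0 = 0 ↔
      s.arr 11 (s.reg 30) v 0 = 0 ∧ s.arr 4 (s.reg 33) (s.reg 34) v ≠ 1 := by
  suffices h : (∀ (t : ℕ) (v : Fin n), t ≠ s.reg 30 →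
      (markSet.run s).arr 11 t v 0 = s.arr 11 t v 0) ∧
      ∀ v : Fin n, (markSet.run s).arr 11 (s.reg 30) v 0 = 0 ↔
        s.arr 11 (s.reg 30) v 0 = 0 ∧ ((v : ℕ) < n → s.arr 4 (s.reg 33) (s.reg 34) v ≠ 1) by
    simpa using h
  refine hs.run_loop rfl (fun i s' => (∀ (t : ℕ) (v : Fin n), t ≠ s.reg 30 →
      s'.arr 11 t v 0 = s.arr 11 t v 0) ∧
      ∀ v : Fin n, s'.arr 11 (s.reg 30) v 0 = 0 ↔
        s.arr 11 (s.reg 30) v 0 = 0 ∧ ((v : ℕ) < i → s.arr 4 (s.reg 33) (s.reg 34) v ≠ 1))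
    (by simp) ?_
  rintro i s' hF hs' ⟨hI1, hI2⟩
  have h30 : s'.reg 30 = s.reg 30 := hF.reg 30 rfl
  have h33 : s'.reg 33 = s.reg 33 := hF.reg 33 rfl
  have h34 : s'.reg 34 = s.reg 34 := hF.reg 34 rfl
  have h4 : s'.arr 4 = s.arr 4 := hF.arr 4 rfl
  simp only [run_ifEq, run_setCell, run_skip, Expr.eval, reg_writeReg, arr_writeReg, arr_writeCell,
    arr_ite, h30, h33, h34, h4, lt_succ_iff_lt_or_eq_fin]
  norm_num [Fin.val_inj]
  refine ⟨fun t v ht => by simp [ht, hI1 t v ht], fun v => ?_⟩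
  have := hI2 v
  grind

lemma markBlocked_spec {s : State} (hs : HasInput G r L s)
    {l : List (Set (Fin n) × Set (Fin n))} (hl : StoresPairs s (s.reg 33) l)
    (hlen : l.length ≤ L.length) (h0 : ∀ v : Fin n, s.arr 11 (s.reg 30) v 0 = 0) :
    (∀ (t : ℕ) (v : Fin n), t ≠ s.reg 30 → (markBlocked.run s).arr 11 t v 0 = s.arr 11 t v 0) ∧
    ∀ v : Fin n, (markBlocked.run s).arr 11 (s.reg 30) v 0 = 0 ↔
      ∀ j (hj : j < l.length), s.arr 10 (s.reg 33) j 0 = 0 → v ∉ l[j].2 := by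
  have key : (∀ (t : ℕ) (v : Fin n), t ≠ s.reg 30 →
      (markBlocked.run s).arr 11 t v 0 = s.arr 11 t v 0) ∧
      ∀ v : Fin n, (markBlocked.run s).arr 11 (s.reg 30) v 0 = 0 ↔
        ∀ j (hj : j < l.length), j < L.length → s.arr 10 (s.reg 33) j 0 = 0 → v ∉ l[j].2 := by
    refine hs.run_loop_tuples rfl (fun i s' => (∀ (t : ℕ) (v : Fin n), t ≠ s.reg 30 →
      s'.arr 11 t v 0 = s.arr 11 t v 0) ∧
      ∀ v : Fin n, s'.arr 11 (s.reg 30) v 0 = 0 ↔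
        ∀ j (hj : j < l.length), j < i → s.arr 10 (s.reg 33) j 0 = 0 → v ∉ l[j].2)
      (by simp [h0]) ?_
    rintro i hi s' hF hs' ⟨hI1, hI2⟩
    have h30 : s'.reg 30 = s.reg 30 := hF.reg 30 rfl
    have h33 : s'.reg 33 = s.reg 33 := hF.reg 33 rfl
    have h4 : s'.arr 4 = s.arr 4 := hF.arr 4 rfl
    have h10 : s'.arr 10 = s.arr 10 := hF.arr 10 rfl
    have h2 : s'.arr 2 = s.arr 2 := hF.arr 2 rfl
    obtain ⟨hm1, hm2⟩ := markSet_spec (hs'.writeReg 34 i (by norm_num))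
    simp only [reg_writeReg, arr_writeReg, h30, h33, h4] at hm1 hm2
    norm_num at hm1 hm2
    simp only [run_ifLt, run_ifEq, run_skip, Expr.eval, reg_writeReg, arr_writeReg, arr_ite, h33,
      h10, h2]
    norm_num [hl.count]
    by_cases hil : i < l.length
    · simp only [if_pos hil]
      by_cases hsat : s.arr 10 (s.reg 33) i 0 = 0
      · simp only [if_pos hsat]
        refine ⟨fun t v ht => (hm1 t v ht).trans (hI1 t v ht), fun v => ?_⟩
        rw [hm2, hI2, hl.right i hil]
        constructor
        · rintro ⟨h1, h2⟩ j hj hji hj0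
          rcases hji.lt_or_eq with h | rfl
          · exact h1 j hj h hj0
          · exact h2
        · exact fun h => ⟨fun j hj hji => h j hj hji.le, h i hil le_rfl hsat⟩
      · simp only [if_neg hsat]
        refine ⟨fun t v ht => hI1 t v ht, fun v => ?_⟩
        rw [hI2]
        constructor
        · intro h1 j hj hji hj0
          rcases hji.lt_or_eq with h | rfl
          · exact h1 j hj h hj0
          · exact absurd hj0 hsat
        · exact fun h j hj hji => h j hj hji.le
    · simp only [if_neg hil]
      refine ⟨fun t v ht => hI1 t v ht, fun v => ?_⟩
      rw [hI2]
      exact ⟨fun h j hj hji => h j hj (by omega), fun h j hj hji => h j hj hji.le⟩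
  exact ⟨key.1, fun v => (key.2 v).trans
    ⟨fun h j hj => h j hj (by omega), fun h j hj _ => h j hj⟩⟩

/-- Register `35` gets a vertex of the current layer that is neither placed nor blocked, or `n`. -/
def chooseVertex : Program :=
  .seq (.setReg 35 (.reg 0)) (.loop 32 (.reg 0)
    (.ifEq (.at 7 (.reg 32)) (.reg 31) (.ifEq (.at 9 (.reg 32)) (.const 0)
      (.ifEq (.cell 11 (.reg 30) (.reg 32) (.const 0)) (.const 0) (.setReg 35 (.reg 32)) .skip)
      .skip) .skip))

lemma chooseVertex_spec {s : State} (hs : Prepared G r L s) {P : Fin n → Prop}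
    (hP : ∀ v : Fin n, P v ↔ G.dist r v + 1 = s.reg 31 ∧ s.arr 9 v 0 0 = 0 ∧
      s.arr 11 (s.reg 30) v 0 = 0) :
    ((chooseVertex.run s).reg 35 = n ∧ ∀ v, ¬ P v) ∨
      ∃ v : Fin n, (chooseVertex.run s).reg 35 = v ∧ P v := by
  have hs1 : Prepared G r L ((Program.setReg 35 (.reg 0)).run s) := hs.run rfl
  suffices h : ((chooseVertex.run s).reg 35 = n ∧ ∀ v : Fin n, (v : ℕ) < n → ¬ P v) ∨
      ∃ v : Fin n, (chooseVertex.run s).reg 35 = v ∧ P v by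
    simpa using h
  refine hs1.input.run_loop (x := 32) rfl (fun i s' =>
    (s'.reg 35 = n ∧ ∀ v : Fin n, (v : ℕ) < i → ¬ P v) ∨ ∃ v : Fin n, s'.reg 35 = v ∧ P v)
    (by simp [hs.input.card]) ?_
  intro i s' hF hs' hI
  have hs2 := hs1.frame hF rfl
  have h30 : s'.reg 30 = s.reg 30 := hF.reg 30 rfl
  have h31 : s'.reg 31 = s.reg 31 := hF.reg 31 rfl
  have h9 : s'.arr 9 = s.arr 9 := hF.arr 9 rfl
  have h11 : s'.arr 11 = s.arr 11 := hF.arr 11 rfl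
  simp only [run_ifEq, run_setReg, run_skip, Expr.eval, reg_writeReg, arr_writeReg, reg_ite, h30,
    h31, h9, h11, lt_succ_iff_lt_or_eq_fin]
  norm_num [hs2.dist]
  have hPi := hP i
  by_cases hi : P i
  · obtain ⟨h1, h2, h3⟩ := hPi.1 hi
    rw [if_pos h1, if_pos h2, if_pos h3]
    exact Or.inr ⟨i, rfl, hi⟩
  · have hval : (if G.dist r i + 1 = s.reg 31 then if s.arr 9 i 0 0 = 0 then
        if s.arr 11 (s.reg 30) i 0 = 0 then (i : ℕ) else s'.reg 35 else s'.reg 35 else s'.reg 35) =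
        s'.reg 35 := by
      grind
    rw [hval]
    rcases hI with ⟨h1, h2⟩ | h
    · refine Or.inl ⟨h1, fun v hv => ?_⟩
      rcases hv with hv | rfl
      · exact h2 v hv
      · exact hi
    · exact Or.inr h

/-- Mark the pairs of the layer in register `33` whose first component contains the vertex in
register `35` as satisfied. -/
def markSatisfied : Program :=
  .loop 34 (.reg 2) (.ifLt (.reg 34) (.at 2 (.reg 33))
    (.ifEq (.cell 3 (.reg 33) (.reg 34) (.reg 35)) (.const 1)
      (.setCell 10 (.reg 33) (.reg 34) (.const 0) (.const 1)) .skip) .skip)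

lemma markSatisfied_spec {s : State} (hs : HasInput G r L s)
    {l : List (Set (Fin n) × Set (Fin n))} (hl : StoresPairs s (s.reg 33) l)
    (hlen : l.length ≤ L.length) {w : Fin n} (hw : s.reg 35 = w) :
    (∀ i j, i ≠ s.reg 33 → (markSatisfied.run s).arr 10 i j 0 = s.arr 10 i j 0) ∧
    ∀ j (hj : j < l.length), (markSatisfied.run s).arr 10 (s.reg 33) j 0 = 0 ↔
      s.arr 10 (s.reg 33) j 0 = 0 ∧ w ∉ l[j].1 := by
  have key : (∀ i j, i ≠ s.reg 33 → (markSatisfied.run s).arr 10 i j 0 = s.arr 10 i j 0) ∧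
      ∀ j (hj : j < l.length), (markSatisfied.run s).arr 10 (s.reg 33) j 0 = 0 ↔
        s.arr 10 (s.reg 33) j 0 = 0 ∧ (j < L.length → w ∉ l[j].1) := by
    refine hs.run_loop_tuples rfl (fun k s' =>
      (∀ i j, i ≠ s.reg 33 → s'.arr 10 i j 0 = s.arr 10 i j 0) ∧
      ∀ j (hj : j < l.length), s'.arr 10 (s.reg 33) j 0 = 0 ↔
        s.arr 10 (s.reg 33) j 0 = 0 ∧ (j < k → w ∉ l[j].1)) (by simp) ?_
    rintro k hk s' hF hs' ⟨hI1, hI2⟩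
    have h33 : s'.reg 33 = s.reg 33 := hF.reg 33 rfl
    have h35 : s'.reg 35 = w := (hF.reg 35 rfl).trans hw
    have h2 : s'.arr 2 = s.arr 2 := hF.arr 2 rfl
    have h3 : s'.arr 3 = s.arr 3 := hF.arr 3 rfl
    simp only [run_ifLt, run_ifEq, run_setCell, run_skip, Expr.eval, reg_writeReg, arr_writeReg,
      arr_writeCell, arr_ite, h33, h35, h2, h3]
    norm_num [hl.count]
    refine ⟨fun i j hij => by simp [hij, hI1 i j hij], fun j hj => ?_⟩
    have h1 := hI2 j hj
    have h2 := hl.left j hj w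
    rcases eq_or_ne j k with rfl | hjk
    · by_cases hwj : w ∈ l[j].1
      · simp [hj, h2.2 hwj, hwj]
      · have : s.arr 3 (s.reg 33) j w ≠ 1 := fun h => hwj (h2.1 h)
        simp [hj, this, h1, hwj]
    · simp only [hjk, if_false, ite_self]
      rw [h1]
      have : j < k ↔ j ≤ k := by omega
      rw [this]
  exact ⟨key.1, fun j hj => by simpa [lt_of_lt_of_le hj hlen] using key.2 j hj⟩

/-- The memory contains the pairs of all layers and the vertices placed so far. -/
structure Placed (G : SimpleGraph (Fin n)) (r : Fin n) (L : List (Fin n × Fin n))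
    (q : List (Fin n)) (s : State) : Prop where
  prepared : Prepared G r L s
  pairs : ∀ i, StoresPairs s i (layerPairs G r L i)
  stored : ∀ k (h : k < q.length), s.arr 5 k 0 0 = (q[k] : ℕ)
  placed : ∀ v : Fin n, s.arr 9 v 0 0 = 0 ↔ v ∉ q
  satisfied : ∀ i j (h : j < (layerPairs G r L i).length),
    s.arr 10 i j 0 = 0 ↔ ∀ a ∈ (layerPairs G r L i)[j].1, a ∉ q
  fresh : ∀ t (v : Fin n), q.length ≤ t → s.arr 11 t v 0 = 0

/-- Choose the vertex with number `30` of the tie-breaker. -/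
def selectNext : Program :=
  .seq findLayer (.seq (.setReg 33 (.sub (.reg 31) (.const 1))) (.seq markBlocked chooseVertex))

/-- Place the vertex in register `35`. -/
def placeVertex : Program :=
  .seq (.put 5 (.reg 30) (.reg 35)) (.seq (.put 9 (.reg 35) (.const 1)) markSatisfied)

/-- A vertex is blocked if it lies in the second component of a pair whose first component has no
placed vertex. The two alternatives at the end are what `not_exists_isOBAOrdering` and
`IsGreedyPrefix.append` need. -/
lemma selectNext_spec (hc : G.Connected) {s : State} {q : List (Fin n)} (hp : Placed G r L q s)
    (h30 : s.reg 30 = q.length) (hex : ∃ v, v ∉ q) :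
    ∃ i, (∃ v, v ∉ q ∧ G.dist r v = i) ∧ (∀ u, G.dist r u < i → u ∈ q) ∧
      (selectNext.run s).reg 33 = i ∧
      (∀ t (v : Fin n), q.length + 1 ≤ t → (selectNext.run s).arr 11 t v 0 = 0) ∧
      (((selectNext.run s).reg 35 = n ∧ ∀ v, v ∉ q → G.dist r v = i →
          ∃ A B, (A, B) ∈ layerPairs G r L i ∧ v ∈ B ∧ ∀ a ∈ A, a ∉ q) ∨
        ∃ w : Fin n, (selectNext.run s).reg 35 = w ∧ w ∉ q ∧ G.dist r w = i ∧
          ∀ A B, (A, B) ∈ layerPairs G r L i → w ∈ B → ∃ a ∈ A, a ∈ q) := by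
  obtain ⟨v₀, hv₀, h31, hmin⟩ := findLayer_spec hc hp.prepared
    (hex.imp fun v hv => (hp.placed v).2 hv)
  set s₁ := (Program.setReg 33 (.sub (.reg 31) (.const 1))).run (findLayer.run s) with hs₁
  have hp1 : Prepared G r L s₁ := (hp.prepared.run (c := findLayer) rfl).run rfl
  have h33 : s₁.reg 33 = G.dist r v₀ := by
    rw [hs₁]
    simp [h31]
  have h31' : s₁.reg 31 = G.dist r v₀ + 1 := by
    rw [hs₁]
    simp [h31]
  have h30' : s₁.reg 30 = q.length := h30 ▸ (run_reg (c := findLayer) (x := 30) rfl s)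
  have ha : ∀ a, findLayer.writesArr a = false → s₁.arr a = s.arr a := fun a h => run_arr h s
  have hpairs : StoresPairs s₁ (s₁.reg 33) (layerPairs G r L (G.dist r v₀)) := by
    rw [h33]
    refine (hp.pairs _).congr ?_ (fun _ _ => ?_) (fun _ _ => ?_)
    · rw [ha 2 rfl]
    · rw [ha 3 rfl]
    · rw [ha 4 rfl]
  obtain ⟨hm1, hm2⟩ := markBlocked_spec hp1.input hpairs (length_layerPairs_le _)
    (fun v => by rw [h30', ha 11 rfl]; exact hp.fresh _ v le_rfl)
  rw [h30'] at hm1 hm2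
  rw [h33, ha 10 rfl] at hm2
  rw [ha 11 rfl] at hm1
  set s₂ := markBlocked.run s₁ with hs₂
  have hp2 : Prepared G r L s₂ := hp1.run rfl
  have h30'' : s₂.reg 30 = q.length := (run_reg (c := markBlocked) rfl s₁).trans h30'
  have h31'' : s₂.reg 31 = G.dist r v₀ + 1 := (run_reg (c := markBlocked) rfl s₁).trans h31'
  have h33'' : s₂.reg 33 = G.dist r v₀ := (run_reg (c := markBlocked) rfl s₁).trans h33
  have h9 : s₂.arr 9 = s.arr 9 := (run_arr (c := markBlocked) rfl s₁).trans (ha 9 rfl)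
  refine ⟨G.dist r v₀, ⟨v₀, (hp.placed _).1 hv₀, rfl⟩, fun u hu => ?_, ?_, fun t v ht => ?_, ?_⟩
  · by_contra hcon
    exact absurd (hmin u ((hp.placed u).2 hcon)) (by omega)
  · exact (run_reg (c := chooseVertex) rfl s₂).trans h33''
  · refine (congrFun (congrFun (congrFun (run_arr (c := chooseVertex) (a := 11) rfl s₂) t) v) 0).trans
      ?_
    rw [hm1 t v (by omega)]
    exact hp.fresh t v (by omega)
  · have hP := chooseVertex_spec hp2 (P := fun v => v ∉ q ∧ G.dist r v = G.dist r v₀ ∧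
      ∀ j (hj : j < (layerPairs G r L (G.dist r v₀)).length), s.arr 10 (G.dist r v₀) j 0 = 0 →
        v ∉ (layerPairs G r L (G.dist r v₀))[j].2) (fun v => by
          rw [h30'', h31'', h9, hm2, hp.placed, Nat.add_right_cancel_iff]
          tauto)
    rcases hP with ⟨h1, h2⟩ | ⟨w, h1, h2, h3, h4⟩
    · refine Or.inl ⟨h1, fun v hv hvd => ?_⟩
      by_contra hcon
      refine h2 v ⟨hv, hvd, fun j hj hj0 hvj => hcon ⟨_, _, List.getElem_mem hj, hvj, ?_⟩⟩
      exact (hp.satisfied _ j hj).1 hj0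
    · refine Or.inr ⟨w, h1, h2, h3, fun A B hAB hwB => ?_⟩
      obtain ⟨j, hj, he⟩ := List.mem_iff_getElem.1 hAB
      by_contra! hcon
      refine h4 j hj ((hp.satisfied _ j hj).2 ?_) ?_
      · rw [he]; exact hcon
      · rw [he]; exact hwB

lemma placeVertex_spec {s : State} {q : List (Fin n)} (hs : Prepared G r L s)
    (hpairs : ∀ i, StoresPairs s i (layerPairs G r L i))
    (hstored : ∀ k (h : k < q.length), s.arr 5 k 0 0 = (q[k] : ℕ))
    (hplaced : ∀ v : Fin n, s.arr 9 v 0 0 = 0 ↔ v ∉ q)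
    (hsat : ∀ i j (h : j < (layerPairs G r L i).length),
      s.arr 10 i j 0 = 0 ↔ ∀ a ∈ (layerPairs G r L i)[j].1, a ∉ q)
    (hfresh : ∀ t (v : Fin n), q.length + 1 ≤ t → s.arr 11 t v 0 = 0)
    (h30 : s.reg 30 = q.length) {w : Fin n} (h35 : s.reg 35 = w) (h33 : s.reg 33 = G.dist r w)
    (hsub : ∀ i A B, (A, B) ∈ layerPairs G r L i → A ⊆ layer G r i) :
    Placed G r L (q ++ [w]) (placeVertex.run s) := by
  set s₁ := (Program.put 9 (.reg 35) (.const 1)).run ((Program.put 5 (.reg 30) (.reg 35)).run s)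
    with hs₁
  have hp1 : Prepared G r L s₁ :=
    (hs.run (c := Program.put 5 (.reg 30) (.reg 35)) rfl).run rfl
  have hpairs1 : ∀ i, StoresPairs s₁ i (layerPairs G r L i) := fun i =>
    (hpairs i).congr rfl (fun _ _ => rfl) (fun _ _ => rfl)
  have h33' : s₁.reg 33 = G.dist r w := h33
  obtain ⟨hm1, hm2⟩ := markSatisfied_spec hp1.input (hpairs1 _) (length_layerPairs_le _)
    (w := w) h35
  rw [h33'] at hm1 hm2
  have hrun : placeVertex.run s = markSatisfied.run s₁ := rfl
  rw [hrun]
  have h10 : s₁.arr 10 = s.arr 10 := by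
    rw [hs₁, run_setCell, arr_writeCell_of_ne _ (by norm_num), run_setCell,
      arr_writeCell_of_ne _ (by norm_num)]
  rw [h10] at hm1 hm2
  refine ⟨hp1.run rfl, fun i => ?_, fun k hk => ?_, fun v => ?_, fun i j hj => ?_,
    fun t v ht => ?_⟩
  · refine (hpairs1 i).congr ?_ (fun _ _ => ?_) (fun _ _ => ?_)
    · rw [run_arr (a := 2) rfl]
    · rw [run_arr (a := 3) rfl]
    · rw [run_arr (a := 4) rfl]
  · rw [run_arr (c := markSatisfied) (a := 5) rfl, hs₁]
    simp only [run_setCell, arr_writeCell, Expr.eval, reg_writeCell, h30, h35]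
    norm_num
    rw [List.length_append, List.length_singleton] at hk
    rcases Nat.lt_succ_iff_lt_or_eq.1 hk with hk | rfl
    · rw [if_neg hk.ne, List.getElem_append_left hk, hstored k hk]
    · simp
  · rw [run_arr (c := markSatisfied) (a := 9) rfl, hs₁]
    simp only [run_setCell, arr_writeCell, Expr.eval, reg_writeCell, h30, h35]
    norm_num [Fin.val_inj]
    have := hplaced v
    grind
  · by_cases hi : i = G.dist r w
    · subst hi
      rw [hm2 j hj, hsat _ j hj]
      simp only [List.mem_append, List.mem_singleton, not_or]
      grind
    -- First components lie in their own layer, so placing `w` satisfies only pairs of the layer of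
    -- `w`.
    · rw [hm1 i j hi, hsat i j hj]
      have hw : w ∉ (layerPairs G r L i)[j].1 := fun h =>
        hi (hsub i _ _ (List.getElem_mem hj) h).symm
      simp only [List.mem_append, List.mem_singleton, not_or]
      grind
  · rw [run_arr (c := markSatisfied) (a := 11) rfl]
    exact hfresh t v (by simpa using ht)

/-- Array `5` gets the tie-breaker; register `3` gets `0` if the choice gets stuck in some layer. -/
def orderLayers : Program :=
  .loop 30 (.reg 0) (.ifEq (.reg 3) (.const 1)
    (.seq selectNext (.ifEq (.reg 35) (.reg 0) (.setReg 3 (.const 0)) placeVertex)) .skip)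

/-- A choice is never revised: placing a vertex can only satisfy further pairs, and getting stuck
proves that the layer has no one-before-all ordering. After that register `3` makes the remaining
rounds idle. -/
lemma orderLayers_spec (hc : G.Connected) {π : Fin n → Fin n → Prop} {s : State}
    (hs : Placed G r L [] s)
    (hR : ∀ i A B, (A, B) ∈ layerPairs G r L i ↔ OBARel G r π i A B) (h3 : s.reg 3 = 1) :
    ((orderLayers.run s).reg 3 ≠ 1 ∧ ∃ i, 1 ≤ i ∧ i ≤ depth G r ∧
      ¬ ∃ t, IsOBAOrdering (layer G r i) (OBARel G r π i) t) ∨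
    ((orderLayers.run s).reg 3 = 1 ∧ ∃ q, q.length = n ∧ IsGreedyPrefix G r (OBARel G r π) q ∧
      Placed G r L q (orderLayers.run s)) := by
  refine hs.prepared.input.run_loop (x := 30) (c := .ifEq (.reg 3) (.const 1)
    (.seq selectNext (.ifEq (.reg 35) (.reg 0) (.setReg 3 (.const 0)) placeVertex)) .skip) rfl (fun m s' =>
    (s'.reg 3 ≠ 1 ∧ ∃ i, 1 ≤ i ∧ i ≤ depth G r ∧
      ¬ ∃ t, IsOBAOrdering (layer G r i) (OBARel G r π i) t) ∨
    (s'.reg 3 = 1 ∧ ∃ q, q.length = m ∧ IsGreedyPrefix G r (OBARel G r π) q ∧ Placed G r L q s'))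
    (Or.inr ⟨h3, [], rfl, isGreedyPrefix_nil, hs⟩) ?_
  intro m s' hF hs' hI
  rcases hI with ⟨h3', hno⟩ | ⟨h3', q, hqm, hq, hp⟩
  · refine Or.inl ⟨?_, hno⟩
    rw [run_ifEq, if_neg (by simpa using h3')]
    simpa using h3'
  rw [run_ifEq, if_pos (by simpa using h3'), run_seq]
  have hp' : Placed G r L q (s'.writeReg 30 m) :=
    ⟨hp.prepared.writeReg _ _ (by norm_num),
      fun i => (hp.pairs i).congr rfl (fun _ _ => rfl) (fun _ _ => rfl), hp.stored, hp.placed, hp.satisfied, hp.fresh⟩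
  have hex := exists_notMem_of_length_lt_card (q := q) (by simp [hqm])
  obtain ⟨i, ⟨v₀, hv₀, hv₀i⟩, hlow, h33, hfresh, hcase⟩ :=
    selectNext_spec hc hp' (by simp [hqm]) hex
  have hpre : Prepared G r L (selectNext.run (s'.writeReg 30 m)) := hp'.prepared.run rfl
  have harr : ∀ a, selectNext.writesArr a = false →
    (selectNext.run (s'.writeReg 30 m)).arr a = s'.arr a := fun a h => run_arr h _
  have h3'' : (selectNext.run (s'.writeReg 30 m)).reg 3 = 1 := by
    rw [run_reg (c := selectNext) rfl]
    simpa using h3'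
  have h30 : (selectNext.run (s'.writeReg 30 m)).reg 30 = q.length := by
    rw [run_reg (c := selectNext) rfl]
    simpa using hqm.symm
  rw [run_ifEq]
  simp only [Expr.eval, hpre.input.card]
  rcases hcase with ⟨h35, hstuck⟩ | ⟨w, h35, hwq, hwi, hw⟩
  · rw [if_pos h35]
    refine Or.inl ⟨by simp, i, ?_, ?_, not_exists_isOBAOrdering hv₀i hv₀ fun v hv hvq => ?_⟩
    -- Getting stuck exhibits a pair of this layer, and layer `0` has none.
    · obtain ⟨A, B, hAB, -⟩ := hstuck v₀ hv₀ hv₀i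
      exact ((hR i A B).1 hAB).one_le
    · exact hv₀i ▸ dist_le_depth v₀
    · obtain ⟨A, B, hAB, h⟩ := hstuck v hvq hv
      exact ⟨A, B, (hR i A B).1 hAB, h⟩
  · rw [if_neg (by rw [h35]; exact w.2.ne)]
    refine Or.inr ⟨(run_reg (c := placeVertex) rfl _).trans h3'', q ++ [w], by simp [hqm], ?_, ?_⟩
    · refine hq.append hwq (hwi ▸ hlow) fun A B hAB hwB => hw A B ((hR i A B).2 (hwi ▸ hAB)) hwB
    · refine placeVertex_spec hpre (fun i => (hp.pairs i).congr ?_ (fun _ _ => ?_) (fun _ _ => ?_))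
        ?_ ?_ ?_ hfresh h30 h35 (h33.trans hwi.symm) (fun i A B h => ((hR i A B).1 h).left_subset)
      · rw [harr 2 rfl]
      · rw [harr 3 rfl]
      · rw [harr 4 rfl]
      · rw [harr 5 rfl]; exact hp.stored
      · rw [harr 9 rfl]; exact hp.placed
      · rw [harr 10 rfl]; exact hp.satisfied

end Machine

/-! ### Comparing labels step by step -/

section Labels

variable {V : Type*} {G : SimpleGraph V}

lemma before_append_of_mem [DecidableEq V] {q : List V} {w a z : V} (hz : z ∈ q) :
    Before (q ++ [w]) a z ↔ Before q a z :=
  (before_of_prefix (List.prefix_append q [w]) hz).symm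

/-- The number of `w` is larger than all earlier ones, so it breaks ties but never overturns a
comparison. Thus the order of the labels can be updated without looking at the labels. -/
lemma labelLess_label_append [Finite V] {q : List V} {w : V} (hq : (q ++ [w]).Nodup) (u v : V) :
    LabelLess (label G (q ++ [w]) v) (label G (q ++ [w]) u) ↔
      LabelLess (label G q v) (label G q u) ∨
        (¬ LabelLess (label G q u) (label G q v) ∧ G.Adj w u ∧ ¬ G.Adj w v) := by
  classical
  have hqn : q.Nodup := (List.nodup_append.1 hq).1
  have hwq : w ∉ q := fun h => (List.nodup_append.1 hq).2.2 w h w (by simp) rfl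
  have hbw : ∀ a, Before (q ++ [w]) a w ↔ a ∈ q := fun a => by
    unfold Before
    rw [List.idxOf_append_of_notMem hwq]
    by_cases ha : a ∈ q
    · rw [List.idxOf_append_of_mem ha]
      have := List.idxOf_lt_length_iff.2 ha
      simp only [ha, iff_true]
      omega
    · rw [List.idxOf_append_of_notMem ha]
      simp [ha]
  rw [labelLess_label_iff hq, labelLess_label_iff hqn, labelLess_label_iff hqn]
  constructor
  · rintro ⟨z, hz, hzu, hzv, hza⟩
    rw [List.mem_append, List.mem_singleton] at hz
    rcases hz with hz | rfl
    · exact Or.inl ⟨z, hz, hzu, hzv, fun a ha => hza a ((before_append_of_mem hz).2 ha)⟩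
    · refine Or.inr ⟨?_, hzu, hzv⟩
      rintro ⟨b, hb, hbv, hbu, -⟩
      exact hbu ((hza b ((hbw b).2 hb)).1 hbv)
  · rintro (⟨z, hz, hzu, hzv, hza⟩ | ⟨hn, hwu, hwv⟩)
    · exact ⟨z, List.mem_append_left _ hz, hzu, hzv,
        fun a ha => hza a ((before_append_of_mem hz).1 ha)⟩
    -- If `u` and `v` have the same neighbors in `q`, then `w` decides. Otherwise the leftmost
    -- disagreement decides, and `hn` excludes that it favors `v`.
    by_cases hagree : ∀ a ∈ q, (G.Adj a v ↔ G.Adj a u)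
    · exact ⟨w, by simp, hwu, hwv, fun a ha => hagree a ((hbw a).1 ha)⟩
    push Not at hagree
    obtain ⟨a₀, ha₀, hne₀⟩ := hagree
    obtain ⟨z, ⟨hz, hne⟩, hmin⟩ := exists_leftmost q
      (S := {a | a ∈ q ∧ ¬ (G.Adj a v ↔ G.Adj a u)}) ⟨a₀, ha₀, by tauto⟩ (fun a ha => ha.1)
    have hbefore : ∀ a, Before q a z → (G.Adj a v ↔ G.Adj a u) := fun a ha => by
      by_contra hcon
      have := hmin a ⟨ha.mem, hcon⟩ ha.ne
      unfold Before at this ha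
      omega
    by_cases hzu : G.Adj z u
    · exact ⟨z, List.mem_append_left _ hz, hzu, by tauto,
        fun a ha => hbefore a ((before_append_of_mem hz).1 ha)⟩
    · exact absurd ⟨z, hz, by tauto, hzu, fun a ha => (hbefore a ha).symm⟩ hn

lemma not_labelLess_label_nil (u v : V) : ¬ LabelLess (label G [] v) (label G [] u) := by
  classical
  rw [labelLess_label_iff List.nodup_nil]
  simp

end Labels

namespace Machine

variable {n : ℕ} {G : SimpleGraph (Fin n)} {r : Fin n} {L : List (Fin n × Fin n)}

/-! ### The search -/

/-- The memory contains the initial segment `q` of a search: array `6` holds the vertices, array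
`12` marks them, and array `13` holds the comparisons of labels in the current round. -/
structure Searched (G : SimpleGraph (Fin n)) (q : List (Fin n)) (s : State) : Prop where
  stored : ∀ k (h : k < q.length), s.arr 6 k 0 0 = (q[k] : ℕ)
  numbered : ∀ v : Fin n, s.arr 12 v 0 0 = 0 ↔ v ∉ q
  less : ∀ u v : Fin n, s.arr 13 q.length u v = 1 ↔ LabelLess (label G q v) (label G q u)
  fresh_less : ∀ t (u v : Fin n), q.length < t → s.arr 13 t u v = 0
  fresh : ∀ t (v : Fin n), q.length ≤ t → s.arr 14 t v 0 = 0

/-- Mark the vertices whose label is less than the one of the vertex in register `41`. -/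
def markSmaller : Program :=
  .loop 42 (.reg 0) (.ifEq (.cell 13 (.reg 40) (.reg 41) (.reg 42)) (.const 1)
    (.setCell 14 (.reg 40) (.reg 42) (.const 0) (.const 1)) .skip)

/-- Mark the vertices whose label is less than the one of another vertex without a number. -/
def markIneligible : Program :=
  .loop 41 (.reg 0) (.ifEq (.at 12 (.reg 41)) (.const 0) markSmaller .skip)

lemma markSmaller_spec {s : State} (hs : HasInput G r L s) :
    (∀ (t : ℕ) (v : Fin n), t ≠ s.reg 40 → (markSmaller.run s).arr 14 t v 0 = s.arr 14 t v 0) ∧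
    ∀ v : Fin n, (markSmaller.run s).arr 14 (s.reg 40) v 0 = 0 ↔
      s.arr 14 (s.reg 40) v 0 = 0 ∧ s.arr 13 (s.reg 40) (s.reg 41) v ≠ 1 := by
  suffices h : (∀ (t : ℕ) (v : Fin n), t ≠ s.reg 40 →
      (markSmaller.run s).arr 14 t v 0 = s.arr 14 t v 0) ∧
      ∀ v : Fin n, (markSmaller.run s).arr 14 (s.reg 40) v 0 = 0 ↔
        s.arr 14 (s.reg 40) v 0 = 0 ∧ ((v : ℕ) < n → s.arr 13 (s.reg 40) (s.reg 41) v ≠ 1) by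
    simpa using h
  refine hs.run_loop rfl (fun i s' => (∀ (t : ℕ) (v : Fin n), t ≠ s.reg 40 →
      s'.arr 14 t v 0 = s.arr 14 t v 0) ∧
      ∀ v : Fin n, s'.arr 14 (s.reg 40) v 0 = 0 ↔
        s.arr 14 (s.reg 40) v 0 = 0 ∧ ((v : ℕ) < i → s.arr 13 (s.reg 40) (s.reg 41) v ≠ 1))
    (by simp) ?_
  rintro i s' hF hs' ⟨hI1, hI2⟩
  have h40 : s'.reg 40 = s.reg 40 := hF.reg 40 rfl
  have h41 : s'.reg 41 = s.reg 41 := hF.reg 41 rfl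
  have h13 : s'.arr 13 = s.arr 13 := hF.arr 13 rfl
  simp only [run_ifEq, run_setCell, run_skip, Expr.eval, reg_writeReg, arr_writeReg, arr_writeCell,
    arr_ite, h40, h41, h13, lt_succ_iff_lt_or_eq_fin]
  norm_num [Fin.val_inj]
  refine ⟨fun t v ht => by simp [ht, hI1 t v ht], fun v => ?_⟩
  have := hI2 v
  grind

lemma markIneligible_spec {s : State} (hs : HasInput G r L s) {q : List (Fin n)}
    (hq : Searched G q s) (h40 : s.reg 40 = q.length) :
    (∀ (t : ℕ) (v : Fin n), t ≠ q.length →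
      (markIneligible.run s).arr 14 t v 0 = s.arr 14 t v 0) ∧
    ∀ v : Fin n, (markIneligible.run s).arr 14 q.length v 0 = 0 ↔
      ¬ ∃ u, u ∉ q ∧ LabelLess (label G q v) (label G q u) := by
  suffices h : (∀ (t : ℕ) (v : Fin n), t ≠ q.length →
      (markIneligible.run s).arr 14 t v 0 = s.arr 14 t v 0) ∧
      ∀ v : Fin n, (markIneligible.run s).arr 14 q.length v 0 = 0 ↔
        ¬ ∃ u : Fin n, (u : ℕ) < n ∧ u ∉ q ∧ LabelLess (label G q v) (label G q u) by
    simpa using h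
  refine hs.run_loop rfl (fun i s' => (∀ (t : ℕ) (v : Fin n), t ≠ q.length →
      s'.arr 14 t v 0 = s.arr 14 t v 0) ∧
      ∀ v : Fin n, s'.arr 14 q.length v 0 = 0 ↔
        ¬ ∃ u : Fin n, (u : ℕ) < i ∧ u ∉ q ∧ LabelLess (label G q v) (label G q u))
    (by simpa using fun v => hq.fresh _ v le_rfl) ?_
  rintro i s' hF hs' ⟨hI1, hI2⟩
  have h40' : s'.reg 40 = q.length := (hF.reg 40 rfl).trans h40
  have h12 : s'.arr 12 = s.arr 12 := hF.arr 12 rfl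
  have h13 : s'.arr 13 = s.arr 13 := hF.arr 13 rfl
  obtain ⟨hm1, hm2⟩ := markSmaller_spec (hs'.writeReg 41 i (by norm_num))
  simp only [reg_writeReg, arr_writeReg, h40', h13] at hm1 hm2
  norm_num [h40'] at hm1 hm2
  simp only [run_ifEq, run_skip, Expr.eval, reg_writeReg, arr_writeReg, arr_ite, h12,
    exists_lt_succ_iff]
  norm_num
  by_cases hi : i ∈ q
  · have : s.arr 12 i 0 0 ≠ 0 := fun h => (hq.numbered i).1 h hi
    simp only [if_neg this]
    refine ⟨hI1, fun v => ?_⟩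
    rw [hI2 v]
    grind
  · simp only [if_pos ((hq.numbered i).2 hi)]
    refine ⟨fun t v ht => (hm1 t v ht).trans (hI1 t v ht), fun v => ?_⟩
    rw [hm2, hI2, hq.less]
    grind

/-- Register `43` gets the leftmost vertex of the tie-breaker that is neither numbered nor marked,
or `n`. -/
def chooseLeftmost : Program :=
  .seq (.setReg 43 (.reg 0)) (.loop 42 (.reg 0)
    (.ifEq (.at 12 (.at 5 (.reg 42))) (.const 0)
      (.ifEq (.cell 14 (.reg 40) (.at 5 (.reg 42)) (.const 0)) (.const 0)
        (.ifEq (.reg 43) (.reg 0) (.setReg 43 (.at 5 (.reg 42))) .skip) .skip) .skip))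

/-- Array `5` is scanned from left to right. Register `43` holds `n` until the first success and is
not overwritten afterwards. -/
lemma chooseLeftmost_spec {s : State} (hs : HasInput G r L s) {ρ : List (Fin n)}
    (hρ : IsVertexOrdering ρ) (hρn : ρ.length = n)
    (h5 : ∀ k (h : k < ρ.length), s.arr 5 k 0 0 = (ρ[k] : ℕ)) {P : Fin n → Prop}
    (hP : ∀ v : Fin n, P v ↔ s.arr 12 v 0 0 = 0 ∧ s.arr 14 (s.reg 40) v 0 = 0)
    (hex : ∃ v, P v) :
    ∃ v : Fin n, (chooseLeftmost.run s).reg 43 = v ∧ P v ∧ ∀ w, P w → w ≠ v → Before ρ v w := by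
  have hs1 : HasInput G r L ((Program.setReg 43 (.reg 0)).run s) := hs.run rfl
  have key : ((chooseLeftmost.run s).reg 43 = n ∧ ∀ j (hj : j < ρ.length), j < n → ¬ P ρ[j]) ∨
      ∃ k, ∃ hk : k < ρ.length, (chooseLeftmost.run s).reg 43 = ρ[k] ∧ P ρ[k] ∧
        ∀ j (hj : j < k), ¬ P ρ[j] := by
    refine hs1.run_loop (x := 42) rfl (fun i s' =>
      (s'.reg 43 = n ∧ ∀ j (hj : j < ρ.length), j < i → ¬ P ρ[j]) ∨
      ∃ k, ∃ hk : k < ρ.length, s'.reg 43 = ρ[k] ∧ P ρ[k] ∧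
        ∀ j (hj : j < k), ¬ P ρ[j]) (by simp [hs.card]) ?_
    intro i s' hF hs' hI
    have hiρ : (i : ℕ) < ρ.length := by rw [hρn]; exact i.2
    have h40 : s'.reg 40 = s.reg 40 := hF.reg 40 rfl
    have ha5 : s'.arr 5 = s.arr 5 := hF.arr 5 rfl
    have h12 : s'.arr 12 = s.arr 12 := hF.arr 12 rfl
    have h14 : s'.arr 14 = s.arr 14 := hF.arr 14 rfl
    have h0 : s'.reg 0 = n := hs'.card
    simp only [run_ifEq, run_setReg, run_skip, Expr.eval, reg_writeReg, arr_writeReg, reg_ite,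
      h40, ha5, h12, h14, h0]
    norm_num [h5 i hiρ]
    have hPi := hP ρ[(i : ℕ)]
    rcases hI with ⟨h1, h2⟩ | ⟨k, hk, h1, h2⟩
    · by_cases hi : P ρ[(i : ℕ)]
      · obtain ⟨h3, h4⟩ := hPi.1 hi
        rw [if_pos h3, if_pos h4, if_pos h1]
        exact Or.inr ⟨i, hiρ, rfl, hi, fun j hj => h2 j (by omega) hj⟩
      · refine Or.inl ⟨?_, fun j hj hji => ?_⟩
        · grind
        · rcases Nat.lt_succ_iff_lt_or_eq.1 (Nat.lt_succ_of_le hji) with h | rfl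
          · exact h2 j hj h
          · exact hi
    · refine Or.inr ⟨k, hk, ?_, h2⟩
      have : s'.reg 43 ≠ n := by
        rw [h1]
        exact ρ[k].2.ne
      grind
  rcases key with ⟨-, h⟩ | ⟨k, hk, h1, h2, h3⟩
  · obtain ⟨v, hv⟩ := hex
    obtain ⟨j, hj, rfl⟩ := List.mem_iff_getElem.1 (hρ.2 v)
    exact absurd hv (h j hj (hρn ▸ hj))
  · refine ⟨ρ[k], h1, h2, fun w hw hne => ?_⟩
    obtain ⟨j, hj, rfl⟩ := List.mem_iff_getElem.1 (hρ.2 w)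
    unfold Before
    rw [hρ.1.idxOf_getElem, hρ.1.idxOf_getElem]
    rcases lt_trichotomy j k with h | rfl | h
    · exact absurd hw (h3 j h)
    · exact absurd rfl hne
    · exact h

/-- Compare the new label of the vertex in register `41` with the other new labels. -/
def compareWith : Program :=
  .loop 42 (.reg 0) (.ifEq (.cell 13 (.reg 40) (.reg 41) (.reg 42)) (.const 1)
    (.setCell 13 (.succ (.reg 40)) (.reg 41) (.reg 42) (.const 1))
    (.ifEq (.cell 13 (.reg 40) (.reg 42) (.reg 41)) (.const 1) .skip
      (.ifEq (.cell 0 (.reg 43) (.reg 41) (.const 0)) (.const 1)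
        (.ifEq (.cell 0 (.reg 43) (.reg 42) (.const 0)) (.const 1) .skip
          (.setCell 13 (.succ (.reg 40)) (.reg 41) (.reg 42) (.const 1))) .skip)))

/-- Compare the labels after the vertex in register `43` has been numbered. -/
def compareLabels : Program := .loop 41 (.reg 0) compareWith

/-- The rule is that of `labelLess_label_append`. Row `s.reg 40` is only read and row `s.reg 40 + 1`
only written, so the comparisons do not interfere. -/
lemma compareWith_spec {s : State} (hs : HasInput G r L s) {w x : Fin n} (hw : s.reg 43 = w)
    (hx : s.reg 41 = x) :
    (∀ t (u v : Fin n), t ≠ s.reg 40 + 1 ∨ u ≠ x →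
      (compareWith.run s).arr 13 t u v = s.arr 13 t u v) ∧
    ∀ v : Fin n, (compareWith.run s).arr 13 (s.reg 40 + 1) x v = 1 ↔
      s.arr 13 (s.reg 40 + 1) x v = 1 ∨ s.arr 13 (s.reg 40) x v = 1 ∨
        (s.arr 13 (s.reg 40) v x ≠ 1 ∧ G.Adj w x ∧ ¬ G.Adj w v) := by
  suffices h : (∀ t (u v : Fin n), t ≠ s.reg 40 + 1 ∨ u ≠ x →
      (compareWith.run s).arr 13 t u v = s.arr 13 t u v) ∧
      ∀ v : Fin n, (compareWith.run s).arr 13 (s.reg 40 + 1) x v = 1 ↔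
        s.arr 13 (s.reg 40 + 1) x v = 1 ∨ ((v : ℕ) < n ∧ (s.arr 13 (s.reg 40) x v = 1 ∨
        (s.arr 13 (s.reg 40) v x ≠ 1 ∧ G.Adj w x ∧ ¬ G.Adj w v))) by
    simpa using h
  refine hs.run_loop rfl (fun i s' => (∀ t (u v : Fin n), t ≠ s.reg 40 + 1 ∨ u ≠ x →
      s'.arr 13 t u v = s.arr 13 t u v) ∧
      ∀ v : Fin n, s'.arr 13 (s.reg 40 + 1) x v = 1 ↔
        s.arr 13 (s.reg 40 + 1) x v = 1 ∨ ((v : ℕ) < i ∧ (s.arr 13 (s.reg 40) x v = 1 ∨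
        (s.arr 13 (s.reg 40) v x ≠ 1 ∧ G.Adj w x ∧ ¬ G.Adj w v)))) (by simp) ?_
  rintro i s' hF hs' ⟨hI1, hI2⟩
  have h40 : s'.reg 40 = s.reg 40 := hF.reg 40 rfl
  have h41 : s'.reg 41 = x := (hF.reg 41 rfl).trans hx
  have h43 : s'.reg 43 = w := (hF.reg 43 rfl).trans hw
  have h1 := hI1 (s.reg 40) x i (Or.inl (by omega))
  have h2 := hI1 (s.reg 40) i x (Or.inl (by omega))
  simp only [run_ifEq, run_setCell, run_skip, Expr.eval, reg_writeReg, arr_writeReg, arr_writeCell,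
    arr_ite, h40, h41, h43, lt_succ_iff_lt_or_eq_fin]
  norm_num [Fin.val_inj, hs'.adj, h1, h2]
  constructor
  · intro t u v htu
    have := hI1 t u v htu
    have : ¬ (t = s.reg 40 + 1 ∧ u = x ∧ v = i) := by tauto
    simp [this, hI1 t u v htu]
  · intro v
    have := hI2 v
    by_cases hvi : v = i
    · subst hvi
      simp only [← hs'.adj] at this ⊢
      split_ifs <;> simp_all
    · simp [hvi, this]

lemma compareLabels_spec {s : State} (hs : HasInput G r L s) {w : Fin n} (hw : s.reg 43 = w)
    (h0 : ∀ u v : Fin n, s.arr 13 (s.reg 40 + 1) u v = 0) :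
    (∀ t (u v : Fin n), t ≠ s.reg 40 + 1 →
      (compareLabels.run s).arr 13 t u v = s.arr 13 t u v) ∧
    ∀ u v : Fin n, (compareLabels.run s).arr 13 (s.reg 40 + 1) u v = 1 ↔
      s.arr 13 (s.reg 40) u v = 1 ∨
        (s.arr 13 (s.reg 40) v u ≠ 1 ∧ G.Adj w u ∧ ¬ G.Adj w v) := by
  suffices h : (∀ t (u v : Fin n), t ≠ s.reg 40 + 1 →
      (compareLabels.run s).arr 13 t u v = s.arr 13 t u v) ∧
      ∀ u v : Fin n, (compareLabels.run s).arr 13 (s.reg 40 + 1) u v = 1 ↔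
        (u : ℕ) < n ∧ (s.arr 13 (s.reg 40) u v = 1 ∨
          (s.arr 13 (s.reg 40) v u ≠ 1 ∧ G.Adj w u ∧ ¬ G.Adj w v)) by
    simpa using h
  refine hs.run_loop (x := 41) (c := compareWith) rfl (fun i s' =>
      (∀ t (u v : Fin n), t ≠ s.reg 40 + 1 → s'.arr 13 t u v = s.arr 13 t u v) ∧
      ∀ u v : Fin n, s'.arr 13 (s.reg 40 + 1) u v = 1 ↔
        (u : ℕ) < i ∧ (s.arr 13 (s.reg 40) u v = 1 ∨
          (s.arr 13 (s.reg 40) v u ≠ 1 ∧ G.Adj w u ∧ ¬ G.Adj w v))) (by simp [h0]) ?_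
  rintro i s' hF hs' ⟨hI1, hI2⟩
  have h40 : s'.reg 40 = s.reg 40 := hF.reg 40 rfl
  have h43 : s'.reg 43 = w := (hF.reg 43 rfl).trans hw
  obtain ⟨hm1, hm2⟩ := compareWith_spec (hs'.writeReg 41 i (by norm_num)) (w := w) (x := i)
    (by simpa using h43) (by simp)
  simp only [reg_writeReg, arr_writeReg] at hm1 hm2
  norm_num [h40] at hm1 hm2
  refine ⟨fun t u v ht => (hm1 t u v (Or.inl ht)).trans (hI1 t u v ht), fun u v => ?_⟩
  rw [lt_succ_iff_lt_or_eq_fin]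
  rcases eq_or_ne u i with rfl | hui
  · rw [hm2, hI2, hI1 _ _ _ (by omega), hI1 _ _ _ (by omega)]
    simp
  · rw [hm1 _ _ _ (Or.inr hui), hI2]
    simp [hui]

/-- Array `6` gets the search ordering for the tie-breaker in array `5`. -/
def search : Program :=
  .loop 40 (.reg 0) (.seq markIneligible (.seq chooseLeftmost
    (.seq (.put 6 (.reg 40) (.reg 43)) (.seq (.put 12 (.reg 43) (.const 1)) compareLabels))))

lemma search_spec {s : State} (hs : HasInput G r L s) {ρ : List (Fin n)}
    (hρ : IsVertexOrdering ρ) (hρn : ρ.length = n)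
    (h5 : ∀ k (h : k < ρ.length), s.arr 5 k 0 0 = (ρ[k] : ℕ)) (h0 : Searched G [] s) :
    ∃ σ, IsLBFSPlusOrdering G ρ σ ∧ Searched G σ (search.run s) := by
  have key : ∃ q : List (Fin n), q.length = n ∧ IsPlusPrefix G ρ q ∧
      Searched G q (search.run s) := by
    refine hs.run_loop (x := 40) (c := .seq markIneligible (.seq chooseLeftmost
      (.seq (.put 6 (.reg 40) (.reg 43)) (.seq (.put 12 (.reg 43) (.const 1)) compareLabels)))) rfl
      (fun m s' => ∃ q : List (Fin n), q.length = m ∧ IsPlusPrefix G ρ q ∧ Searched G q s')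
      ⟨[], rfl, ⟨List.nodup_nil, fun p v hp => by simp at hp⟩, h0⟩ ?_
    rintro m s' hF hs' ⟨q, hqm, hq, hS⟩
    have hex := exists_notMem_of_length_lt_card (q := q) (by simp [hqm])
    simp only [run_seq]
    have hs1 : HasInput G r L (s'.writeReg 40 m) := hs'.writeReg _ _ (by norm_num)
    have hS1 : Searched G q (s'.writeReg 40 m) :=
      ⟨hS.stored, hS.numbered, hS.less, hS.fresh_less, hS.fresh⟩
    obtain ⟨hm1, hm2⟩ := markIneligible_spec hs1 hS1 (by simp [hqm])
    set s₁ := markIneligible.run (s'.writeReg 40 m) with hs₁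
    have hs2 : HasInput G r L s₁ := hs1.run rfl
    have ha : ∀ a, markIneligible.writesArr a = false → s₁.arr a = s'.arr a := fun a h => run_arr h _
    have h40 : s₁.reg 40 = q.length := by
      rw [hs₁, run_reg rfl]
      simp [hqm]
    obtain ⟨w, hw, hwe, hmin⟩ := chooseLeftmost_spec hs2 hρ hρn
      (by rw [ha 5 rfl, hF.arr 5 rfl]; exact h5) (P := Eligible G q)
      (fun v => by rw [h40, hm2, ha 12 rfl, hS.numbered]; rfl) (exists_eligible q hex)
    have hq' := hq.append hwe hmin
    set s₂ := chooseLeftmost.run s₁ with hs₂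
    have hs3 : HasInput G r L s₂ := hs2.run rfl
    have hb : ∀ a, chooseLeftmost.writesArr a = false → s₂.arr a = s₁.arr a :=
      fun a h => run_arr h _
    have h40' : s₂.reg 40 = q.length := (run_reg (c := chooseLeftmost) rfl s₁).trans h40
    set s₃ := (Program.put 12 (.reg 43) (.const 1)).run
      ((Program.put 6 (.reg 40) (.reg 43)).run s₂) with hs₃
    have hs4 : HasInput G r L s₃ :=
      (hs3.run (c := Program.put 6 (.reg 40) (.reg 43)) rfl).run rfl
    have h13 : s₃.arr 13 = s'.arr 13 := by
      rw [hs₃, run_arr rfl, run_arr rfl, hb 13 rfl, ha 13 rfl]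
    have h14 : s₃.arr 14 = s₁.arr 14 := by
      rw [hs₃, run_arr rfl, run_arr rfl, hb 14 rfl]
    have h40'' : s₃.reg 40 = q.length := h40'
    obtain ⟨hc1, hc2⟩ := compareLabels_spec hs4 (w := w) hw (fun u v => by
      rw [h13, h40'']
      exact hS.fresh_less _ u v (by omega))
    rw [h13, h40''] at hc1 hc2
    have h6 : (compareLabels.run s₃).arr 6 = s₃.arr 6 := run_arr rfl _
    have h12 : (compareLabels.run s₃).arr 12 = s₃.arr 12 := run_arr rfl _
    have h14' : (compareLabels.run s₃).arr 14 = s₁.arr 14 := (run_arr rfl _).trans h14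
    refine ⟨q ++ [w], by simp [hqm], hq', fun k hk => ?_, fun v => ?_, fun u v => ?_,
      fun t u v ht => ?_, fun t v ht => ?_⟩
    · rw [h6, hs₃]
      simp only [run_setCell, arr_writeCell, Expr.eval, reg_writeCell, h40', hw]
      norm_num
      rw [List.length_append, List.length_singleton] at hk
      rcases Nat.lt_succ_iff_lt_or_eq.1 hk with hk | rfl
      · rw [if_neg hk.ne, List.getElem_append_left hk, hb 6 rfl, ha 6 rfl, hS.stored k hk]
      · simp
    · rw [h12, hs₃]
      simp only [run_setCell, arr_writeCell, Expr.eval, reg_writeCell, h40', hw]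
      norm_num [Fin.val_inj]
      rw [hb 12 rfl, ha 12 rfl]
      have := hS.numbered v
      grind
    · rw [List.length_append, List.length_singleton, hc2, hS.less, ne_eq, hS.less,
        labelLess_label_append hq'.1]
    · rw [List.length_append, List.length_singleton] at ht
      rw [hc1 t u v (by omega)]
      exact hS.fresh_less t u v (by omega)
    · rw [List.length_append, List.length_singleton] at ht
      rw [h14', hm1 t v (by omega)]
      exact hS.fresh t v (by omega)
  obtain ⟨q, hqn, hq, hS⟩ := key
  exact ⟨q, ⟨⟨hq.1, hq.1.mem_of_length_eq_card (by simpa using hqn)⟩, hq.2⟩, hS⟩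

/-! ### The whole program -/

/-- Compute the distances and the numbers of parents. -/
def prepare : Program := .seq computeDist countParents

/-- Compute the pairs of all layers. -/
def storePairs : Program := .seq storeBase deriveLayers

/-- Order the layers and search if this succeeds. -/
def solve : Program := .seq orderLayers (.ifEq (.reg 3) (.const 1) search .skip)

/-- The implementation of the algorithm. -/
def psopProgram : Program :=
  .seq prepare (.seq checkLayers (.ifEq (.reg 3) (.const 1) (.seq storePairs solve) .skip))

lemma input_arr_eq_zero {a : ℕ} (ha : 2 ≤ a) (i j k : ℕ) : (input G r L).arr a i j k = 0 := by
  simp only [input]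
  rw [if_neg (by omega), if_neg (by omega)]

lemma prepare_spec (hc : G.Connected) : Prepared G r L (prepare.run (input G r L)) := by
  have h1 : HasInput G r L (computeDist.run (input G r L)) := (hasInput_input G r L).run rfl
  have h2 := computeDist_spec hc (hasInput_input G r L) (fun v => input_arr_eq_zero (by norm_num) ..)
  have h3 := countParents_spec h1 h2 (fun j => by
    rw [run_arr rfl]
    exact input_arr_eq_zero (by norm_num) ..)
  refine ⟨h1.run (c := countParents) rfl, fun v => ?_, h3.1, h3.2⟩
  rw [prepare, run_seq, run_arr (c := countParents) rfl, h2]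

lemma storePairs_spec (hc : G.Connected) (hG : IsChordalBipartite G) {π : Fin n → Fin n → Prop}
    (hL : ∀ x y, (x, y) ∈ L ↔ π x y) {s : State} (hs : Prepared G r L s)
    (h0 : ∀ a i j k, 2 ≤ a → a ≤ 4 → s.arr a i j k = 0) (i : ℕ) :
    StoresPairs (storePairs.run s) i (layerPairs G r L i) := by
  have h1 := storeBase_spec hs.input hs.dist fun i =>
    ⟨h0 2 i 0 0 le_rfl (by norm_num), fun j hj => absurd hj (by simp),
      fun j hj => absurd hj (by simp), fun j _ v => h0 3 i j v (by norm_num) (by norm_num),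
      fun j _ v => h0 4 i j v (by norm_num) (by norm_num)⟩
  exact deriveLayers_spec hc hG hL (hs.run (c := storeBase) rfl) h1 i

lemma storesList_of_getElem {s : State} {a : ℕ} {σ : List (Fin n)} (hσ : σ.length = n)
    (h : ∀ k (hk : k < σ.length), s.arr a k 0 0 = (σ[k] : ℕ)) : StoresList s a σ := by
  refine List.ext_getElem (by simp [hσ]) fun k h1 h2 => ?_
  simp only [List.getElem_map, List.getElem_range]
  exact (h k (by simpa using h1)).symm

lemma length_eq_of_isVertexOrdering {σ : List (Fin n)} (hσ : IsVertexOrdering σ) :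
    σ.length = n := by
  rw [← List.toFinset_card_of_nodup hσ.1,
    Finset.eq_univ_iff_forall.2 fun v => List.mem_toFinset.2 (hσ.2 v), Finset.card_univ,
    Fintype.card_fin]

lemma solve_spec (hc : G.Connected) {π : Fin n → Fin n → Prop} (hv : ¬ ViolatesLayers G r π)
    {s : State} (hs : Prepared G r L s) (hpairs : ∀ i, StoresPairs s i (layerPairs G r L i))
    (hR : ∀ i A B, (A, B) ∈ layerPairs G r L i ↔ OBARel G r π i A B) (h3 : s.reg 3 = 1)
    (h0 : ∀ a i j k, 9 ≤ a → a ≤ 14 → s.arr a i j k = 0) :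
    (¬ Accepts (solve.run s) ∧ PSOPAlgorithm G r π none) ∨
      (Accepts (solve.run s) ∧ ∃ ρ σ, PSOPAlgorithm G r π (some (ρ, σ)) ∧
        StoresList (solve.run s) 5 ρ ∧ StoresList (solve.run s) 6 σ) := by
  have h := orderLayers_spec hc (s := s) ⟨hs, hpairs, fun k hk => absurd hk (by simp),
    fun v => by simp [h0], fun i j hj => by simp [h0], fun t v _ => by simp [h0]⟩ hR h3
  rw [solve, run_seq, run_ifEq]
  rcases h with ⟨h4, i, hi, hik, hno⟩ | ⟨h4, q, hqn, hq, hp⟩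
  · rw [if_neg (show ¬ (Expr.reg 3).eval (orderLayers.run s) = (Expr.const 1).eval _ from h4)]
    exact Or.inl ⟨h4, .rejectOBA hv i hi hik hno⟩
  · rw [if_pos (show (Expr.reg 3).eval (orderLayers.run s) = (Expr.const 1).eval _ from h4)]
    have hall : IsVertexOrdering q := ⟨hq.1, hq.1.mem_of_length_eq_card (by simpa using hqn)⟩
    have hz : ∀ a i j k, 9 ≤ a → a ≤ 14 → orderLayers.writesArr a = false →
        (orderLayers.run s).arr a i j k = 0 := fun a i j k h h14 h' => by
      rw [run_arr h', h0 a i j k h h14]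
    obtain ⟨σ, hσ, hS⟩ := search_spec hp.prepared.input hall hqn hp.stored
      ⟨fun k hk => absurd hk (by simp), fun v => by simp [hz 12 _ _ _ (by norm_num) (by norm_num) rfl],
        fun u v => by simp [hz 13 _ _ _ (by norm_num) (by norm_num) rfl, not_labelLess_label_nil],
        fun t u v _ => hz 13 _ _ _ (by norm_num) (by norm_num) rfl, fun t v _ => hz 14 _ _ _ (by norm_num) (by norm_num) rfl⟩
    refine Or.inr ⟨(run_reg (c := search) rfl _).trans h4, q, σ, ?_,
      storesList_of_getElem hqn fun k hk => ?_,
      storesList_of_getElem (length_eq_of_isVertexOrdering hσ.1) hS.stored⟩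
    -- The stored greedy list is rewritten as a concatenation of its layers, the form of a
    -- tie-breaker in the algorithm.
    · have hcat := hq.eq_concatLayers hc hall.2
      have key := PSOPAlgorithm.accept hv (fun i => q.filter fun v => G.dist r v = i) σ
        (fun i _ _ => hq.isOBAOrdering_filter hall.2 fun A B h =>
          ⟨h.left_subset, h.right_subset⟩) (by rwa [← hcat])
      rwa [← hcat] at key
    · rw [run_arr (c := search) rfl]
      exact hp.stored k hk

lemma psopProgram_spec (hc : G.Connected) (hG : IsChordalBipartite G) {π : Fin n → Fin n → Prop}
    (hL : ∀ x y, (x, y) ∈ L ↔ π x y) : DocumentsRun G r π (psopProgram.run (input G r L)) := by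
  have hs := prepare_spec (L := L) (r := r) hc
  have h3 := checkLayers_spec hL hs.input hs.dist
  have hs' : Prepared G r L (checkLayers.run (prepare.run (input G r L))) := hs.run rfl
  have h0 : ∀ a i j k, 2 ≤ a → prepare.writesArr a = false →
      (checkLayers.run (prepare.run (input G r L))).arr a i j k = 0 := fun a i j k h h' => by
    rw [run_arr (c := checkLayers) rfl, run_arr h', input_arr_eq_zero h]
  rw [psopProgram, run_seq, run_seq, run_ifEq]
  by_cases hv : ViolatesLayers G r π
  · have h4 : ¬ (checkLayers.run (prepare.run (input G r L))).reg 3 = 1 := fun h => h3.1 h hv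
    rw [if_neg (show ¬ (Expr.reg 3).eval _ = (Expr.const 1).eval _ from h4)]
    exact ⟨fun h => absurd hv h, Or.inl ⟨h4, .rejectLayers hv⟩⟩
  · rw [if_pos (show (Expr.reg 3).eval _ = (Expr.const 1).eval _ from h3.2 hv), run_seq]
    have hR : ∀ i A B, (A, B) ∈ layerPairs G r L i ↔ OBARel G r π i A B :=
      fun i A B => mem_layerPairs hc hL
    have hpairs := storePairs_spec hc hG hL hs' (fun a i j k h2 h4 => h0 a i j k h2 (by
      interval_cases a <;> rfl))
    refine ⟨fun _ i _ _ => ?_, solve_spec hc hv (hs'.run (c := storePairs) rfl) hpairs hR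
      ((run_reg (c := storePairs) rfl _).trans (h3.2 hv)) fun a i j k h9 h14 => ?_⟩
    · refine StoresPairs.storesRelation ((hpairs i).congr ?_ (fun _ _ => ?_) (fun _ _ => ?_)) (hR i)
      · rw [run_arr (c := solve) (a := 2) rfl]
      · rw [run_arr (c := solve) (a := 3) rfl]
      · rw [run_arr (c := solve) (a := 4) rfl]
    · rw [run_arr (c := storePairs) (by interval_cases a <;> rfl)]
      exact h0 a i j k (by omega) (by interval_cases a <;> rfl)

/-- By reflexivity the `n` tuples `(v, v)` belong to `π`. This brings the cubic parts of the program
within the time bound. -/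
lemma card_le_length {π : Fin n → Fin n → Prop} (hπ : ∀ v, π v v)
    (hL : ∀ x y, (x, y) ∈ L ↔ π x y) : n ≤ L.length := by
  have h : (Finset.univ.image fun v : Fin n => (v, v)) ⊆ L.toFinset := by
    intro p hp
    obtain ⟨v, -, rfl⟩ := Finset.mem_image.1 hp
    exact List.mem_toFinset.2 ((hL v v).2 (hπ v))
  have h1 := (Finset.card_le_card h).trans L.toFinset_card_le
  rwa [Finset.card_image_of_injective _ fun u v h => (Prod.mk.inj h).1, Finset.card_univ,
    Fintype.card_fin] at h1

lemma psopProgram_cost (r : Fin n) (h : n ≤ L.length) :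
    (psopProgram.exec (input G r L)).2 ≤ psopProgram.size * L.length * n ^ 2 := by
  -- Loops are nested at most three deep: two of them run up to `n` and the third up to `n` or
  -- `|π|`. The root guarantees `n ≥ 1`.
  have h1 := (cost_le_of_fits (c := psopProgram) (d := 2) (b := true) (by rfl)
    (Fin.pos r) h (hasInput_input G r L).card (hasInput_input G r L).tuples).1
  rw [if_pos rfl] at h1
  linarith

end Machine

/-- The first part says that the algorithm, whatever one-before-all orderings it chooses, has a result
and that every result is right. The second part says that one program carries out the algorithm
on all inputs within the time bound; the partial order is given as a list of its tuples, so `|π|` is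
the length of this list. -/
theorem mainTheorem1 :
    (∀ (V : Type*) [Fintype V] [DecidableEq V] (G : SimpleGraph V) (r : V) (π : V → V → Prop),
      G.Connected → IsChordalBipartite G → IsPartialOrder V π →
        (∃ o, PSOPAlgorithm G r π o) ∧
        (PSOPAlgorithm G r π none → ¬ ∃ σ, IsRootedLBFSExtension G r π σ) ∧
        (∀ ρ σ, PSOPAlgorithm G r π (some (ρ, σ)) → IsRootedLBFSExtension G r π σ)) ∧
    (∃ (P : Machine.Program) (C : ℕ),
      ∀ (n : ℕ) (G : SimpleGraph (Fin n)) (r : Fin n) (π : Fin n → Fin n → Prop)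
        (L : List (Fin n × Fin n)),
        G.Connected → IsChordalBipartite G → IsPartialOrder (Fin n) π →
        L.Nodup → (∀ x y, (x, y) ∈ L ↔ π x y) →
          (P.exec (Machine.input G r L)).2 ≤ C * L.length * n ^ 2 ∧
          (Machine.Accepts (P.exec (Machine.input G r L)).1 ↔
            ∃ σ, IsRootedLBFSExtension G r π σ) ∧
          Machine.DocumentsRun G r π (P.exec (Machine.input G r L)).1) := by
  refine ⟨fun V _ _ G r π hc hG _ => ⟨PSOPAlgorithm.exists_result hc,
    PSOPAlgorithm.not_exists_of_reject hc hG, fun ρ σ => PSOPAlgorithm.isRootedLBFSExtension hc hG.1⟩,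
    Machine.psopProgram, Machine.psopProgram.size, fun n G r π L hc hG hπ _ hL => ?_⟩
  have hdoc : Machine.DocumentsRun G r π (Machine.psopProgram.run (Machine.input G r L)) :=
    Machine.psopProgram_spec hc hG hL
  refine ⟨Machine.psopProgram_cost r (Machine.card_le_length (fun v => hπ.refl v) hL), ?_, hdoc⟩
  rcases hdoc.2 with ⟨hacc, hres⟩ | ⟨hacc, ρ, σ, hres, -, -⟩
  · exact iff_of_false hacc (PSOPAlgorithm.not_exists_of_reject hc hG hres)
  · exact iff_of_true hacc ⟨σ, PSOPAlgorithm.isRootedLBFSExtension hc hG.1 hres⟩
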